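/- Let $w$ be an indeterminate. A Diophantine triple over $\mathbb{Q}(w)$ is a set of three distinct non-zero elements $q_1,q_2,q_3\in\mathbb{Q}(w)$ such that $q_iq_j+1$ is a square in $\mathbb{Q}(w)$ for all $i<j$. The curve induced by it is $E: y^2=(q_1x+1)(q_2x+1)(q_3x+1)$; with $X=q_1q_2q_3x$, $Y=q_1q_2q_3y$ it has the Weierstrass form $Y^2=(X+q_2q_3)(X+q_1q_3)(X+q_1q_2)$. **Theorem.** In each of the cases 1, 2, 3 below, $\{q_1,q_2,q_3\}$ is a Diophantine triple over $\mathbb{Q}(w)$, and the curve $E$ it induces is an elliptic curve which is isomorphic over $\mathbb{Q}(w)$ to $Y^2=X^3+A(w)X^2+B(w)X$. The torsion subgroup of $E(\mathbb{Q}(w))$ is isomorphic to $\mathbb{Z}/2\mathbb{Z}\times\mathbb{Z}/6\mathbb{Z}$, and the rank of $E$ over $\mathbb{Q}(w)$ is exactly $2$. Moreover $x_1(w)$ and $x_2(w)$ are the $X$-coordinates of two independent $\mathbb{Q}(w)$-rational points of infinite order on $Y^2=X^3+A(w)X^2+B(w)X$. **Case 1.** $$q_1=-\frac{(w-7)(w-2)(w+1)(w+2)(w^2+6w-1)}{6(w-1)(w+3)(2w+1)(w^2-2w-5)},\qquad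 q_2=\frac{9(w-1)(w+3)(2w+1)(w^2-2w-5)}{2(w-7)(w-2)(w+1)(w+2)(w^2+6w-1)},$$ $$q_3=-\frac{(w^2-2w-5)(w^2+6w-1)(w^4-12w^3-26w^2+36w+37)}{6(w-7)(w-2)(w-1)(w+1)(w+2)(w+3)(2w+1)},$$ $$\begin{aligned}A={}&185257+401184w+530914w^2+1218012w^3+1041238w^4-925272w^5-1369658w^6+53676w^7+519130w^8\\&+93984w^9-59978w^{10}-12924w^{11}+3286w^{12}+792w^{13}-14w^{14}-12w^{15}+w^{16},\end{aligned}$$ $$B=27(w-7)^3(w-2)^3(w-1)^3(w+1)^3(w+2)^3(w+3)^3(2w+1)^3(w^4+6w^3+19w^2+10)(2w^4-6w^3-7w^2+36w+47),$$ $$x_1=-27(w-7)^2(w-2)^2(w-1)^2(w+1)^2(w+2)^2(w+3)^2(2w+1)^2,$$ $$x_2=-\frac{4(w-7)^2(w-2)^2(w-1)(w+1)^2(w+2)^2(w+3)(2w+1)(w^4+6w^3+19w^2+10)(2w^4-6w^3-7w^2+36w+47)}{(w^2+6w-1)^2}.$$ **Case 2.** $$q_1=-\frac{(w^2-2)(w^2-6w+1)(w^2+6w-5)}{6(w-1)(w+3)(2w-1)(w^2-2w-1)},\qquad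 q_2=\frac{9(w-1)(w+3)(2w-1)(w^2-2w-1)}{2(w^2-2)(w^2-6w+1)(w^2+6w-5)},$$ $$q_3=-\frac{(w^2-2w-1)(w^2+6w-5)(w^4-12w^3-10w^2+36w-11)}{6(w-1)(w+3)(2w-1)(w^2-2)(w^2-6w+1)},$$ $$\begin{aligned}A={}&3517-26568w+74462w^2-102612w^3+138610w^4-283680w^5+346730w^6-107316w^7-122138w^8\\&+84648w^9+7418w^{10}-15084w^{11}+1690w^{12}+576w^{13}+14w^{14}-12w^{15}+w^{16},\end{aligned}$$ $$B=27(w-1)^3(w+3)^3(2w-1)^3(w^2-2)^3(w^2-6w+1)^3(w^4+6w^3+17w^2-36w+16)(2w^4-6w^3+7w^2+5),$$ $$x_1=-27(w-1)^2(w+3)^2(2w-1)^2(w^2-2)^2(w^2-6w+1)^2,$$ $$x_2=-\frac{4(w-1)(w+3)(2w-1)(w^2-2)^3(w^2-6w+1)^3(2w^4-6w^3+7w^2+5)}{(w^2-2w-1)^2}.$$ **Case 3.** $$q_1=-\frac{18(w-1)(w+1)(2w+3)(w^2-2w-4)(w^2+2w+2)}{(w^2-2)(w^2-12w-14)(w^4+12w^3+20w^2-8)},$$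 $$q_2=-\frac{(w^2-2)^2(w^2-12w-14)^2(w^2+2w+2)}{6(w-1)(w+1)(2w+3)(w^2-2w-4)(w^4+12w^3+20w^2-8)},$$ $$q_3=-\frac{(w^2-2w-4)(w^4+12w^3+20w^2-8)^2}{6(w-1)(w+1)(2w+3)(w^2-2)(w^2-12w-14)(w^2+2w+2)},$$ $$\begin{aligned}A={}&-1899008-5996544w-1469440w^2+13980672w^3+14383360w^4-6990336w^5-16274176w^6-3491328w^7\\&+5554240w^8+2814336w^9-219616w^{10}-160416w^{11}+120808w^{12}+38928w^{13}-856w^{14}+w^{16},\end{aligned}$$ $$B=3456(w-1)^3(w+1)^3(2w+3)^3(w^2-2)^3(w^2-12w-14)^3(w^4+2w^2+12w+10)(w^4+36w^3+56w^2-24w-44),$$ $$x_1=\frac{108(w-1)^2(w+1)^2(2w+3)^2(w^2-2)^3(w^2-12w-14)^3(w^2+2w+2)^2}{(w^4+2w^2+12w+10)^2},$$ $$x_2=-27(w-1)(w+1)(2w+3)(w^2-2)^2(w^2-12w-14)^2(w^2-2w-4)^2.$$ -/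

import Mathlib

namespace DiophantineCurves

/-- Three distinct non-zero elements of a field such that the product of any two of them, increased
by `1`, is a square in the field. -/
structure IsDiophantineTriple {F : Type*} [Field F] (q : Fin 3 → F) : Prop where
  injective : Function.Injective q
  ne_zero : ∀ i, q i ≠ 0
  isSquare : ∀ i j, i < j → IsSquare (q i * q j + 1)

/-- The curve `y² = (q₀ x + 1) (q₁ x + 1) (q₂ x + 1)` induced by a triple, in Weierstrass form
`Y² = (X + q₁ q₂) (X + q₀ q₂) (X + q₀ q₁)`, through `X = q₀ q₁ q₂ x` and `Y = q₀ q₁ q₂ y`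
(see `inducedCurve_equation_iff`). -/
def inducedCurve {F : Type*} [Field F] (q : Fin 3 → F) : WeierstrassCurve F where
  a₁ := 0
  a₂ := q 0 * q 1 + q 0 * q 2 + q 1 * q 2
  a₃ := 0
  a₄ := q 0 * q 1 * q 2 * (q 0 + q 1 + q 2)
  a₆ := (q 0 * q 1 * q 2) ^ 2

theorem inducedCurve_equation_iff {F : Type*} [Field F] (q : Fin 3 → F) (hq : ∀ i, q i ≠ 0)
    (x y : F) :
    (inducedCurve q).toAffine.Equation (q 0 * q 1 * q 2 * x) (q 0 * q 1 * q 2 * y) ↔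
      y ^ 2 = (q 0 * x + 1) * (q 1 * x + 1) * (q 2 * x + 1) := by
  have h : (q 0 * q 1 * q 2) ^ 2 ≠ 0 :=
    pow_ne_zero 2 (mul_ne_zero (mul_ne_zero (hq 0) (hq 1)) (hq 2))
  rw [WeierstrassCurve.Affine.equation_iff, ← mul_right_inj' h (b := y ^ 2)]
  simp only [inducedCurve]
  constructor <;> intro e <;> linear_combination e

/-- The curve `Y² = X³ + A X² + B X`. -/
def twoTorsionCurve {F : Type*} [Field F] (A B : F) : WeierstrassCurve F where
  a₁ := 0
  a₂ := A
  a₃ := 0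
  a₄ := B
  a₆ := 0

/-- Decidable equality on `ℚ(w)`, which the group law on points asks for. -/
noncomputable instance ratFuncDecidableEq : DecidableEq (RatFunc ℚ) := Classical.decEq _

/-- The triple `q` over `ℚ(w)` is Diophantine, and the elliptic curve it induces can be written as
`Y² = X³ + A X² + B X`, has torsion subgroup `ℤ/2 × ℤ/6` and rank `2` over `ℚ(w)`, and `x₁`, `x₂` are
the `X`-coordinates of two independent points (in particular of infinite order) on
`Y² = X³ + A X² + B X`. -/
structure InducesRankTwoCurve (q : Fin 3 → RatFunc ℚ) (A B x₁ x₂ : RatFunc ℚ) : Prop where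
  isDiophantineTriple : IsDiophantineTriple q
  isElliptic : (inducedCurve q).IsElliptic
  exists_variableChange :
    ∃ C : WeierstrassCurve.VariableChange (RatFunc ℚ), C • inducedCurve q = twoTorsionCurve A B
  torsion : Nonempty
    (AddCommGroup.torsion (inducedCurve q).toAffine.Point ≃+ ZMod 2 × ZMod 6)
  rank : Module.rank ℤ (inducedCurve q).toAffine.Point = 2
  independent : ∃ (y₁ y₂ : RatFunc ℚ)
    (h₁ : (twoTorsionCurve A B).toAffine.Nonsingular x₁ y₁)
    (h₂ : (twoTorsionCurve A B).toAffine.Nonsingular x₂ y₂),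
    LinearIndependent ℤ
      ![WeierstrassCurve.Affine.Point.some x₁ y₁ h₁, WeierstrassCurve.Affine.Point.some x₂ y₂ h₂]

section Families

variable {F : Type*} [Field F] (w : F)

/-! First curve -/

def firstTriple : Fin 3 → F :=
  ![-((-7 + w) * (-2 + w) * (1 + w) * (2 + w) * (-1 + 6 * w + w ^ 2)) /
      (6 * (-1 + w) * (3 + w) * (1 + 2 * w) * (-5 - 2 * w + w ^ 2)),
    (9 * (-1 + w) * (3 + w) * (1 + 2 * w) * (-5 - 2 * w + w ^ 2)) /
      (2 * (-7 + w) * (-2 + w) * (1 + w) * (2 + w) * (-1 + 6 * w + w ^ 2)),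
    -((-5 - 2 * w + w ^ 2) * (-1 + 6 * w + w ^ 2) *
        (37 + 36 * w - 26 * w ^ 2 - 12 * w ^ 3 + w ^ 4)) /
      (6 * (-7 + w) * (-2 + w) * (-1 + w) * (1 + w) * (2 + w) * (3 + w) * (1 + 2 * w))]

def firstA : F :=
  185257 + 401184 * w + 530914 * w ^ 2 + 1218012 * w ^ 3 + 1041238 * w ^ 4 - 925272 * w ^ 5
    - 1369658 * w ^ 6 + 53676 * w ^ 7 + 519130 * w ^ 8 + 93984 * w ^ 9 - 59978 * w ^ 10
    - 12924 * w ^ 11 + 3286 * w ^ 12 + 792 * w ^ 13 - 14 * w ^ 14 - 12 * w ^ 15 + w ^ 16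

def firstB : F :=
  27 * (-7 + w) ^ 3 * (-2 + w) ^ 3 * (-1 + w) ^ 3 * (1 + w) ^ 3 * (2 + w) ^ 3 * (3 + w) ^ 3
    * (1 + 2 * w) ^ 3 * (10 + 19 * w ^ 2 + 6 * w ^ 3 + w ^ 4)
    * (47 + 36 * w - 7 * w ^ 2 - 6 * w ^ 3 + 2 * w ^ 4)

def firstX₁ : F :=
  -27 * (-7 + w) ^ 2 * (-2 + w) ^ 2 * (-1 + w) ^ 2 * (1 + w) ^ 2 * (2 + w) ^ 2 * (3 + w) ^ 2
    * (1 + 2 * w) ^ 2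

def firstX₂ : F :=
  -(4 / (-1 + 6 * w + w ^ 2) ^ 2) * (-7 + w) ^ 2 * (-2 + w) ^ 2 * (-1 + w) * (1 + w) ^ 2
    * (2 + w) ^ 2 * (3 + w) * (1 + 2 * w) * (10 + 19 * w ^ 2 + 6 * w ^ 3 + w ^ 4)
    * (47 + 36 * w - 7 * w ^ 2 - 6 * w ^ 3 + 2 * w ^ 4)

/-! Second curve -/

def secondTriple : Fin 3 → F :=
  ![-((-2 + w ^ 2) * (1 - 6 * w + w ^ 2) * (-5 + 6 * w + w ^ 2)) /
      (6 * (-1 + w) * (3 + w) * (-1 + 2 * w) * (-1 - 2 * w + w ^ 2)),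
    (9 * (-1 + w) * (3 + w) * (-1 + 2 * w) * (-1 - 2 * w + w ^ 2)) /
      (2 * (-2 + w ^ 2) * (1 - 6 * w + w ^ 2) * (-5 + 6 * w + w ^ 2)),
    -((-1 - 2 * w + w ^ 2) * (-5 + 6 * w + w ^ 2) *
        (-11 + 36 * w - 10 * w ^ 2 - 12 * w ^ 3 + w ^ 4)) /
      (6 * (-1 + w) * (3 + w) * (-1 + 2 * w) * (-2 + w ^ 2) * (1 - 6 * w + w ^ 2))]

def secondA : F :=
  3517 - 26568 * w + 74462 * w ^ 2 - 102612 * w ^ 3 + 138610 * w ^ 4 - 283680 * w ^ 5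
    + 346730 * w ^ 6 - 107316 * w ^ 7 - 122138 * w ^ 8 + 84648 * w ^ 9 + 7418 * w ^ 10
    - 15084 * w ^ 11 + 1690 * w ^ 12 + 576 * w ^ 13 + 14 * w ^ 14 - 12 * w ^ 15 + w ^ 16

def secondB : F :=
  27 * (-1 + w) ^ 3 * (3 + w) ^ 3 * (-1 + 2 * w) ^ 3 * (-2 + w ^ 2) ^ 3
    * (1 - 6 * w + w ^ 2) ^ 3 * (16 - 36 * w + 17 * w ^ 2 + 6 * w ^ 3 + w ^ 4)
    * (5 + 7 * w ^ 2 - 6 * w ^ 3 + 2 * w ^ 4)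

def secondX₁ : F :=
  -27 * (-1 + w) ^ 2 * (3 + w) ^ 2 * (-1 + 2 * w) ^ 2 * (-2 + w ^ 2) ^ 2
    * (1 - 6 * w + w ^ 2) ^ 2

def secondX₂ : F :=
  -(4 / (-1 - 2 * w + w ^ 2) ^ 2) * (-1 + w) * (3 + w) * (-1 + 2 * w) * (-2 + w ^ 2) ^ 3
    * (1 - 6 * w + w ^ 2) ^ 3 * (5 + 7 * w ^ 2 - 6 * w ^ 3 + 2 * w ^ 4)

/-! Third curve -/

def thirdTriple : Fin 3 → F :=
  ![-(18 * (-1 + w) * (1 + w) * (3 + 2 * w) * (-4 - 2 * w + w ^ 2) * (2 + 2 * w + w ^ 2)) /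
      ((-2 + w ^ 2) * (-14 - 12 * w + w ^ 2) * (-8 + 20 * w ^ 2 + 12 * w ^ 3 + w ^ 4)),
    -((-2 + w ^ 2) ^ 2 * (-14 - 12 * w + w ^ 2) ^ 2 * (2 + 2 * w + w ^ 2)) /
      (6 * (-1 + w) * (1 + w) * (3 + 2 * w) * (-4 - 2 * w + w ^ 2) *
        (-8 + 20 * w ^ 2 + 12 * w ^ 3 + w ^ 4)),
    -((-4 - 2 * w + w ^ 2) * (-8 + 20 * w ^ 2 + 12 * w ^ 3 + w ^ 4) ^ 2) /
      (6 * (-1 + w) * (1 + w) * (3 + 2 * w) * (-2 + w ^ 2) * (-14 - 12 * w + w ^ 2) *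
        (2 + 2 * w + w ^ 2))]

def thirdA : F :=
  -1899008 - 5996544 * w - 1469440 * w ^ 2 + 13980672 * w ^ 3 + 14383360 * w ^ 4
    - 6990336 * w ^ 5 - 16274176 * w ^ 6 - 3491328 * w ^ 7 + 5554240 * w ^ 8 + 2814336 * w ^ 9
    - 219616 * w ^ 10 - 160416 * w ^ 11 + 120808 * w ^ 12 + 38928 * w ^ 13 - 856 * w ^ 14
    + w ^ 16

def thirdB : F :=
  3456 * (-1 + w) ^ 3 * (1 + w) ^ 3 * (3 + 2 * w) ^ 3 * (-2 + w ^ 2) ^ 3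
    * (-14 - 12 * w + w ^ 2) ^ 3 * (10 + 12 * w + 2 * w ^ 2 + w ^ 4)
    * (-44 - 24 * w + 56 * w ^ 2 + 36 * w ^ 3 + w ^ 4)

def thirdX₁ : F :=
  (108 * (-1 + w) ^ 2 * (1 + w) ^ 2 * (3 + 2 * w) ^ 2 * (-2 + w ^ 2) ^ 3
      * (-14 - 12 * w + w ^ 2) ^ 3 * (2 + 2 * w + w ^ 2) ^ 2) /
    (10 + 12 * w + 2 * w ^ 2 + w ^ 4) ^ 2

def thirdX₂ : F :=
  -27 * (-1 + w) * (1 + w) * (3 + 2 * w) * (-2 + w ^ 2) ^ 2 * (-14 - 12 * w + w ^ 2) ^ 2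
    * (-4 - 2 * w + w ^ 2) ^ 2

end Families

end DiophantineCurves

/-!
In all three cases the substitution `X = u² x - q₀ q₁` transforms the curve induced by the triple to
`E : y² = x (x + M) (x + N)` with `M = a³ (a + 2 b)` and `N = b³ (b + 2 a)` for coprime polynomials
`a` and `b` in `ℤ[w]` (`IsSubstitution.pointAddEquiv`). Such a curve has a point of order three, with
abscissa `a² b²`, besides the points of order two. That the triple is Diophantine and that the curve
has two further points comes from linear forms in `a` and `b` which are squares, or three times
squares.

*The number of classes modulo two.* A point of `E` over `ℚ(w)` is determined modulo `2 E(ℚ(w))` by the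
square classes of `x`, `x + M` and `x + N`. As `ℤ[w]` is factorial with units `1` and `-1`, these are
products of `-1` and of the prime factors of `M`, `N` and `N - M`
(`exists_isSquare_mul_classProd`). At a prime factor `f` of `M` or `N` the classes satisfy a local
condition over the residue field `ℚ[w] / (f)`; a simple root of `f` modulo a prime number `p` embeds
this field in the field of `p`-adic numbers, and the condition becomes a relation between Legendre
symbols, linear in the exponents of the square classes (`LocalTest.Valid.sum_eq_zero`). Enough of
these relations leave four free exponents, hence at most `16` classes
(`FamilyData.Valid.card_quotient_le`).

*Finite generation and torsion.* Let `w₀` be an integer at which `E` has good reduction. The points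
that reduce to zero at `w₀` form a group `H` without torsion (`Place.eq_zero_of_nsmul_eq_zero`). For
them `x` has a pole at `w₀`, which gives further relations between the exponents, so that their
square classes are trivial and `H = 2 H`. The image of `H` under the specialization at any other
integer lies in a finitely generated group, by the Mordell-Weil theorem over `ℚ` for curves with
rational points of order two (`rat_fg_of_isSplit`); being divisible by two, it is a torsion group, and
it is killed by `12` if the specialized curve has twelve points modulo `11` and modulo `13`. That holds
at all integers congruent to `w₀` modulo `143`. Thus, for `Q` in `H`, the point `12 Q` has poles at
infinitely many places, and so `12 Q = 0` and `Q = 0`. Therefore specialization at `w₀` is injective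
(`FamilyData.Specializes.reduce_injective`), `E(ℚ(w))` is finitely generated, and its torsion subgroup
has at most, hence exactly, twelve elements.

*The rank.* Legendre symbols of values of polynomials in the square classes show that the two given
points and the points of order two are independent modulo `2 E(ℚ(w))`
(`FamilyData.Separates.isTwoBasis`). The two points are then independent, and since there are at most
`16` classes, four of which come from the torsion, the rank is two (`IsTwoBasis.rank_eq_two`).
-/

/-! ### The chord-tangent law on `Y² = X³ + A X² + B X` -/

namespace DiophantineCurves

open WeierstrassCurve.Affine WeierstrassCurve.Affine.Point

section GroupLaw

variable {F : Type*} [Field F] {A B : F}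

theorem twoTorsionCurve_equation_iff {x y : F} :
    (twoTorsionCurve A B).toAffine.Equation x y ↔ y ^ 2 = x ^ 3 + A * x ^ 2 + B * x := by
  rw [equation_iff]
  simp [twoTorsionCurve]

theorem twoTorsionCurve_nonsingular_iff {x y : F} :
    (twoTorsionCurve A B).toAffine.Nonsingular x y ↔
      y ^ 2 = x ^ 3 + A * x ^ 2 + B * x ∧ (3 * x ^ 2 + 2 * A * x + B ≠ 0 ∨ 2 * y ≠ 0) := by
  rw [nonsingular_iff', twoTorsionCurve_equation_iff]
  simp only [twoTorsionCurve, zero_mul, zero_sub, add_zero]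
  rw [neg_ne_zero]

theorem twoTorsionCurve_negY (x y : F) : (twoTorsionCurve A B).toAffine.negY x y = -y := by
  simp [negY, twoTorsionCurve]

theorem nonsingular_of_discr (hD : 2 * B * (A ^ 2 - 4 * B) ≠ 0) {x y : F}
    (h : y ^ 2 = x ^ 3 + A * x ^ 2 + B * x) :
    (twoTorsionCurve A B).toAffine.Nonsingular x y := by
  rw [twoTorsionCurve_nonsingular_iff]
  refine ⟨h, ?_⟩
  by_contra! hc
  obtain ⟨h1, h2⟩ := hc
  apply hD
  have h2' : y = 0 := by
    rcases mul_eq_zero.1 h2 with h | h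
    · exact absurd (by rw [h]; ring) hD
    · exact h
  rw [h2'] at h
  have hx : x * (x ^ 2 + A * x + B) = 0 := by linear_combination -h
  rcases mul_eq_zero.1 hx with hx | hx
  · rw [hx] at h1
    linear_combination 2 * (A ^ 2 - 4 * B) * h1
  · have h3 : x * (2 * x + A) = 0 := by linear_combination h1 - hx
    rcases mul_eq_zero.1 h3 with h3 | h3
    · rw [h3] at h1
      linear_combination 2 * (A ^ 2 - 4 * B) * h1
    · linear_combination 2 * B * ((2 * x + A) * h3 - 4 * hx)

theorem neg_some_eq {x y : F} (h : (twoTorsionCurve A B).toAffine.Nonsingular x y)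
    (h' : (twoTorsionCurve A B).toAffine.Nonsingular x (-y)) :
    -some x y h = some x (-y) h' := by
  rw [neg_some]
  simp only [twoTorsionCurve_negY]

theorem nonsingular_neg_y {x y : F} (h : (twoTorsionCurve A B).toAffine.Nonsingular x y) :
    (twoTorsionCurve A B).toAffine.Nonsingular x (-y) := by
  have := (nonsingular_neg x y).2 h
  rwa [twoTorsionCurve_negY] at this

theorem some_congr {x y x' y' : F} {h : (twoTorsionCurve A B).toAffine.Nonsingular x y}
    {h' : (twoTorsionCurve A B).toAffine.Nonsingular x' y'} (hx : x = x') (hy : y = y') :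
    some x y h = some x' y' h' := by
  subst hx hy; rfl

/-- The three points `(xᵢ, yᵢ)` are, with multiplicities, the intersection of the curve
`Y² = X³ + A X² + B X` with the line `Y = ℓ X + n`. -/
structure LineSection (A B ℓ n x₁ y₁ x₂ y₂ x₃ y₃ : F) : Prop where
  sum : x₁ + x₂ + x₃ = ℓ ^ 2 - A
  pairs : x₁ * x₂ + x₁ * x₃ + x₂ * x₃ = B - 2 * ℓ * n
  prod : x₁ * x₂ * x₃ = n ^ 2
  y₁_eq : y₁ = ℓ * x₁ + n
  y₂_eq : y₂ = ℓ * x₂ + n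
  y₃_eq : y₃ = ℓ * x₃ + n

variable [DecidableEq F]

theorem exists_lineSection {x₁ y₁ x₂ y₂ x₃ y₃ : F}
    {h₁ : (twoTorsionCurve A B).toAffine.Nonsingular x₁ y₁}
    {h₂ : (twoTorsionCurve A B).toAffine.Nonsingular x₂ y₂}
    {h₃ : (twoTorsionCurve A B).toAffine.Nonsingular x₃ y₃}
    (h : some x₁ y₁ h₁ + some x₂ y₂ h₂ + some x₃ y₃ h₃ = 0) :
    ∃ ℓ n, LineSection A B ℓ n x₁ y₁ x₂ y₂ x₃ y₃ := by
  have hneg := eq_neg_of_add_eq_zero_left h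
  have hxy : ¬(x₁ = x₂ ∧ y₁ = (twoTorsionCurve A B).toAffine.negY x₂ y₂) := by
    rintro ⟨hx, hy⟩
    rw [add_of_Y_eq hx hy] at hneg
    exact some_ne_zero _ (neg_eq_zero.1 hneg.symm)
  rw [add_some hxy, neg_some, some.injEq] at hneg
  set ℓ := (twoTorsionCurve A B).toAffine.slope x₁ x₂ y₁ y₂ with hℓ
  obtain ⟨hx3, hy3⟩ := hneg
  simp only [addX, addY, negAddY, negY, twoTorsionCurve, zero_mul, sub_zero, add_zero] at hx3 hy3
  have e₁ := twoTorsionCurve_equation_iff.1 h₁.1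
  have e₂ := twoTorsionCurve_equation_iff.1 h₂.1
  have hsum : x₁ + x₂ + x₃ = ℓ ^ 2 - A := by linear_combination -hx3
  have hy3' : y₃ = ℓ * x₃ + (y₁ - ℓ * x₁) := by linear_combination hy3 + ℓ * hx3
  by_cases hx : x₁ = x₂
  · have hy : y₁ ≠ (twoTorsionCurve A B).toAffine.negY x₂ y₂ := fun hy => hxy ⟨hx, hy⟩
    have hyy : y₁ = y₂ := Y_eq_of_Y_ne h₁.1 h₂.1 hx hy
    rw [slope_of_Y_ne hx hy] at hℓ
    subst hx
    subst hyy
    simp only [twoTorsionCurve, negY, zero_mul, sub_zero] at hℓ hy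
    have h2y : y₁ - -y₁ ≠ 0 := sub_ne_zero.2 hy
    rw [eq_div_iff h2y] at hℓ
    refine ⟨ℓ, y₁ - ℓ * x₁, hsum, ?_, ?_, by ring, by ring, hy3'⟩
    · have : x₃ = ℓ ^ 2 - A - x₁ - x₁ := by linear_combination hsum
      rw [this]
      linear_combination hℓ
    · have : x₃ = ℓ ^ 2 - A - x₁ - x₁ := by linear_combination hsum
      rw [this]
      linear_combination x₁ * hℓ - e₁
  · rw [slope_of_X_ne hx, eq_div_iff (sub_ne_zero.2 hx)] at hℓ
    refine ⟨ℓ, y₁ - ℓ * x₁, hsum, ?_, ?_, by ring, by linear_combination hℓ, hy3'⟩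
    · apply mul_left_cancel₀ (sub_ne_zero.2 hx)
      have : x₃ = ℓ ^ 2 - A - x₁ - x₂ := by linear_combination hsum
      have hy2 : y₂ = y₁ - ℓ * (x₁ - x₂) := by linear_combination hℓ
      rw [this]
      rw [hy2] at e₂
      linear_combination e₁ - e₂
    · apply mul_left_cancel₀ (sub_ne_zero.2 hx)
      have : x₃ = ℓ ^ 2 - A - x₁ - x₂ := by linear_combination hsum
      have hy2 : y₂ = y₁ - ℓ * (x₁ - x₂) := by linear_combination hℓ
      rw [this]
      rw [hy2] at e₂
      linear_combination x₂ * e₁ - x₁ * e₂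

theorem add_eq_zero_of_lineSection (h2 : (2 : F) ≠ 0) {ℓ n x₁ y₁ x₂ y₂ x₃ y₃ : F}
    (h₁ : (twoTorsionCurve A B).toAffine.Nonsingular x₁ y₁)
    (h₂ : (twoTorsionCurve A B).toAffine.Nonsingular x₂ y₂)
    (h₃ : (twoTorsionCurve A B).toAffine.Nonsingular x₃ y₃)
    (h : LineSection A B ℓ n x₁ y₁ x₂ y₂ x₃ y₃) :
    some x₁ y₁ h₁ + some x₂ y₂ h₂ + some x₃ y₃ h₃ = 0 := by
  obtain ⟨hs, hp, hr, hy₁, hy₂, hy₃⟩ := h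
  rw [add_eq_zero_iff_eq_neg]
  have hxy : ¬(x₁ = x₂ ∧ y₁ = (twoTorsionCurve A B).toAffine.negY x₂ y₂) := by
    rintro ⟨hx, hy⟩
    rw [twoTorsionCurve_negY] at hy
    subst hx
    have hyy : y₁ = y₂ := by rw [hy₁, hy₂]
    subst hyy
    have hy0 : y₁ = 0 := by
      have : 2 * y₁ = 0 := by linear_combination hy
      exact (mul_eq_zero.1 this).resolve_left h2
    -- a double root of the cubic at a point with vanishing ordinate
    rcases (twoTorsionCurve_nonsingular_iff.1 h₁).2 with h | h
    · apply h
      have : x₃ = ℓ ^ 2 - A - x₁ - x₁ := by linear_combination hs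
      rw [this] at hp
      have hn : n = -(ℓ * x₁) := by linear_combination hy0 - hy₁
      rw [hn] at hp
      linear_combination -hp
    · exact h (by rw [hy0, mul_zero])
  rw [add_some hxy, neg_some, some.injEq]
  have hℓ : (twoTorsionCurve A B).toAffine.slope x₁ x₂ y₁ y₂ = ℓ := by
    by_cases hx : x₁ = x₂
    · have hy : y₁ ≠ (twoTorsionCurve A B).toAffine.negY x₂ y₂ := fun hy => hxy ⟨hx, hy⟩
      rw [slope_of_Y_ne hx hy]
      subst hx
      simp only [twoTorsionCurve, negY, zero_mul, sub_zero] at hy ⊢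
      have hyy : y₁ = y₂ := by rw [hy₁, hy₂]
      subst hyy
      rw [div_eq_iff (sub_ne_zero.2 hy)]
      have : x₃ = ℓ ^ 2 - A - x₁ - x₁ := by linear_combination hs
      rw [this] at hp
      have hn : n = y₁ - ℓ * x₁ := by linear_combination -hy₁
      rw [hn] at hp
      linear_combination -hp
    · rw [slope_of_X_ne hx, div_eq_iff (sub_ne_zero.2 hx)]
      linear_combination hy₁ - hy₂
  rw [hℓ]
  simp only [addX, addY, negAddY, negY, twoTorsionCurve, zero_mul, sub_zero, add_zero]
  constructor
  · linear_combination -hs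
  · linear_combination -hy₁ + hy₃ + ℓ * hs

theorem some_add_self_eq_zero_iff (h2 : (2 : F) ≠ 0) {x y : F}
    {h : (twoTorsionCurve A B).toAffine.Nonsingular x y} :
    some x y h + some x y h = 0 ↔ y = 0 := by
  rw [add_eq_zero_iff_eq_neg, neg_some, some.injEq, twoTorsionCurve_negY]
  constructor
  · rintro ⟨-, hy⟩
    have : 2 * y = 0 := by linear_combination hy
    exact (mul_eq_zero.1 this).resolve_left h2
  · rintro rfl
    simp

end GroupLaw

end DiophantineCurves

/-! ### Two-descent over a field -/

namespace DiophantineCurves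

open WeierstrassCurve.Affine WeierstrassCurve.Affine.Point

section Descent

variable {F : Type*} [Field F] {A B : F}

open Classical in
/-- The square class attached to a point by the root `e` of `X³ + A X² + B X`: it is `x - e`, except
at infinity, where it is `1`, and at `(e, 0)`, where it is the derivative of the cubic at `e`. -/
noncomputable def descentMap (e : F) : (twoTorsionCurve A B).toAffine.Point → F
  | .zero => 1
  | .some x _ _ => if x = e then 3 * e ^ 2 + 2 * A * e + B else x - e

@[simp]
theorem descentMap_zero (e : F) :
    descentMap e (0 : (twoTorsionCurve A B).toAffine.Point) = 1 := rfl

theorem descentMap_some_of_ne {e x y : F} {h : (twoTorsionCurve A B).toAffine.Nonsingular x y}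
    (hx : x ≠ e) : descentMap e (some x y h) = x - e := by
  simp [descentMap, hx]

theorem descentMap_some_self {e y : F} {h : (twoTorsionCurve A B).toAffine.Nonsingular e y} :
    descentMap e (some e y h) = 3 * e ^ 2 + 2 * A * e + B := by
  simp [descentMap]

theorem descentMap_ne_zero {e : F} (hc : 3 * e ^ 2 + 2 * A * e + B ≠ 0)
    (P : (twoTorsionCurve A B).toAffine.Point) : descentMap e P ≠ 0 := by
  rcases P with _ | ⟨x, y, h⟩
  · exact one_ne_zero
  · by_cases hx : x = e
    · subst hx
      rwa [descentMap_some_self]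
    · rw [descentMap_some_of_ne hx]
      exact sub_ne_zero.2 hx

theorem descentMap_neg (e : F) (P : (twoTorsionCurve A B).toAffine.Point) :
    descentMap e (-P) = descentMap e P := by
  rcases P with _ | ⟨x, y, h⟩
  · rfl
  · rw [neg_some]
    rfl

/-- The factor `x₂ - e` and `x₃ - e` of a line section through `(e, 0)`. -/
theorem LineSection.mul_sub_of_eq {e ℓ n x₁ y₁ x₂ y₂ x₃ y₃ : F}
    (he : e ^ 3 + A * e ^ 2 + B * e = 0)
    (h₁ : y₁ ^ 2 = x₁ ^ 3 + A * x₁ ^ 2 + B * x₁)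
    (h : LineSection A B ℓ n x₁ y₁ x₂ y₂ x₃ y₃) (hx : x₁ = e) :
    (x₂ - e) * (x₃ - e) = 3 * e ^ 2 + 2 * A * e + B := by
  obtain ⟨hs, hp, hr, hy₁, hy₂, hy₃⟩ := h
  subst hx
  have hy : y₁ = 0 := by
    rw [he] at h₁
    exact pow_eq_zero_iff two_ne_zero |>.1 h₁
  have hn : n = -(ℓ * x₁) := by linear_combination hy - hy₁
  rw [hn] at hp
  linear_combination hp - 2 * x₁ * hs

theorem LineSection.swap {ℓ n x₁ y₁ x₂ y₂ x₃ y₃ : F}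
    (h : LineSection A B ℓ n x₁ y₁ x₂ y₂ x₃ y₃) : LineSection A B ℓ n x₂ y₂ x₁ y₁ x₃ y₃ := by
  obtain ⟨hs, hp, hr, hy₁, hy₂, hy₃⟩ := h
  exact ⟨by linear_combination hs, by linear_combination hp, by linear_combination hr,
    hy₂, hy₁, hy₃⟩

theorem LineSection.rotate {ℓ n x₁ y₁ x₂ y₂ x₃ y₃ : F}
    (h : LineSection A B ℓ n x₁ y₁ x₂ y₂ x₃ y₃) : LineSection A B ℓ n x₂ y₂ x₃ y₃ x₁ y₁ := by
  obtain ⟨hs, hp, hr, hy₁, hy₂, hy₃⟩ := h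
  exact ⟨by linear_combination hs, by linear_combination hp, by linear_combination hr,
    hy₂, hy₃, hy₁⟩

variable [DecidableEq F]

theorem isSquare_descentMap_of_add_eq_zero {e : F} (he : e ^ 3 + A * e ^ 2 + B * e = 0)
    (hc : 3 * e ^ 2 + 2 * A * e + B ≠ 0) {P Q R : (twoTorsionCurve A B).toAffine.Point}
    (h : P + Q + R = 0) : IsSquare (descentMap e P * descentMap e Q * descentMap e R) := by
  have key : ∀ P Q : (twoTorsionCurve A B).toAffine.Point, P + Q = 0 →
      descentMap e P = descentMap e Q := fun P Q h => by
    rw [eq_neg_of_add_eq_zero_left h, descentMap_neg]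
  by_cases hP : P = 0
  · subst hP
    rw [zero_add] at h
    exact ⟨descentMap e R, by rw [key Q R h, descentMap_zero, one_mul]⟩
  by_cases hQ : Q = 0
  · subst hQ
    rw [add_zero] at h
    exact ⟨descentMap e R, by rw [key P R h, descentMap_zero, mul_one]⟩
  by_cases hR : R = 0
  · subst hR
    rw [add_zero] at h
    exact ⟨descentMap e Q, by rw [key P Q h, descentMap_zero, mul_one]⟩
  rcases P with _ | ⟨x₁, y₁, h₁⟩
  · exact absurd rfl hP
  rcases Q with _ | ⟨x₂, y₂, h₂⟩
  · exact absurd rfl hQ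
  rcases R with _ | ⟨x₃, y₃, h₃⟩
  · exact absurd rfl hR
  obtain ⟨ℓ, n, hL⟩ := exists_lineSection h
  have e₁ := twoTorsionCurve_equation_iff.1 h₁.1
  have e₂ := twoTorsionCurve_equation_iff.1 h₂.1
  have e₃ := twoTorsionCurve_equation_iff.1 h₃.1
  by_cases hx₁ : x₁ = e
  · have := hL.mul_sub_of_eq he e₁ hx₁
    have hne := this ▸ hc
    rw [descentMap_some_of_ne (sub_ne_zero.1 (left_ne_zero_of_mul hne)),
      descentMap_some_of_ne (sub_ne_zero.1 (right_ne_zero_of_mul hne)), mul_assoc, this]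
    subst hx₁
    rw [descentMap_some_self]
    exact ⟨_, rfl⟩
  by_cases hx₂ : x₂ = e
  · have := hL.swap.mul_sub_of_eq he e₂ hx₂
    have hne := this ▸ hc
    rw [descentMap_some_of_ne (sub_ne_zero.1 (left_ne_zero_of_mul hne)),
      descentMap_some_of_ne (sub_ne_zero.1 (right_ne_zero_of_mul hne)), mul_right_comm, this]
    subst hx₂
    rw [descentMap_some_self]
    exact ⟨_, rfl⟩
  by_cases hx₃ : x₃ = e
  · have := hL.rotate.rotate.mul_sub_of_eq he e₃ hx₃
    have hne := this ▸ hc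
    rw [descentMap_some_of_ne (sub_ne_zero.1 (left_ne_zero_of_mul hne)),
      descentMap_some_of_ne (sub_ne_zero.1 (right_ne_zero_of_mul hne)), this]
    subst hx₃
    rw [descentMap_some_self]
    exact ⟨_, rfl⟩
  rw [descentMap_some_of_ne hx₁, descentMap_some_of_ne hx₂, descentMap_some_of_ne hx₃]
  obtain ⟨hs, hp, hr, -, -, -⟩ := hL
  exact ⟨ℓ * e + n, by linear_combination hr - e * hp + e ^ 2 * hs - he⟩

theorem isSquare_descentMap_add {e : F} (he : e ^ 3 + A * e ^ 2 + B * e = 0)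
    (hc : 3 * e ^ 2 + 2 * A * e + B ≠ 0) (P Q : (twoTorsionCurve A B).toAffine.Point) :
    IsSquare (descentMap e P * descentMap e Q * descentMap e (P + Q)) := by
  rw [← descentMap_neg e (P + Q)]
  exact isSquare_descentMap_of_add_eq_zero he hc (add_neg_cancel _)

/-- A point at which `x`, `x + M` and `x + N` are squares is twice a point. -/
theorem exists_half {M N : F} (h2 : (2 : F) ≠ 0) (hM : M ≠ 0) (hN : N ≠ 0) (hMN : M ≠ N)
    {x y : F} {h : (twoTorsionCurve (M + N) (M * N)).toAffine.Nonsingular x y}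
    (h₁ : IsSquare x) (h₂ : IsSquare (x + M)) (h₃ : IsSquare (x + N)) :
    ∃ Q : (twoTorsionCurve (M + N) (M * N)).toAffine.Point, some x y h = 2 • Q := by
  obtain ⟨u₁, hu₁⟩ := h₁
  obtain ⟨u₂, hu₂⟩ := h₂
  obtain ⟨u₃, hu₃⟩ := h₃
  have e := twoTorsionCurve_equation_iff.1 h.1
  -- the signs of the roots are chosen so that `y = u₁ u₂ u₃`
  obtain ⟨u₁, hu₁, hy⟩ : ∃ u, x = u * u ∧ y = u * u₂ * u₃ := by
    have : (y - u₁ * u₂ * u₃) * (y + u₁ * u₂ * u₃) = 0 := by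
      have : x ^ 3 + (M + N) * x ^ 2 + M * N * x = (u₁ * u₁) * (u₂ * u₂) * (u₃ * u₃) := by
        rw [← hu₁, ← hu₂, ← hu₃]; ring
      linear_combination e + this
    rcases mul_eq_zero.1 this with h | h
    · exact ⟨u₁, hu₁, by linear_combination h⟩
    · exact ⟨-u₁, by rw [hu₁]; ring, by linear_combination h⟩
  have hM' : M = u₂ * u₂ - u₁ * u₁ := by linear_combination hu₂ - hu₁
  have hN' : N = u₃ * u₃ - u₁ * u₁ := by linear_combination hu₃ - hu₁
  have hD : 2 * (M * N) * ((M + N) ^ 2 - 4 * (M * N)) ≠ 0 := by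
    have : (M + N) ^ 2 - 4 * (M * N) = (M - N) ^ 2 := by ring
    rw [this]
    exact mul_ne_zero (mul_ne_zero h2 (mul_ne_zero hM hN)) (pow_ne_zero _ (sub_ne_zero.2 hMN))
  set X := (u₁ + u₂) * (u₁ + u₃) with hX
  set Y := (u₁ + u₂) * (u₁ + u₃) * (u₂ + u₃) with hY
  have hQ : (twoTorsionCurve (M + N) (M * N)).toAffine.Nonsingular X Y :=
    nonsingular_of_discr hD (by rw [hX, hY, hM', hN']; ring)
  refine ⟨some X Y hQ, ?_⟩
  have hneg := nonsingular_neg_y h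
  have key : some X Y hQ + some X Y hQ + some x (-y) hneg = 0 := by
    refine add_eq_zero_of_lineSection h2 hQ hQ hneg
      (ℓ := u₁ + u₂ + u₃) (n := Y - (u₁ + u₂ + u₃) * X) ⟨?_, ?_, ?_, by ring, by ring, ?_⟩
    · rw [hX, hu₁, hM', hN']; ring
    · rw [hX, hY, hu₁, hM', hN']; ring
    · rw [hX, hY, hu₁]; ring
    · rw [hX, hY, hy, hu₁]; ring
  rw [← neg_some_eq h hneg, add_neg_eq_zero] at key
  rw [← key, two_nsmul]

end Descent

end DiophantineCurves

/-! ### Places and reduction of points -/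

namespace DiophantineCurves

open WeierstrassCurve.Affine WeierstrassCurve.Affine.Point

/-- A place of the field `K` with values in the field `k`: a valuation subring of `K` together with
a homomorphism to `k` whose kernel is the maximal ideal. -/
structure Place (K k : Type*) [Field K] [Field k] where
  /-- The ring of elements that are finite at the place. -/
  ring : ValuationSubring K
  /-- The residue homomorphism. -/
  residue : ring →+* k
  residue_eq_zero_iff : ∀ x : ring, residue x = 0 ↔ ring.valuation x < 1

namespace Place

variable {K k : Type*} [Field K] [Field k] (p : Place K k)

/-- The valuation of the place. -/
noncomputable abbrev val : Valuation K p.ring.ValueGroup := p.ring.valuation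

open Classical in
/-- The residue of an element of `K`, with the value `0` at the elements with a pole. -/
noncomputable def res (x : K) : k := if hx : x ∈ p.ring then p.residue ⟨x, hx⟩ else 0

variable {p}

theorem mem_iff {x : K} : x ∈ p.ring ↔ p.val x ≤ 1 := (p.ring.valuation_le_one_iff x).symm

theorem res_of_mem {x : K} (hx : x ∈ p.ring) : p.res x = p.residue ⟨x, hx⟩ := dif_pos hx

theorem res_add {x y : K} (hx : x ∈ p.ring) (hy : y ∈ p.ring) :
    p.res (x + y) = p.res x + p.res y := by
  rw [res_of_mem hx, res_of_mem hy, res_of_mem (add_mem hx hy), ← map_add]; rfl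

theorem res_sub {x y : K} (hx : x ∈ p.ring) (hy : y ∈ p.ring) :
    p.res (x - y) = p.res x - p.res y := by
  rw [res_of_mem hx, res_of_mem hy, res_of_mem (sub_mem hx hy), ← map_sub]; rfl

theorem res_mul {x y : K} (hx : x ∈ p.ring) (hy : y ∈ p.ring) :
    p.res (x * y) = p.res x * p.res y := by
  rw [res_of_mem hx, res_of_mem hy, res_of_mem (mul_mem hx hy), ← map_mul]; rfl

theorem res_pow {x : K} (hx : x ∈ p.ring) (n : ℕ) : p.res (x ^ n) = p.res x ^ n := by
  rw [res_of_mem hx, res_of_mem (pow_mem hx n), ← map_pow]; rfl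

theorem res_neg {x : K} (hx : x ∈ p.ring) : p.res (-x) = -p.res x := by
  rw [res_of_mem hx, res_of_mem (neg_mem hx), ← map_neg]; rfl

theorem res_natCast (n : ℕ) : p.res n = n := by
  rw [res_of_mem (natCast_mem p.ring n), ← map_natCast p.residue n]; rfl

theorem res_one : p.res 1 = 1 := by
  rw [res_of_mem (one_mem _), ← map_one p.residue]; rfl

theorem res_zero : p.res 0 = 0 := by
  rw [res_of_mem (zero_mem _), ← map_zero p.residue]; rfl

theorem res_eq_zero_iff {x : K} (hx : x ∈ p.ring) : p.res x = 0 ↔ p.val x < 1 := by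
  rw [res_of_mem hx, p.residue_eq_zero_iff]

theorem val_eq_one_of_res_ne_zero {x : K} (hx : x ∈ p.ring) (h : p.res x ≠ 0) : p.val x = 1 := by
  rw [Ne, res_eq_zero_iff hx, not_lt] at h
  exact le_antisymm (mem_iff.1 hx) h

theorem mem_of_pow_mem {x : K} {n : ℕ} (hn : n ≠ 0) (h : x ^ n ∈ p.ring) : x ∈ p.ring := by
  rw [mem_iff, map_pow] at h
  rw [mem_iff]
  exact (pow_le_one_iff hn).1 h

theorem mem_of_val_lt_one {x : K} (h : p.val x < 1) : x ∈ p.ring := mem_iff.2 h.le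

theorem res_eq_zero_of_val_lt_one {x : K} (h : p.val x < 1) : p.res x = 0 :=
  (res_eq_zero_iff (mem_of_val_lt_one h)).2 h

variable (p) in
/-- The place is one of good reduction for `Y² = X³ + A X² + B X`, the reduced curve being
`Y² = X³ + A' X² + B' X`. -/
structure GoodReduction (A B : K) (A' B' : k) : Prop where
  memA : A ∈ p.ring
  memB : B ∈ p.ring
  resA : p.res A = A'
  resB : p.res B = B'
  discr : 2 * B' * (A' ^ 2 - 4 * B') ≠ 0

variable {A B : K} {A' B' : k} (hg : p.GoodReduction A B A' B')

include hg in
theorem GoodReduction.mem_y {x y : K} (h : (twoTorsionCurve A B).toAffine.Nonsingular x y)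
    (hx : x ∈ p.ring) : y ∈ p.ring := by
  apply mem_of_pow_mem two_ne_zero
  rw [twoTorsionCurve_equation_iff.1 h.1]
  exact add_mem (add_mem (pow_mem hx _) (mul_mem hg.memA (pow_mem hx _))) (mul_mem hg.memB hx)

include hg in
theorem GoodReduction.nonsingular_res {x y : K}
    (h : (twoTorsionCurve A B).toAffine.Nonsingular x y) (hx : x ∈ p.ring) :
    (twoTorsionCurve A' B').toAffine.Nonsingular (p.res x) (p.res y) := by
  apply nonsingular_of_discr hg.discr
  have hy := hg.mem_y h hx
  rw [← hg.resA, ← hg.resB, ← res_pow hy, twoTorsionCurve_equation_iff.1 h.1,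
    res_add (add_mem (pow_mem hx _) (mul_mem hg.memA (pow_mem hx _))) (mul_mem hg.memB hx),
    res_add (pow_mem hx _) (mul_mem hg.memA (pow_mem hx _)), res_mul hg.memA (pow_mem hx _),
    res_mul hg.memB hx, res_pow hx, res_pow hx]

open Classical in
/-- The reduction of points at a place of good reduction, as a map. -/
noncomputable def reduceFun : (twoTorsionCurve A B).toAffine.Point →
    (twoTorsionCurve A' B').toAffine.Point
  | .zero => 0
  | .some x y h =>
    if hx : x ∈ p.ring then some (p.res x) (p.res y) (hg.nonsingular_res h hx) else 0

theorem reduceFun_zero : reduceFun hg 0 = 0 := rfl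

theorem reduceFun_of_mem {x y : K} {h : (twoTorsionCurve A B).toAffine.Nonsingular x y}
    (hx : x ∈ p.ring) :
    reduceFun hg (some x y h) = some (p.res x) (p.res y) (hg.nonsingular_res h hx) := dif_pos hx

theorem reduceFun_of_notMem {x y : K} {h : (twoTorsionCurve A B).toAffine.Nonsingular x y}
    (hx : x ∉ p.ring) : reduceFun hg (some x y h) = 0 := dif_neg hx

theorem reduceFun_neg (P : (twoTorsionCurve A B).toAffine.Point) :
    reduceFun hg (-P) = -reduceFun hg P := by
  rcases P with _ | ⟨x, y, h⟩
  · rfl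
  · rw [neg_some_eq h (nonsingular_neg_y h)]
    by_cases hx : x ∈ p.ring
    · rw [reduceFun_of_mem hg hx, reduceFun_of_mem hg hx,
        neg_some_eq _ (nonsingular_neg_y (hg.nonsingular_res h hx))]
      exact some_congr rfl (res_neg (hg.mem_y h hx))
    · rw [reduceFun_of_notMem hg hx, reduceFun_of_notMem hg hx, Point.neg_zero]

include hg in
/-- If two points of a line section are integral, with integral third abscissa, so are the
coefficients of the line. -/
theorem GoodReduction.mem_line {ℓ n x₁ y₁ x₂ y₂ x₃ y₃ : K}
    (hL : LineSection A B ℓ n x₁ y₁ x₂ y₂ x₃ y₃) (hx₁ : x₁ ∈ p.ring) (hy₁ : y₁ ∈ p.ring)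
    (hx₂ : x₂ ∈ p.ring) (hx₃ : x₃ ∈ p.ring) : ℓ ∈ p.ring ∧ n ∈ p.ring := by
  have hℓ : ℓ ∈ p.ring := by
    apply mem_of_pow_mem two_ne_zero
    rw [show ℓ ^ 2 = x₁ + x₂ + x₃ + A by linear_combination -hL.sum]
    exact add_mem (add_mem (add_mem hx₁ hx₂) hx₃) hg.memA
  refine ⟨hℓ, ?_⟩
  rw [show n = y₁ - ℓ * x₁ by linear_combination -hL.y₁_eq]
  exact sub_mem hy₁ (mul_mem hℓ hx₁)

include hg in
theorem GoodReduction.lineSection_res {ℓ n x₁ y₁ x₂ y₂ x₃ y₃ : K}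
    (hL : LineSection A B ℓ n x₁ y₁ x₂ y₂ x₃ y₃) (hx₁ : x₁ ∈ p.ring) (hy₁ : y₁ ∈ p.ring)
    (hx₂ : x₂ ∈ p.ring) (hy₂ : y₂ ∈ p.ring) (hx₃ : x₃ ∈ p.ring) (hy₃ : y₃ ∈ p.ring) :
    LineSection A' B' (p.res ℓ) (p.res n) (p.res x₁) (p.res y₁) (p.res x₂) (p.res y₂)
      (p.res x₃) (p.res y₃) := by
  obtain ⟨hℓ, hn⟩ := hg.mem_line hL hx₁ hy₁ hx₂ hx₃
  have hA := hg.memA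
  have hB := hg.memB
  rw [← hg.resA, ← hg.resB]
  obtain ⟨h1, h2, h3, h4, h5, h6⟩ := hL
  lift x₁ to p.ring using hx₁
  lift y₁ to p.ring using hy₁
  lift x₂ to p.ring using hx₂
  lift y₂ to p.ring using hy₂
  lift x₃ to p.ring using hx₃
  lift y₃ to p.ring using hy₃
  lift ℓ to p.ring using hℓ
  lift n to p.ring using hn
  lift A to p.ring using hA
  lift B to p.ring using hB
  have hr : ∀ x : p.ring, p.res x = p.residue x := fun x => res_of_mem x.2
  simp only [hr]
  rw [mul_assoc, two_mul] at h2
  norm_cast at h1 h2 h3 h4 h5 h6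
  refine ⟨?_, ?_, ?_, ?_, ?_, ?_⟩
  · simpa using congrArg p.residue h1
  · rw [mul_assoc, two_mul]
    simpa using congrArg p.residue h2
  · simpa using congrArg p.residue h3
  · simpa using congrArg p.residue h4
  · simpa using congrArg p.residue h5
  · simpa using congrArg p.residue h6

include hg in
/-- When exactly one of three collinear points reduces to infinity, the other two reduce to opposite
points. -/
theorem GoodReduction.res_opposite {ℓ n x₁ y₁ x₂ y₂ x₃ y₃ : K}
    (hL : LineSection A B ℓ n x₁ y₁ x₂ y₂ x₃ y₃) (hx₁ : x₁ ∈ p.ring) (hy₁ : y₁ ∈ p.ring)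
    (hx₂ : x₂ ∈ p.ring) (hy₂ : y₂ ∈ p.ring) (hx₃ : x₃ ∉ p.ring) :
    p.res x₁ = p.res x₂ ∧ p.res y₁ + p.res y₂ = 0 := by
  have hA := hg.memA
  have hB := hg.memB
  have hℓ : 1 < p.val ℓ := by
    by_contra h
    have hℓ : ℓ ∈ p.ring := mem_iff.2 (not_lt.1 h)
    apply hx₃
    rw [show x₃ = ℓ ^ 2 - A - x₁ - x₂ by linear_combination hL.sum]
    exact sub_mem (sub_mem (sub_mem (pow_mem hℓ _) hA) hx₁) hx₂
  have hℓ0 : ℓ ≠ 0 := by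
    rintro rfl
    simp at hℓ
  have hm : p.val ℓ⁻¹ < 1 := by
    rw [map_inv₀]
    exact inv_lt_one_of_one_lt₀ hℓ
  have hm' := mem_of_val_lt_one hm
  have hm0 := res_eq_zero_of_val_lt_one hm
  have hx : x₁ - x₂ = ℓ⁻¹ * (y₁ - y₂) := by
    rw [hL.y₁_eq, hL.y₂_eq]; field_simp; ring
  have hy : y₁ + y₂ = ℓ⁻¹ * (B - x₁ * x₂ + (A + x₁ + x₂) * (x₁ + x₂)) := by
    have hn : n = y₁ - ℓ * x₁ := by linear_combination -hL.y₁_eq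
    have h2 := hL.pairs
    rw [show x₃ = ℓ ^ 2 - A - x₁ - x₂ by linear_combination hL.sum, hn] at h2
    rw [eq_inv_mul_iff_mul_eq₀ hℓ0]
    linear_combination h2 + ℓ * hL.y₂_eq + ℓ * hn
  constructor
  · rw [← sub_eq_zero, ← res_sub hx₁ hx₂, hx, res_mul hm' (sub_mem hy₁ hy₂), hm0, zero_mul]
  · rw [← res_add hy₁ hy₂, hy, res_mul hm' (add_mem (sub_mem hB (mul_mem hx₁ hx₂))
      (mul_mem (add_mem (add_mem hA hx₁) hx₂) (add_mem hx₁ hx₂))), hm0, zero_mul]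

include hg in
/-- Two of three collinear points cannot reduce to infinity without the third. -/
theorem GoodReduction.mem_or_mem {ℓ n x₁ y₁ x₂ y₂ x₃ y₃ : K}
    (hL : LineSection A B ℓ n x₁ y₁ x₂ y₂ x₃ y₃) (hx₃ : x₃ ∈ p.ring) (hy₃ : y₃ ∈ p.ring) :
    x₁ ∈ p.ring ∨ x₂ ∈ p.ring := by
  have hA := hg.memA
  have hB := hg.memB
  by_contra! h
  obtain ⟨hx₁, hx₂⟩ := h
  -- the abscissas are measured from the integral point
  have key : ∀ x, x ∉ p.ring → 1 < p.val (x - x₃) := fun x hx => by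
    by_contra h
    exact hx (by simpa using add_mem (mem_iff.2 (not_lt.1 h)) hx₃)
  have ha := key x₁ hx₁
  have hb := key x₂ hx₂
  have h2 : (2 : K) ∈ p.ring := by exact_mod_cast natCast_mem p.ring 2
  have h3 : (3 : K) ∈ p.ring := by exact_mod_cast natCast_mem p.ring 3
  have hn : n = y₃ - ℓ * x₃ := by linear_combination -hL.y₃_eq
  have h1 : (x₁ - x₃) * (x₂ - x₃) = 3 * x₃ ^ 2 + 2 * A * x₃ + B - 2 * ℓ * y₃ := by
    have := hL.pairs
    rw [hn] at this
    linear_combination this - 2 * x₃ * hL.sum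
  have h1' : ℓ ^ 2 = (x₁ - x₃) + (x₂ - x₃) + (3 * x₃ + A) := by linear_combination -hL.sum
  have hab : 1 < p.val (x₁ - x₃) * p.val (x₂ - x₃) := one_lt_mul'' ha hb
  have hc1 : p.val (3 * x₃ ^ 2 + 2 * A * x₃ + B) ≤ 1 := mem_iff.1
    (add_mem (add_mem (mul_mem h3 (pow_mem hx₃ _)) (mul_mem (mul_mem h2 hA) hx₃)) hB)
  have hc2 : p.val (3 * x₃ + A) ≤ 1 := mem_iff.1 (add_mem (mul_mem h3 hx₃) hA)
  have hℓ : p.val (x₁ - x₃) * p.val (x₂ - x₃) ≤ p.val ℓ := by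
    by_contra h
    push Not at h
    have h' := h1
    apply_fun p.val at h'
    rw [map_mul] at h'
    have : p.val (3 * x₃ ^ 2 + 2 * A * x₃ + B - 2 * ℓ * y₃) <
        p.val (x₁ - x₃) * p.val (x₂ - x₃) := by
      refine Valuation.map_sub_lt _ (hc1.trans_lt hab) (lt_of_le_of_lt ?_ h)
      rw [map_mul, map_mul]
      calc p.val 2 * p.val ℓ * p.val y₃ ≤ 1 * p.val ℓ * 1 := by
            gcongr
            · exact mem_iff.1 h2
            · exact mem_iff.1 hy₃
        _ = p.val ℓ := by simp
    exact this.ne h'.symm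
  have hlt : p.val (ℓ ^ 2) < p.val ℓ := by
    rw [h1']
    refine Valuation.map_add_lt _ (Valuation.map_add_lt _ ?_ ?_) (hc2.trans_lt (hab.trans_le hℓ))
    · refine lt_of_lt_of_le ?_ hℓ
      exact lt_mul_of_one_lt_right (zero_lt_one.trans ha) hb
    · refine lt_of_lt_of_le ?_ hℓ
      exact lt_mul_of_one_lt_left (zero_lt_one.trans hb) ha
  rw [map_pow] at hlt
  exact absurd hlt (not_lt.2 (le_self_pow₀ (hab.trans_le hℓ).le two_ne_zero))

variable [DecidableEq K] [DecidableEq k]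

theorem reduceFun_add_eq_zero {P Q R : (twoTorsionCurve A B).toAffine.Point}
    (h : P + Q + R = 0) : reduceFun hg P + reduceFun hg Q + reduceFun hg R = 0 := by
  have h2 : (2 : k) ≠ 0 := fun h => hg.discr (by rw [h]; ring)
  have key : ∀ P Q : (twoTorsionCurve A B).toAffine.Point, P + Q = 0 →
      reduceFun hg P + reduceFun hg Q = 0 := fun P Q h => by
    rw [eq_neg_of_add_eq_zero_left h, reduceFun_neg, neg_add_cancel]
  by_cases hP : P = 0
  · subst hP
    rw [zero_add] at h
    rw [reduceFun_zero, zero_add, key _ _ h]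
  by_cases hQ : Q = 0
  · subst hQ
    rw [add_zero] at h
    rw [reduceFun_zero, add_zero, key _ _ h]
  by_cases hR : R = 0
  · subst hR
    rw [add_zero] at h
    rw [reduceFun_zero, add_zero, key _ _ h]
  rcases P with _ | ⟨x₁, y₁, h₁⟩
  · exact absurd rfl hP
  rcases Q with _ | ⟨x₂, y₂, h₂⟩
  · exact absurd rfl hQ
  rcases R with _ | ⟨x₃, y₃, h₃⟩
  · exact absurd rfl hR
  obtain ⟨ℓ, n, hL⟩ := exists_lineSection h
  by_cases hx₁ : x₁ ∈ p.ring <;> by_cases hx₂ : x₂ ∈ p.ring <;> by_cases hx₃ : x₃ ∈ p.ring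
  · have hy₁ := hg.mem_y h₁ hx₁
    have hy₂ := hg.mem_y h₂ hx₂
    have hy₃ := hg.mem_y h₃ hx₃
    rw [reduceFun_of_mem hg hx₁, reduceFun_of_mem hg hx₂, reduceFun_of_mem hg hx₃]
    exact add_eq_zero_of_lineSection h2 _ _ _
      (hg.lineSection_res hL hx₁ hy₁ hx₂ hy₂ hx₃ hy₃)
  · rw [reduceFun_of_mem hg hx₁, reduceFun_of_mem hg hx₂, reduceFun_of_notMem hg hx₃, add_zero]
    obtain ⟨hx, hy⟩ := hg.res_opposite hL hx₁ (hg.mem_y h₁ hx₁) hx₂ (hg.mem_y h₂ hx₂) hx₃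
    exact add_of_Y_eq hx (by rw [twoTorsionCurve_negY]; linear_combination hy)
  · rw [reduceFun_of_mem hg hx₁, reduceFun_of_notMem hg hx₂, reduceFun_of_mem hg hx₃, add_zero]
    obtain ⟨hx, hy⟩ := hg.res_opposite hL.rotate.rotate hx₃ (hg.mem_y h₃ hx₃) hx₁
      (hg.mem_y h₁ hx₁) hx₂
    exact add_of_Y_eq hx.symm (by rw [twoTorsionCurve_negY]; linear_combination hy)
  · rcases hg.mem_or_mem hL.rotate hx₁ (hg.mem_y h₁ hx₁) with h | h
    exacts [absurd h hx₂, absurd h hx₃]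
  · rw [reduceFun_of_notMem hg hx₁, reduceFun_of_mem hg hx₂, reduceFun_of_mem hg hx₃, zero_add]
    obtain ⟨hx, hy⟩ := hg.res_opposite hL.rotate hx₂ (hg.mem_y h₂ hx₂) hx₃
      (hg.mem_y h₃ hx₃) hx₁
    exact add_of_Y_eq hx (by rw [twoTorsionCurve_negY]; linear_combination hy)
  · rcases hg.mem_or_mem hL.rotate.rotate hx₂ (hg.mem_y h₂ hx₂) with h | h
    exacts [absurd h hx₃, absurd h hx₁]
  · rcases hg.mem_or_mem hL hx₃ (hg.mem_y h₃ hx₃) with h | h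
    exacts [absurd h hx₁, absurd h hx₂]
  · rw [reduceFun_of_notMem hg hx₁, reduceFun_of_notMem hg hx₂, reduceFun_of_notMem hg hx₃,
      add_zero, add_zero]

/-- The reduction of points at a place of good reduction is a homomorphism. -/
noncomputable def reduce : (twoTorsionCurve A B).toAffine.Point →+
    (twoTorsionCurve A' B').toAffine.Point :=
  AddMonoidHom.mk' (reduceFun hg) fun P Q => by
    have := reduceFun_add_eq_zero hg (add_neg_cancel (P + Q))
    rw [reduceFun_neg] at this
    exact (add_neg_eq_zero.1 this).symm

theorem reduce_of_mem {x y : K} {h : (twoTorsionCurve A B).toAffine.Nonsingular x y}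
    (hx : x ∈ p.ring) :
    reduce hg (some x y h) = some (p.res x) (p.res y) (hg.nonsingular_res h hx) :=
  reduceFun_of_mem hg (h := h) hx

theorem notMem_of_reduce_eq_zero {x y : K} {h : (twoTorsionCurve A B).toAffine.Nonsingular x y}
    (h0 : reduce hg (some x y h) = 0) : x ∉ p.ring := fun hx => by
  rw [reduce_of_mem hg hx] at h0
  exact some_ne_zero _ h0

end Place

end DiophantineCurves

/-! ### Torsion in the kernel of reduction -/

namespace DiophantineCurves

open WeierstrassCurve.Affine WeierstrassCurve.Affine.Point

namespace Place

variable {K k : Type*} [Field K] [Field k] {p : Place K k} {A B : K} {A' B' : k}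

/-- The function `x / y`, a local parameter at infinity. -/
noncomputable def infParam : (twoTorsionCurve A B).toAffine.Point → K
  | .zero => 0
  | .some x y _ => x / y

@[simp]
theorem infParam_zero : infParam (0 : (twoTorsionCurve A B).toAffine.Point) = 0 := rfl

theorem infParam_some {x y : K} (h : (twoTorsionCurve A B).toAffine.Nonsingular x y) :
    infParam (some x y h) = x / y := rfl

theorem infParam_neg (P : (twoTorsionCurve A B).toAffine.Point) :
    infParam (-P) = -infParam P := by
  rcases P with _ | ⟨x, y, h⟩
  · exact neg_zero.symm
  · rw [neg_some_eq h (nonsingular_neg_y h), infParam_some, infParam_some, div_neg]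

variable (hg : p.GoodReduction A B A' B')

include hg in
theorem GoodReduction.val_y_sq {x y : K} (h : (twoTorsionCurve A B).toAffine.Nonsingular x y)
    (hx : 1 < p.val x) : p.val y ^ 2 = p.val x ^ 3 := by
  have hx2 : p.val x < p.val x ^ 2 := lt_self_pow₀ hx one_lt_two
  rw [← map_pow, twoTorsionCurve_equation_iff.1 h.1, add_assoc, ← map_pow]
  apply Valuation.map_add_eq_of_lt_left
  have h3 : p.val x ^ 2 < p.val x ^ 3 := pow_lt_pow_right₀ hx (by norm_num)
  rw [map_pow p.val x 3]
  refine Valuation.map_add_lt _ ?_ ?_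
  · rw [map_mul, map_pow]
    exact (mul_le_of_le_one_left' (mem_iff.1 hg.memA)).trans_lt h3
  · rw [map_mul]
    exact (mul_le_of_le_one_left' (mem_iff.1 hg.memB)).trans_lt (hx2.trans h3)

include hg in
theorem GoodReduction.val_infParam_sq {x y : K}
    (h : (twoTorsionCurve A B).toAffine.Nonsingular x y)
    (hx : 1 < p.val x) : p.val (x / y) ^ 2 * p.val x = 1 := by
  have h0 : p.val x ≠ 0 := (zero_lt_one.trans hx).ne'
  rw [map_div₀, div_pow, hg.val_y_sq h hx]
  field_simp

include hg in
/-- In the kernel of reduction the sum of the parameters of three collinear points is smaller than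
each of the parameters: the group law is addition to first order. -/
theorem GoodReduction.val_sum_infParam_lt {ℓ n x₁ y₁ x₂ y₂ x₃ y₃ : K}
    (h₁ : (twoTorsionCurve A B).toAffine.Nonsingular x₁ y₁)
    (h₂ : (twoTorsionCurve A B).toAffine.Nonsingular x₂ y₂)
    (h₃ : (twoTorsionCurve A B).toAffine.Nonsingular x₃ y₃)
    (hL : LineSection A B ℓ n x₁ y₁ x₂ y₂ x₃ y₃)
    (hx₁ : 1 < p.val x₁) (hx₂ : 1 < p.val x₂) (hx₃ : 1 < p.val x₃) :
    p.val (x₁ / y₁ + x₂ / y₂ + x₃ / y₃) < p.val (x₁ / y₁) := by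
  have h2 : (2 : K) ∈ p.ring := by exact_mod_cast natCast_mem p.ring 2
  have hy : ∀ {x y : K}, (twoTorsionCurve A B).toAffine.Nonsingular x y → 1 < p.val x → y ≠ 0 :=
    fun h hx hy => by
      have := hg.val_y_sq h hx
      rw [hy, _root_.map_zero, zero_pow two_ne_zero] at this
      exact (pow_ne_zero 3 (zero_lt_one.trans hx).ne') this.symm
  have hy₁ := hy h₁ hx₁
  have hy₂ := hy h₂ hx₂
  have hy₃ := hy h₃ hx₃
  have hn : p.val n ^ 2 = p.val x₁ * p.val x₂ * p.val x₃ := by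
    rw [← map_pow, ← hL.prod, map_mul, map_mul]
  have h12 : 1 < p.val x₁ * p.val x₂ := one_lt_mul'' hx₁ hx₂
  have h23 : 1 < p.val x₂ * p.val x₃ := one_lt_mul'' hx₂ hx₃
  have h13 : 1 < p.val x₁ * p.val x₃ := one_lt_mul'' hx₁ hx₃
  have hn1 : 1 < p.val n := by
    refine (one_lt_pow_iff two_ne_zero).1 ?_
    rw [hn]
    exact one_lt_mul'' h12 hx₃
  have hℓ : p.val ℓ < p.val n := by
    refine lt_of_pow_lt_pow_left₀ 2 zero_le ?_
    rw [← map_pow, show ℓ ^ 2 = x₁ + x₂ + x₃ + A by linear_combination -hL.sum, hn]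
    refine Valuation.map_add_lt _ (Valuation.map_add_lt _ (Valuation.map_add_lt _ ?_ ?_) ?_) ?_
    · rw [mul_assoc]
      exact lt_mul_of_one_lt_right (zero_lt_one.trans hx₁) h23
    · rw [mul_right_comm]
      exact lt_mul_of_one_lt_left (zero_lt_one.trans hx₂) h13
    · exact lt_mul_of_one_lt_left (zero_lt_one.trans hx₃) h12
    · exact (mem_iff.1 hg.memA).trans_lt (one_lt_mul'' h12 hx₃)
  have hid : (x₁ / y₁ + x₂ / y₂ + x₃ / y₃) * (n ^ 2 + (ℓ ^ 2 * B - ℓ * n * A)) =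
      2 * ℓ * B - n * A := by
    have hn0 : n ≠ 0 := by
      rintro rfl
      simp at hn1
    have hden : y₁ * y₂ * y₃ = n * (n ^ 2 + (ℓ ^ 2 * B - ℓ * n * A)) := by
      rw [hL.y₁_eq, hL.y₂_eq, hL.y₃_eq]
      linear_combination ℓ ^ 3 * hL.prod + ℓ ^ 2 * n * hL.pairs + ℓ * n ^ 2 * hL.sum
    have hnum : x₁ * y₂ * y₃ + x₂ * y₁ * y₃ + x₃ * y₁ * y₂ = n * (2 * ℓ * B - n * A) := by
      rw [hL.y₁_eq, hL.y₂_eq, hL.y₃_eq]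
      linear_combination 3 * ℓ ^ 2 * hL.prod + 2 * ℓ * n * hL.pairs + n ^ 2 * hL.sum
    apply mul_left_cancel₀ hn0
    calc n * ((x₁ / y₁ + x₂ / y₂ + x₃ / y₃) * (n ^ 2 + (ℓ ^ 2 * B - ℓ * n * A)))
        = (x₁ / y₁ + x₂ / y₂ + x₃ / y₃) * (n * (n ^ 2 + (ℓ ^ 2 * B - ℓ * n * A))) := by ring
      _ = (x₁ / y₁ + x₂ / y₂ + x₃ / y₃) * (y₁ * y₂ * y₃) := by rw [hden]
      _ = x₁ * y₂ * y₃ + x₂ * y₁ * y₃ + x₃ * y₁ * y₂ := by field_simp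
      _ = _ := hnum
  have hA := mem_iff.1 hg.memA
  have hB := mem_iff.1 hg.memB
  have hℓn : p.val ℓ * p.val n < p.val n ^ 2 := by
    rw [pow_two]
    exact mul_lt_mul_of_pos_right hℓ (zero_lt_one.trans hn1)
  have hden : p.val (n ^ 2 + (ℓ ^ 2 * B - ℓ * n * A)) = p.val n ^ 2 := by
    rw [← map_pow]
    apply Valuation.map_add_eq_of_lt_left
    rw [map_pow p.val n]
    refine Valuation.map_sub_lt _ ?_ ?_
    · rw [map_mul, map_pow]
      exact (mul_le_of_le_one_right' hB).trans_lt (pow_lt_pow_left₀ hℓ zero_le two_ne_zero)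
    · rw [map_mul, map_mul]
      exact (mul_le_of_le_one_right' hA).trans_lt hℓn
  have hnum : p.val (2 * ℓ * B - n * A) ≤ p.val n := by
    refine (Valuation.map_sub _ _ _).trans (max_le ?_ ?_)
    · rw [map_mul, map_mul]
      calc p.val 2 * p.val ℓ * p.val B ≤ 1 * p.val n * 1 := by
            gcongr
            exact mem_iff.1 h2
        _ = p.val n := by simp
    · rw [map_mul]
      exact mul_le_of_le_one_right' hA
  set s := x₁ / y₁ + x₂ / y₂ + x₃ / y₃
  have hs : p.val s * p.val n ≤ 1 := by
    have h := congrArg p.val hid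
    rw [map_mul, hden] at h
    rw [← h, pow_two, ← mul_assoc] at hnum
    exact (mul_le_iff_le_one_left (zero_lt_one.trans hn1)).1 hnum
  by_contra! hc
  have h1 : (p.val (x₁ / y₁) * p.val n) ^ 2 ≤ 1 :=
    pow_le_one₀ zero_le ((mul_le_mul_left hc _).trans hs)
  rw [mul_pow, hn, mul_assoc (p.val x₁), ← mul_assoc, hg.val_infParam_sq h₁ hx₁, one_mul] at h1
  exact absurd h23 (not_lt.2 h1)

variable [DecidableEq K] [DecidableEq k]

theorem val_of_reduce_eq_zero {x y : K} {h : (twoTorsionCurve A B).toAffine.Nonsingular x y}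
    (h0 : reduce hg (some x y h) = 0) : 1 < p.val x := by
  have := notMem_of_reduce_eq_zero hg h0
  rwa [mem_iff, not_le] at this

theorem val_infParam_add_sub_lt {P Q : (twoTorsionCurve A B).toAffine.Point}
    (hP : reduce hg P = 0) (hQ : reduce hg Q = 0) (hP0 : P ≠ 0) :
    p.val (infParam (P + Q) - infParam P - infParam Q) < p.val (infParam P) := by
  have hpos : 0 < p.val (infParam P) := by
    rcases P with _ | ⟨x, y, h⟩
    · exact absurd rfl hP0
    · rw [infParam_some]
      have := hg.val_infParam_sq h (val_of_reduce_eq_zero hg hP)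
      rw [zero_lt_iff]
      intro h0
      rw [h0, zero_pow two_ne_zero, zero_mul] at this
      exact zero_ne_one this
  by_cases hQ0 : Q = 0
  · subst hQ0
    simpa using hpos
  by_cases hPQ : P + Q = 0
  · have : infParam Q = -infParam P := by rw [eq_neg_of_add_eq_zero_right hPQ, infParam_neg]
    rw [hPQ, this]
    simpa using hpos
  have hR : reduce hg (-(P + Q)) = 0 := by rw [map_neg, map_add, hP, hQ]; simp
  have hR0 : -(P + Q) ≠ 0 := neg_ne_zero.2 hPQ
  have hsum : P + Q + -(P + Q) = 0 := add_neg_cancel _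
  have hz : infParam (P + Q) - infParam P - infParam Q =
      -(infParam P + infParam Q + infParam (-(P + Q))) := by rw [infParam_neg]; ring
  rw [hz, Valuation.map_neg]
  generalize -(P + Q) = R at *
  rcases P with _ | ⟨x₁, y₁, h₁⟩
  · exact absurd rfl hP0
  rcases Q with _ | ⟨x₂, y₂, h₂⟩
  · exact absurd rfl hQ0
  rcases R with _ | ⟨x₃, y₃, h₃⟩
  · exact absurd rfl hR0
  obtain ⟨ℓ, n, hL⟩ := exists_lineSection hsum
  exact hg.val_sum_infParam_lt h₁ h₂ h₃ hL (val_of_reduce_eq_zero hg hP)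
    (val_of_reduce_eq_zero hg hQ) (val_of_reduce_eq_zero hg hR)

/-- The kernel of reduction has no torsion of order prime to the residue characteristic. -/
theorem eq_zero_of_nsmul_eq_zero {P : (twoTorsionCurve A B).toAffine.Point}
    (hP : reduce hg P = 0) {n : ℕ} (hn : (n : k) ≠ 0) (h : n • P = 0) : P = 0 := by
  by_contra hP0
  have key : ∀ m : ℕ, p.val (infParam (m • P) - m * infParam P) < p.val (infParam P) := by
    intro m
    induction m with
    | zero =>
      have := val_infParam_add_sub_lt hg hP (_root_.map_zero _) hP0
      simp only [zero_nsmul, infParam_zero, Nat.cast_zero, zero_mul, sub_zero, _root_.map_zero]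
      exact lt_of_le_of_lt zero_le this
    | succ m ih =>
      have h1 := val_infParam_add_sub_lt hg hP (Q := m • P) (by rw [map_nsmul, hP, nsmul_zero]) hP0
      have : infParam ((m + 1) • P) - ((m + 1 : ℕ) : K) * infParam P =
          (infParam (P + m • P) - infParam P - infParam (m • P)) +
            (infParam (m • P) - m * infParam P) := by
        rw [succ_nsmul']
        push_cast
        ring
      rw [this]
      exact Valuation.map_add_lt _ h1 ih
  have h1 := key n
  rw [h, infParam_zero, zero_sub, Valuation.map_neg, map_mul,
    val_eq_one_of_res_ne_zero (natCast_mem _ n) (by rwa [res_natCast]), one_mul] at h1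
  exact lt_irrefl _ h1

end Place

end DiophantineCurves

/-! ### The place of a prime element -/

namespace DiophantineCurves

namespace Place

variable {R K k : Type*} [CommRing R] [IsDomain R] [UniqueFactorizationMonoid R] [Field K]
  [Algebra R K] [IsFractionRing R K] [Field k] (φ : R →+* k) {π : R}

section

omit [UniqueFactorizationMonoid R]

/-- The elements of `R` that do not vanish under `φ`. -/
def nonvanishing : Submonoid R := (nonZeroDivisors k).comap φ

omit [IsDomain R] in
variable {φ} in
theorem mem_nonvanishing {x : R} : x ∈ nonvanishing φ ↔ φ x ≠ 0 := mem_nonZeroDivisors_iff_ne_zero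

theorem nonvanishing_le : nonvanishing φ ≤ nonZeroDivisors R := fun x hx => by
  rw [mem_nonvanishing] at hx
  exact mem_nonZeroDivisors_of_ne_zero fun h => hx (by rw [h, map_zero])

variable (K) in
/-- The localization of `R` away from the kernel of `φ`, inside the field of fractions. -/
noncomputable abbrev localRing : Subalgebra R K :=
  Localization.subalgebra.ofField K _ (nonvanishing_le φ)

theorem mem_localRing_iff {x : K} :
    x ∈ localRing K φ ↔ ∃ a b : R, φ b ≠ 0 ∧ x = algebraMap R K a / algebraMap R K b := by
  constructor
  · rintro ⟨a, b, hb, rfl⟩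
    exact ⟨a, b, mem_nonvanishing.1 hb, by rw [div_eq_mul_inv]⟩
  · rintro ⟨a, b, hb, rfl⟩
    exact ⟨a, b, mem_nonvanishing.2 hb, by rw [div_eq_mul_inv]⟩

variable (K) in
/-- The extension of `φ` to the localization. -/
noncomputable def localResidue : localRing K φ →+* k :=
  IsLocalization.lift (M := nonvanishing φ) (g := φ) fun y =>
    IsUnit.mk0 _ (mem_nonvanishing.1 y.2)

theorem localResidue_algebraMap (a : R) : localResidue K φ (algebraMap R _ a) = φ a :=
  IsLocalization.lift_eq _ a

end

/-- A fraction has a representation in which one of the two terms does not vanish under `φ`, when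
the kernel of `φ` is generated by a prime. -/
theorem exists_div_of_prime (hπ : Prime π) (hφ : ∀ x, φ x = 0 ↔ π ∣ x) (x : K) :
    ∃ a b : R, (φ a ≠ 0 ∨ φ b ≠ 0) ∧ b ≠ 0 ∧ x = algebraMap R K a / algebraMap R K b := by
  obtain ⟨a, b, hab, h⟩ := IsFractionRing.exists_reduced_fraction (A := R) x
  refine ⟨a, b, ?_, nonZeroDivisors.ne_zero b.2, ?_⟩
  · by_contra! hc
    exact hπ.not_isUnit (hab ((hφ _).1 hc.1) ((hφ _).1 hc.2))
  · rw [← h, IsFractionRing.mk'_eq_div]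

variable (K) in
/-- The place of the field of fractions of `R` given by a homomorphism `φ` to a field whose kernel
is generated by a prime element `π`. -/
noncomputable def ofPrime (hπ : Prime π) (hφ : ∀ x, φ x = 0 ↔ π ∣ x) : Place K k where
  ring :=
    { (localRing K φ).toSubring with
      mem_or_inv_mem' := fun x => by
        obtain ⟨a, b, h, -, rfl⟩ := exists_div_of_prime φ hπ hφ x
        rcases h with h | h
        · exact Or.inr ((mem_localRing_iff φ).2 ⟨b, a, h, by rw [inv_div]⟩)
        · exact Or.inl ((mem_localRing_iff φ).2 ⟨a, b, h, rfl⟩) }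
  residue := localResidue K φ
  residue_eq_zero_iff := by
    intro x
    rw [← ValuationSubring.valuation_lt_one_iff, IsLocalRing.mem_maximalIdeal, mem_nonunits_iff]
    constructor
    · intro h hu
      exact (hu.map (localResidue K φ)).ne_zero h
    · intro hu
      by_contra h
      obtain ⟨x, hx⟩ := x
      obtain ⟨a, b, hb, hab⟩ := (mem_localRing_iff φ).1 hx
      have hb0 : algebraMap R K b ≠ 0 := fun h0 => hb (by
        rw [(IsFractionRing.to_map_eq_zero_iff (K := K)).1 h0, map_zero])
      have ha : φ a ≠ 0 := by
        intro ha
        apply h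
        have : (⟨x, hx⟩ : localRing K φ) * algebraMap R _ b = algebraMap R _ a := by
          apply Subtype.ext
          change x * algebraMap R K b = algebraMap R K a
          rw [hab, div_mul_cancel₀ _ hb0]
        have h2 := congrArg (localResidue K φ) this
        rw [map_mul, localResidue_algebraMap, localResidue_algebraMap, ha] at h2
        exact (mul_eq_zero.1 h2).resolve_right hb
      have ha0 : algebraMap R K a ≠ 0 := fun h0 => ha (by
        rw [(IsFractionRing.to_map_eq_zero_iff (K := K)).1 h0, map_zero])
      apply hu
      refine IsUnit.of_mul_eq_one ⟨x⁻¹, (mem_localRing_iff φ).2 ⟨b, a, ha, by rw [hab, inv_div]⟩⟩ ?_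
      apply Subtype.ext
      change x * x⁻¹ = 1
      apply mul_inv_cancel₀
      rw [hab]
      exact div_ne_zero ha0 hb0

variable {φ} (hπ : Prime π) (hφ : ∀ x, φ x = 0 ↔ π ∣ x)

theorem mem_ofPrime_iff {x : K} : x ∈ (ofPrime K φ hπ hφ).ring ↔
    ∃ a b : R, φ b ≠ 0 ∧ x = algebraMap R K a / algebraMap R K b :=
  mem_localRing_iff φ

theorem algebraMap_mem_ofPrime (a : R) : algebraMap R K a ∈ (ofPrime K φ hπ hφ).ring :=
  (localRing K φ).algebraMap_mem a

theorem res_ofPrime_algebraMap (a : R) :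
    (ofPrime K φ hπ hφ).res (algebraMap R K a) = φ a := by
  rw [res_of_mem (algebraMap_mem_ofPrime hπ hφ a)]
  exact localResidue_algebraMap φ a

theorem div_mem_of_res_eq_zero {x : K} (hx : x ∈ (ofPrime K φ hπ hφ).ring)
    (h : (ofPrime K φ hπ hφ).res x = 0) :
    x / algebraMap R K π ∈ (ofPrime K φ hπ hφ).ring := by
  obtain ⟨a, b, hb, rfl⟩ := (mem_ofPrime_iff hπ hφ).1 hx
  have hb0 : algebraMap R K b ≠ 0 := fun h0 => hb (by
    rw [(IsFractionRing.to_map_eq_zero_iff (K := K)).1 h0, map_zero])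
  have hπ0 : algebraMap R K π ≠ 0 := fun h0 =>
    hπ.ne_zero ((IsFractionRing.to_map_eq_zero_iff (K := K)).1 h0)
  have ha : φ a = 0 := by
    have h1 := res_mul hx (algebraMap_mem_ofPrime hπ hφ b)
    rw [h, zero_mul, div_mul_cancel₀ _ hb0, res_ofPrime_algebraMap] at h1
    exact h1
  obtain ⟨c, rfl⟩ := (hφ a).1 ha
  refine (mem_ofPrime_iff hπ hφ).2 ⟨c, b, hb, ?_⟩
  rw [map_mul]
  field_simp

end Place

end DiophantineCurves

/-! ### Two-descent over a factorial ring -/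

namespace DiophantineCurves

section Factorial

variable {R : Type*} [CommRing R] [IsDomain R] [UniqueFactorizationMonoid R]

theorem finiteMultiplicity_of_prime {q m : R} (hq : Prime q) (hm : m ≠ 0) :
    FiniteMultiplicity q m := FiniteMultiplicity.of_prime_left hq hm

theorem multiplicity_mul_of_ne_zero {q m n : R} (hq : Prime q) (hm : m ≠ 0) (hn : n ≠ 0) :
    multiplicity q (m * n) = multiplicity q m + multiplicity q n :=
  multiplicity_mul hq (finiteMultiplicity_of_prime hq (mul_ne_zero hm hn))

/-- An element in which all primes have even multiplicity is a unit times a square. -/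
theorem exists_eq_unit_mul_sq {m : R} (hm : m ≠ 0)
    (h : ∀ q, Prime q → Even (multiplicity q m)) : ∃ u c : R, IsUnit u ∧ m = u * c ^ 2 := by
  induction m using (IsWellFounded.wf (r := DvdNotUnit (α := R))).induction with
  | _ m ih =>
    by_cases hu : IsUnit m
    · exact ⟨m, 1, hu, by ring⟩
    obtain ⟨q, hqi, hqm⟩ := WfDvdMonoid.exists_irreducible_factor hu hm
    have hq := UniqueFactorizationMonoid.irreducible_iff_prime.1 hqi
    have h2 : 2 ≤ multiplicity q m := by
      have h0 : multiplicity q m ≠ 0 := by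
        rw [Ne, multiplicity_eq_zero]
        exact not_not.2 hqm
      have := h q hq
      rcases this with ⟨r, hr⟩
      lia
    obtain ⟨m', rfl⟩ := (pow_dvd_pow q h2).trans (pow_multiplicity_dvd q m)
    have hm' : m' ≠ 0 := right_ne_zero_of_mul hm
    have hq2 : q ^ 2 ≠ 0 := left_ne_zero_of_mul hm
    obtain ⟨u, c, hu', hc⟩ := ih m' ⟨hm', q ^ 2, fun hh => hq.not_isUnit
      ((isUnit_pow_iff two_ne_zero).1 hh), by ring⟩ hm' fun p hp => by
      have h1 := h p hp
      rw [multiplicity_mul_of_ne_zero hp hq2 hm', pow_two,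
        multiplicity_mul_of_ne_zero hp hq.ne_zero hq.ne_zero] at h1
      rcases h1 with ⟨r, hr⟩
      exact ⟨r - multiplicity p q, by lia⟩
    exact ⟨u, q * c, hu', by rw [hc]; ring⟩

theorem multiplicity_prod_pow {ι : Type*} {f : ι → R} (hf : ∀ i, f i ≠ 0) (S : Finset ι)
    (n : ι → ℕ) {q : R} (hq : Prime q) :
    multiplicity q (∏ i ∈ S, f i ^ n i) = ∑ i ∈ S, n i * multiplicity q (f i) := by
  classical
  induction S using Finset.induction_on with
  | empty => simpa using multiplicity_eq_zero.2 fun h => hq.not_isUnit (isUnit_of_dvd_one h)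
  | insert i S hi ih =>
    rw [Finset.prod_insert hi, Finset.sum_insert hi, multiplicity_mul_of_ne_zero hq
      (pow_ne_zero _ (hf i)) (Finset.prod_ne_zero_iff.2 fun j _ => pow_ne_zero _ (hf j)), ih,
      (finiteMultiplicity_of_prime hq (hf i)).multiplicity_pow hq]

omit [IsDomain R] [UniqueFactorizationMonoid R] in
theorem multiplicity_prime_of_not_dvd {p q : R} (h : ¬ q ∣ p) : multiplicity q p = 0 :=
  multiplicity_eq_zero.2 h

omit [UniqueFactorizationMonoid R] in
theorem multiplicity_prime_of_dvd {p q : R} (hp : Prime p) (hq : Prime q) (h : q ∣ p) :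
    multiplicity q p = 1 := by
  rw [multiplicity_eq_of_associated_left (hq.associated_of_dvd hp h).symm]
  exact multiplicity_self

/-- An element in which all primes outside a finite set have even multiplicity is, up to a unit and
a square, a product of members of the set. -/
theorem exists_mul_prod_pow_eq_unit_mul_sq {ι : Type*} {f : ι → R} (hf : ∀ i, Prime (f i))
    (hne : ∀ i j, i ≠ j → ¬ f i ∣ f j) (S : Finset ι) {m : R} (hm : m ≠ 0)
    (h : ∀ q, Prime q → (∀ i ∈ S, ¬ q ∣ f i) → Even (multiplicity q m)) :
    ∃ u c : R, IsUnit u ∧ m * ∏ i ∈ S, f i ^ multiplicity (f i) m = u * c ^ 2 := by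
  have hP : ∏ i ∈ S, f i ^ multiplicity (f i) m ≠ 0 :=
    Finset.prod_ne_zero_iff.2 fun j _ => pow_ne_zero _ (hf j).ne_zero
  apply exists_eq_unit_mul_sq (mul_ne_zero hm hP)
  intro q hq
  rw [multiplicity_mul_of_ne_zero hq hm hP, multiplicity_prod_pow (fun i => (hf i).ne_zero) S _ hq]
  by_cases hS : ∃ i ∈ S, q ∣ f i
  · obtain ⟨i, hi, hqi⟩ := hS
    have hass := hq.associated_of_dvd (hf i) hqi
    rw [Finset.sum_eq_single_of_mem i hi, multiplicity_prime_of_dvd (hf i) hq hqi,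
      multiplicity_eq_of_associated_left hass, mul_one]
    · exact ⟨_, rfl⟩
    · intro j _ hj
      rw [multiplicity_prime_of_not_dvd (q := q), mul_zero]
      exact fun hqj => hne i j hj.symm (hass.symm.dvd.trans hqj)
  · push Not at hS
    rw [Finset.sum_eq_zero fun i hi => by rw [multiplicity_prime_of_not_dvd (hS i hi), mul_zero],
      add_zero]
    exact h q hq hS

/-- In a product of three elements which is a square, the multiplicity of a prime in the first
factor is even when the prime does not divide another factor as well. -/
theorem even_multiplicity {m₁ m₂ m₃ k q : R} (hk : k ≠ 0) (h : m₁ * m₂ * m₃ = k ^ 2)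
    (hq : Prime q) (h' : q ∣ m₁ → ¬ q ∣ m₂ ∧ ¬ q ∣ m₃) : Even (multiplicity q m₁) := by
  by_cases hd : q ∣ m₁
  · have h0 : m₁ * m₂ * m₃ ≠ 0 := by rw [h]; exact pow_ne_zero 2 hk
    have h12 := left_ne_zero_of_mul h0
    have := congrArg (multiplicity q) h
    rw [multiplicity_mul_of_ne_zero hq h12 (right_ne_zero_of_mul h0),
      multiplicity_mul_of_ne_zero hq (left_ne_zero_of_mul h12) (right_ne_zero_of_mul h12),
      multiplicity_prime_of_not_dvd (h' hd).1, multiplicity_prime_of_not_dvd (h' hd).2, pow_two,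
      multiplicity_mul_of_ne_zero hq hk hk] at this
    exact ⟨_, by simpa using this⟩
  · rw [multiplicity_prime_of_not_dvd hd]
    exact ⟨0, rfl⟩

variable {K : Type*} [Field K] [Algebra R K] [IsFractionRing R K]

/-- The coordinates of a point on `y² = x (x + M) (x + N)` have the denominators `e²` and `e³`. -/
theorem exists_eq_div_sq {M N : R} {x y : K}
    (h : y ^ 2 = x * (x + algebraMap R K M) * (x + algebraMap R K N)) :
    ∃ m e k : R, e ≠ 0 ∧ IsRelPrime m e ∧ x = algebraMap R K m / algebraMap R K e ^ 2 ∧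
      y = algebraMap R K k / algebraMap R K e ^ 3 := by
  have hinj := IsFractionRing.injective R K
  obtain ⟨n, d, hnd, rfl⟩ := IsFractionRing.exists_reduced_fraction (A := R) x
  obtain ⟨s, t, hst, rfl⟩ := IsFractionRing.exists_reduced_fraction (A := R) y
  obtain ⟨d, hd⟩ := d
  obtain ⟨t, ht⟩ := t
  rw [mem_nonZeroDivisors_iff_ne_zero] at hd ht
  simp only [IsFractionRing.mk'_eq_div] at *
  have hd' : algebraMap R K d ≠ 0 := fun h0 => hd (hinj (by rw [h0, map_zero]))
  have ht' : algebraMap R K t ≠ 0 := fun h0 => ht (hinj (by rw [h0, map_zero]))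
  have key : s ^ 2 * d ^ 3 = t ^ 2 * (n * (n + M * d) * (n + N * d)) := by
    apply hinj
    simp only [map_mul, map_pow, map_add]
    field_simp at h
    linear_combination h
  have h1 : t ^ 2 ∣ d ^ 3 :=
    (hst.symm.pow_left (m := 2) |>.pow_right (n := 2)).dvd_of_dvd_mul_left ⟨_, key⟩
  have hndM : ∀ L : R, IsRelPrime d (n + L * d) := fun L c hc hc' =>
    hnd ((dvd_add_left (hc.mul_left L)).1 hc') hc
  have h2 : d ^ 3 ∣ t ^ 2 := by
    refine IsRelPrime.dvd_of_dvd_mul_right (IsRelPrime.pow_left ?_) ⟨s ^ 2, by rw [← key]; ring⟩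
    exact (hnd.symm.mul_right (hndM M)).mul_right (hndM N)
  have h3 : d ∣ t := by
    have : d ^ 2 ∣ t ^ 2 := (pow_dvd_pow d (by norm_num)).trans h2
    exact (IsIntegrallyClosed.pow_dvd_pow_iff two_ne_zero).1 this
  obtain ⟨e, rfl⟩ := h3
  have h4 : d ∣ e ^ 2 := by
    have : d ^ 2 * d ∣ d ^ 2 * e ^ 2 := by convert h2 using 1 <;> ring
    exact (mul_dvd_mul_iff_left (pow_ne_zero 2 hd)).1 this
  have h5 : e ^ 2 ∣ d := by
    have : d ^ 2 * e ^ 2 ∣ d ^ 2 * d := by convert h1 using 1 <;> ring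
    exact (mul_dvd_mul_iff_left (pow_ne_zero 2 hd)).1 this
  obtain ⟨u, hu⟩ := associated_of_dvd_dvd h4 h5
  have he : e ≠ 0 := right_ne_zero_of_mul ht
  have he' : algebraMap R K e ≠ 0 := fun h0 => he (hinj (by rw [h0, map_zero]))
  have hu' : algebraMap R K e ^ 2 = algebraMap R K d * algebraMap R K u := by
    rw [← map_pow, ← hu, map_mul]
  have hu0 : algebraMap R K u ≠ 0 := (u.isUnit.map (algebraMap R K)).ne_zero
  refine ⟨n * u, e, s * u, he, ?_, ?_, ?_⟩
  · refine (isRelPrime_mul_unit_right_left u.isUnit).2 ?_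
    intro c hc hce
    exact hnd hc ((hce.trans (dvd_pow_self e two_ne_zero)).trans h5)
  · rw [hu', map_mul]
    field_simp
  · rw [pow_succ, hu', map_mul, map_mul]
    field_simp

/-- The type of a prime that divides two of the three factors of `x (x + M) (x + N)`: the index of
the factor that it does not divide is `exempt` of the type. -/
def exempt : Fin 3 → Fin 3 := ![2, 1, 0]

/-- The list of generators of the group of classes of the factors: the given primes and twice the
unit `-1`, which is of the type of the primes dividing `N` and of that of the primes dividing
`N - M`. -/
def withSigns {n : ℕ} (f : Fin n → R) : Fin (n + 2) → R := Fin.cons (-1) (Fin.cons (-1) f)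

/-- The types of the members of `withSigns`. -/
def withSignTypes {n : ℕ} (t : Fin n → Fin 3) : Fin (n + 2) → Fin 3 :=
  Fin.cons 1 (Fin.cons 2 t)

/-- The class of the factor `j` given by the exponents `β` of the generators. -/
def classProd {n : ℕ} (F : Fin n → R) (t : Fin n → Fin 3) (β : Fin n → ZMod 2) (j : Fin 3) : R :=
  ∏ i, F i ^ (if t i = exempt j then 0 else (β i).val)

omit [IsDomain R] [UniqueFactorizationMonoid R] in
theorem classProd_withSigns {n : ℕ} (f : Fin n → R) (t : Fin n → Fin 3) (β : Fin n → ZMod 2)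
    (s₀ s₁ : ZMod 2) (j : Fin 3) :
    classProd (withSigns f) (withSignTypes t) (Fin.cons s₀ (Fin.cons s₁ β)) j =
      (-1) ^ (if 1 = exempt j then 0 else s₀.val) *
        ((-1) ^ (if 2 = exempt j then 0 else s₁.val) * classProd f t β j) := by
  simp only [classProd, withSigns, withSignTypes, Fin.prod_univ_succ, Fin.cons_zero, Fin.cons_succ]

omit [IsDomain R] [UniqueFactorizationMonoid R] in
theorem isSquare_pow_mul_pow_mod_two (a : R) (v : ℕ) :
    IsSquare (a ^ v * a ^ ((v : ZMod 2)).val) := by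
  rw [ZMod.val_natCast, ← pow_add]
  refine Even.isSquare_pow ?_ a
  exact (Nat.even_add.2 (by rw [Nat.even_iff, Nat.even_iff, Nat.mod_mod]))

/-- The factors of `x (x + M) (x + N)` at a point are, up to squares, products of the primes that
divide two of the factors and a sign, with matching exponents. -/
theorem exists_isSquare_mul_classProd (hunit : ∀ u : R, IsUnit u → u = 1 ∨ u = -1) {n : ℕ}
    {f : Fin n → R} {t : Fin n → Fin 3} (hf : ∀ i, Prime (f i))
    (hne : ∀ i j, i ≠ j → ¬ f i ∣ f j) {M N : R}
    (hM : ∀ q, Prime q → q ∣ M → ∃ i, t i = 0 ∧ q ∣ f i)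
    (hN : ∀ q, Prime q → q ∣ N → ∃ i, t i = 1 ∧ q ∣ f i)
    (hNM : ∀ q, Prime q → q ∣ N - M → ∃ i, t i = 2 ∧ q ∣ f i) {x y : K}
    (h : y ^ 2 = x * (x + algebraMap R K M) * (x + algebraMap R K N)) (hy : y ≠ 0) :
    ∃ β : Fin (n + 2) → ZMod 2, ∀ j : Fin 3,
      IsSquare ((![x, x + algebraMap R K M, x + algebraMap R K N] j) *
        algebraMap R K (classProd (withSigns f) (withSignTypes t) β j)) := by
  have hinj := IsFractionRing.injective R K
  obtain ⟨m, e, k, he, hme, hx, hyk⟩ := exists_eq_div_sq h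
  have he' : algebraMap R K e ≠ 0 := fun h0 => he (hinj (by rw [h0, map_zero]))
  have hx2 : x + algebraMap R K M = algebraMap R K (m + M * e ^ 2) / algebraMap R K e ^ 2 := by
    rw [hx]; simp only [map_add, map_mul, map_pow]; field_simp
  have hx3 : x + algebraMap R K N = algebraMap R K (m + N * e ^ 2) / algebraMap R K e ^ 2 := by
    rw [hx]; simp only [map_add, map_mul, map_pow]; field_simp
  have hprod : m * (m + M * e ^ 2) * (m + N * e ^ 2) = k ^ 2 := by
    apply hinj
    rw [hx2, hx3, hx, hyk] at h
    simp only [map_mul, map_pow] at h ⊢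
    field_simp at h
    rw [h]
  have hk : k ≠ 0 := by
    rintro rfl
    exact hy (by rw [hyk, map_zero, zero_div])
  have hm0 : m * (m + M * e ^ 2) * (m + N * e ^ 2) ≠ 0 := by
    rw [hprod]; exact pow_ne_zero 2 hk
  have hm2 : m + M * e ^ 2 ≠ 0 := right_ne_zero_of_mul (left_ne_zero_of_mul hm0)
  have hm1 : m ≠ 0 := left_ne_zero_of_mul (left_ne_zero_of_mul hm0)
  -- a prime that divides one of the terms does not divide `e`
  have hqe : ∀ q, Prime q → ∀ L, q ∣ m + L * e ^ 2 → ¬ q ∣ e := fun q hq L hL hqe =>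
    hq.not_isUnit (hme ((dvd_add_left ((dvd_pow hqe two_ne_zero).mul_left L)).1 hL) hqe)
  have hdiff : ∀ q, Prime q → ∀ L L', q ∣ m + L * e ^ 2 → q ∣ m + L' * e ^ 2 → q ∣ L' - L :=
    fun q hq L L' h1 h2 => (hq.dvd_or_dvd (a := L' - L) (b := e ^ 2) (by
      have := dvd_sub h2 h1
      convert this using 1; ring)).resolve_right
        fun h3 => hqe q hq L h1 (hq.dvd_of_dvd_pow h3)
  have hdiff0 : ∀ q, Prime q → ∀ L', q ∣ m → q ∣ m + L' * e ^ 2 → q ∣ L' :=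
    fun q hq L' h1 h2 => by
      simpa using hdiff q hq 0 L' (by simpa using h1) h2
  -- the primes that may divide a factor to an odd power
  have ev1 : ∀ q, Prime q → (∀ i ∈ Finset.univ.filter (fun i => t i ≠ 2), ¬ q ∣ f i) →
      Even (multiplicity q m) := fun q hq hq' => even_multiplicity hk hprod hq fun h1 =>
    ⟨fun h2 => by
      obtain ⟨i, hi, hqi⟩ := hM q hq (hdiff0 q hq M h1 h2)
      exact hq' i (by simp [hi]) hqi,
    fun h2 => by
      obtain ⟨i, hi, hqi⟩ := hN q hq (hdiff0 q hq N h1 h2)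
      exact hq' i (by simp [hi]) hqi⟩
  have ev2 : ∀ q, Prime q → (∀ i ∈ Finset.univ.filter (fun i => t i ≠ 1), ¬ q ∣ f i) →
      Even (multiplicity q (m + M * e ^ 2)) := fun q hq hq' =>
    even_multiplicity (m₂ := m) (m₃ := m + N * e ^ 2) hk (by rw [← hprod]; ring) hq fun h1 =>
    ⟨fun h2 => by
      obtain ⟨i, hi, hqi⟩ := hM q hq (hdiff0 q hq M h2 h1)
      exact hq' i (by simp [hi]) hqi,
    fun h2 => by
      obtain ⟨i, hi, hqi⟩ := hNM q hq (hdiff q hq M N h1 h2)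
      exact hq' i (by simp [hi]) hqi⟩
  have ev3 : ∀ i, t i = 0 → Even (multiplicity (f i) (m + N * e ^ 2)) := fun i hi =>
    even_multiplicity (m₂ := m) (m₃ := m + M * e ^ 2) hk (by rw [← hprod]; ring) (hf i) fun h1 =>
    ⟨fun h2 => by
      obtain ⟨j, hj, hqj⟩ := hN _ (hf i) (hdiff0 _ (hf i) N h2 h1)
      exact hne i j (fun hij => by simp [← hij, hi] at hj) hqj,
    fun h2 => by
      obtain ⟨j, hj, hqj⟩ := hNM _ (hf i) (hdiff _ (hf i) M N h2 h1)
      exact hne i j (fun hij => by simp [← hij, hi] at hj) hqj⟩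
  have evsum : ∀ i, t i = 0 → (multiplicity (f i) (m + M * e ^ 2) : ZMod 2) =
      (multiplicity (f i) m : ZMod 2) := fun i hi => by
    have h1 := congrArg (multiplicity (f i)) hprod
    rw [multiplicity_mul_of_ne_zero (hf i) (left_ne_zero_of_mul hm0) (right_ne_zero_of_mul hm0),
      multiplicity_mul_of_ne_zero (hf i) hm1 hm2, pow_two k,
      multiplicity_mul_of_ne_zero (hf i) hk hk] at h1
    obtain ⟨r, hr⟩ := ev3 i hi
    rw [ZMod.natCast_eq_natCast_iff']
    lia
  obtain ⟨u₀, c₀, hu₀, h₀⟩ := exists_mul_prod_pow_eq_unit_mul_sq hf hne _ hm1 ev1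
  obtain ⟨u₁, c₁, hu₁, h₁⟩ := exists_mul_prod_pow_eq_unit_mul_sq hf hne _ hm2 ev2
  obtain ⟨s₀, hs₀⟩ : ∃ s : ZMod 2, u₀ = (-1) ^ s.val := by
    rcases hunit u₀ hu₀ with h | h
    · exact ⟨0, by rw [h]; simp⟩
    · exact ⟨1, by rw [h]; simp [ZMod.val_one]⟩
  obtain ⟨s₁, hs₁⟩ : ∃ s : ZMod 2, u₁ = (-1) ^ s.val := by
    rcases hunit u₁ hu₁ with h | h
    · exact ⟨0, by rw [h]; simp⟩
    · exact ⟨1, by rw [h]; simp [ZMod.val_one]⟩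
  set β : Fin n → ZMod 2 := fun i =>
    if t i = 2 then (multiplicity (f i) (m + M * e ^ 2) : ZMod 2) else multiplicity (f i) m with hβ
  have hsq : ∀ (L : R) (j : Fin 3) (c : R) (s : ZMod 2), (∀ i, t i ≠ exempt j →
      β i = (multiplicity (f i) L : ZMod 2)) →
      L * ∏ i with t i ≠ exempt j, f i ^ multiplicity (f i) L = (-1) ^ s.val * c ^ 2 →
      IsSquare (algebraMap R K (L * ((-1) ^ s.val * classProd f t β j))) := by
    intro L j c s hL hc
    have h1 : IsSquare ((∏ i with t i ≠ exempt j, f i ^ multiplicity (f i) L) *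
        classProd f t β j) := by
      have : classProd f t β j = ∏ i with t i ≠ exempt j, f i ^ (β i).val := by
        rw [classProd, Finset.prod_filter]
        refine Finset.prod_congr rfl fun i _ => ?_
        by_cases hi : t i = exempt j <;> simp [hi]
      rw [this, ← Finset.prod_mul_distrib]
      refine Finset.isSquare_prod _ fun i hi => ?_
      rw [Finset.mem_filter] at hi
      rw [hL i hi.2]
      exact isSquare_pow_mul_pow_mod_two _ _
    obtain ⟨r, hr⟩ := h1
    have hP0 : ∏ i with t i ≠ exempt j, f i ^ multiplicity (f i) L ≠ 0 :=
      Finset.prod_ne_zero_iff.2 fun j _ => pow_ne_zero _ (hf j).ne_zero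
    set P := ∏ i with t i ≠ exempt j, f i ^ multiplicity (f i) L
    have hP0' : algebraMap R K P ≠ 0 := fun h0 => hP0 (hinj (by rw [h0, map_zero]))
    refine ⟨algebraMap R K ((-1) ^ s.val * c * r) / algebraMap R K P, ?_⟩
    rw [div_mul_div_comm, eq_div_iff (mul_ne_zero hP0' hP0'), ← map_mul, ← map_mul, ← map_mul]
    congr 1
    linear_combination ((-1) ^ s.val * classProd f t β j * P) * hc +
      ((-1) ^ s.val * (-1) ^ s.val * c ^ 2) * hr
  have hS₀ := hsq m 0 c₀ s₀ (fun i hi => if_neg hi) (by rw [← hs₀]; exact h₀)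
  have hS₁ := hsq (m + M * e ^ 2) 1 c₁ s₁ (fun i hi => by
    simp only [hβ]
    split_ifs with h2
    · rfl
    · have : t i = 0 := by
        have h1 : t i ≠ 1 := hi
        revert h1 h2; generalize t i = a; revert a; decide
      exact (evsum i this).symm) (by rw [← hs₁]; exact h₁)
  have hE : IsSquare (1 / algebraMap R K e ^ 2) := ⟨1 / algebraMap R K e, by field_simp⟩
  have hX₀ : IsSquare (x * algebraMap R K ((-1) ^ s₀.val * classProd f t β 0)) := by
    have := hS₀.mul hE
    rwa [map_mul _ m, mul_one_div, mul_div_right_comm, ← hx] at this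
  have hX₁ : IsSquare ((x + algebraMap R K M) *
      algebraMap R K ((-1) ^ s₁.val * classProd f t β 1)) := by
    have := hS₁.mul hE
    rwa [map_mul _ (m + M * e ^ 2), mul_one_div, mul_div_right_comm, ← hx2] at this
  refine ⟨Fin.cons s₀ (Fin.cons s₁ β), fun j => ?_⟩
  rw [classProd_withSigns]
  fin_cases j
  · simpa [exempt] using hX₀
  · simpa [exempt] using hX₁
  · have hz : y ≠ 0 := hy
    have h2 : IsSquare (classProd f t β 0 * classProd f t β 1 * classProd f t β 2) := by
      rw [classProd, classProd, classProd, ← Finset.prod_mul_distrib, ← Finset.prod_mul_distrib]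
      refine Finset.isSquare_prod _ fun i _ => ?_
      rw [← pow_add, ← pow_add]
      refine Even.isSquare_pow ?_ _
      generalize t i = a
      generalize (β i).val = v
      fin_cases a <;> simp [exempt]
    have h3 : IsSquare (y ^ 2) := ⟨y, pow_two y⟩
    have h4 := ((hX₀.mul hX₁).mul h3).mul (h2.map (algebraMap R K))
    have hx0 : x ≠ 0 := by rintro rfl; exact hy (by simpa using h)
    have hxM : x + algebraMap R K M ≠ 0 := fun h0 => hy (by simpa [h0] using h)
    have hC0 : ∀ j, classProd f t β j ≠ 0 := fun j =>
      Finset.prod_ne_zero_iff.2 fun i _ => pow_ne_zero _ (hf i).ne_zero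
    have hC : ∀ j, algebraMap R K (classProd f t β j) ≠ 0 := fun j h0 =>
      hC0 j (hinj (by rw [h0, map_zero]))
    obtain ⟨r, hr⟩ := h4
    have hxz := mul_ne_zero (mul_ne_zero hx0 hxM) (mul_ne_zero (hC 0) (hC 1))
    refine ⟨r / (x * (x + algebraMap R K M) * (algebraMap R K (classProd f t β 0) *
      algebraMap R K (classProd f t β 1))), ?_⟩
    rw [div_mul_div_comm, eq_div_iff (mul_ne_zero hxz hxz), ← hr, h]
    simp only [exempt, map_mul, map_pow, map_neg, map_one]
    simp
    ring

end Factorial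

end DiophantineCurves

/-! ### Two-descent on `y² = x (x + M) (x + N)` -/

namespace DiophantineCurves

open WeierstrassCurve.Affine WeierstrassCurve.Affine.Point

section Split

variable {F : Type*} [Field F] {M N : F}

/-- The conditions under which `y² = x (x + M) (x + N)` is an elliptic curve. -/
structure IsSplit (M N : F) : Prop where
  two_ne : (2 : F) ≠ 0
  left_ne : M ≠ 0
  right_ne : N ≠ 0
  ne : M ≠ N

theorem IsSplit.discr_ne_zero (hS : IsSplit M N) :
    2 * (M * N) * ((M + N) ^ 2 - 4 * (M * N)) ≠ 0 := by
  have : 2 * (M * N) * ((M + N) ^ 2 - 4 * (M * N)) = 2 * (M * N) * (M - N) ^ 2 := by ring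
  rw [this]
  exact mul_ne_zero (mul_ne_zero hS.two_ne (mul_ne_zero hS.left_ne hS.right_ne))
    (pow_ne_zero 2 (sub_ne_zero.2 hS.ne))

variable (M N) in
/-- The `x`-coordinates of the points of order two on `y² = x (x + M) (x + N)`. -/
def splitRoot : Fin 3 → F := ![0, -M, -N]

theorem splitRoot_isRoot (j : Fin 3) : splitRoot M N j ^ 3 + (M + N) * splitRoot M N j ^ 2 +
    M * N * splitRoot M N j = 0 := by
  fin_cases j <;> simp [splitRoot] <;> ring

theorem IsSplit.deriv_ne_zero (hS : IsSplit M N) (j : Fin 3) :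
    3 * splitRoot M N j ^ 2 + 2 * (M + N) * splitRoot M N j + M * N ≠ 0 := by
  fin_cases j
  · simpa [splitRoot] using ⟨hS.left_ne, hS.right_ne⟩
  · have h : 3 * (-M) ^ 2 + 2 * (M + N) * (-M) + M * N = M * (M - N) := by ring
    simp only [splitRoot]
    change 3 * (-M) ^ 2 + 2 * (M + N) * (-M) + M * N ≠ 0
    rw [h]
    exact mul_ne_zero hS.left_ne (sub_ne_zero.2 hS.ne)
  · have h : 3 * (-N) ^ 2 + 2 * (M + N) * (-N) + M * N = N * (N - M) := by ring
    change 3 * (-N) ^ 2 + 2 * (M + N) * (-N) + M * N ≠ 0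
    rw [h]
    exact mul_ne_zero hS.right_ne (sub_ne_zero.2 hS.ne.symm)

theorem split_equation {x y : F}
    (h : (twoTorsionCurve (M + N) (M * N)).toAffine.Nonsingular x y) :
    y ^ 2 = x * (x + M) * (x + N) := by
  have := twoTorsionCurve_equation_iff.1 h.1
  linear_combination this

theorem sub_splitRoot_ne_zero {x y : F}
    (h : (twoTorsionCurve (M + N) (M * N)).toAffine.Nonsingular x y) (hy : y ≠ 0) (j : Fin 3) :
    x ≠ splitRoot M N j := by
  intro hx
  apply hy
  have := splitRoot_isRoot (M := M) (N := N) j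
  rw [← hx] at this
  have h' := twoTorsionCurve_equation_iff.1 h.1
  rw [this] at h'
  exact pow_eq_zero_iff two_ne_zero |>.1 h'

theorem descentMap_splitRoot {x y : F}
    (h : (twoTorsionCurve (M + N) (M * N)).toAffine.Nonsingular x y) (hy : y ≠ 0) (j : Fin 3) :
    descentMap (splitRoot M N j) (some x y h) = ![x, x + M, x + N] j := by
  rw [descentMap_some_of_ne (sub_splitRoot_ne_zero h hy j)]
  fin_cases j <;> simp [splitRoot]

variable [DecidableEq F]

/-- A point is twice a point when all its descent classes are trivial. -/
theorem IsSplit.exists_eq_two_nsmul (hS : IsSplit M N)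
    (P : (twoTorsionCurve (M + N) (M * N)).toAffine.Point)
    (h : ∀ j, IsSquare (descentMap (splitRoot M N j) P)) : ∃ Q, P = 2 • Q := by
  rcases P with _ | ⟨x, y, hP⟩
  · exact ⟨0, (nsmul_zero 2).symm⟩
  · have key : ∀ j, IsSquare (x - splitRoot M N j) := fun j => by
      by_cases hx : x = splitRoot M N j
      · rw [hx, sub_self]; exact IsSquare.zero
      · rw [← descentMap_some_of_ne (h := hP) hx]; exact h j
    refine exists_half hS.two_ne hS.left_ne hS.right_ne hS.ne ?_ ?_ ?_
    · simpa [splitRoot] using key 0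
    · simpa [splitRoot] using key 1
    · simpa [splitRoot] using key 2

omit [DecidableEq F] in
theorem isSquare_mul_of_isSquare_mul {a b c : F} (hb : b ≠ 0) (h₁ : IsSquare (a * b))
    (h₂ : IsSquare (b * c)) : IsSquare (a * c) := by
  obtain ⟨r, hr⟩ := h₁.mul h₂
  refine ⟨r / b, ?_⟩
  rw [div_mul_div_comm, eq_div_iff (mul_ne_zero hb hb), ← hr]
  ring

/-- Points in the same descent classes differ by twice a point. -/
theorem IsSplit.exists_sub_eq_two_nsmul (hS : IsSplit M N)
    (P Q : (twoTorsionCurve (M + N) (M * N)).toAffine.Point)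
    (h : ∀ j, IsSquare (descentMap (splitRoot M N j) P * descentMap (splitRoot M N j) Q)) :
    ∃ R, P - Q = 2 • R := by
  apply hS.exists_eq_two_nsmul
  intro j
  have h1 := isSquare_descentMap_add (splitRoot_isRoot j) (hS.deriv_ne_zero j) P (-Q)
  rw [descentMap_neg, ← sub_eq_add_neg, mul_comm] at h1
  have := isSquare_mul_of_isSquare_mul
    (mul_ne_zero (descentMap_ne_zero (hS.deriv_ne_zero j) P)
      (descentMap_ne_zero (hS.deriv_ne_zero j) Q)) h1 (c := 1) (by simpa using h j)
  simpa using this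

/-- A point is zero, of order two, or its second coordinate does not vanish. -/
theorem split_cases (P : (twoTorsionCurve (M + N) (M * N)).toAffine.Point) :
    P = 0 ∨ (∃ j : Fin 3, ∃ h, P = some (splitRoot M N j) 0 h) ∨
      ∃ x y h, y ≠ 0 ∧ P = some x y h := by
  rcases P with _ | ⟨x, y, h⟩
  · exact Or.inl rfl
  · by_cases hy : y = 0
    · subst hy
      have hx := split_equation h
      refine Or.inr (Or.inl ?_)
      rw [zero_pow two_ne_zero, eq_comm, mul_eq_zero, mul_eq_zero] at hx
      rcases hx with (hx | hx) | hx
      · exact ⟨0, by simpa [splitRoot, hx] using h, some_congr (by simp [splitRoot, hx]) rfl⟩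
      · have hx' : x = -M := by linear_combination hx
        exact ⟨1, by simpa [splitRoot, hx'] using h, some_congr (by simp [splitRoot, hx']) rfl⟩
      · have hx' : x = -N := by linear_combination hx
        exact ⟨2, by simpa [splitRoot, hx'] using h, some_congr (by simp [splitRoot, hx']) rfl⟩
    · exact Or.inr (Or.inr ⟨x, y, h, hy, rfl⟩)

end Split

/-- A subgroup has finite index when the elements of the group fall into finitely many kinds and the
difference of any two of the same kind lies in the subgroup. -/
theorem finiteIndex_of_forall_sub_mem {G D : Type*} [AddCommGroup G] [Finite D] {H : AddSubgroup G}
    (rel : G → D → Prop) (hrel : ∀ P, ∃ d, rel P d)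
    (h : ∀ P Q d, rel P d → rel Q d → P - Q ∈ H) : H.FiniteIndex := by
  choose f hf using hrel
  have : Finite (G ⧸ H) := by
    refine Finite.of_injective (fun q : G ⧸ H => f q.out) fun q q' hq => ?_
    rw [← q.out_eq', ← q'.out_eq', eq_comm, QuotientAddGroup.eq, ← sub_eq_neg_add]
    exact h _ _ _ (hf _) (by
      have : f q.out = f q'.out := hq
      rw [this]; exact hf _)
  exact AddSubgroup.finiteIndex_of_finite_quotient

section WeakMordellWeil

variable {R K : Type*} [CommRing R] [IsDomain R] [UniqueFactorizationMonoid R] [Field K]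
  [Algebra R K] [IsFractionRing R K] [DecidableEq K]

/-- The weak Mordell-Weil theorem for a curve `y² = x (x + M) (x + N)` over the field of fractions
of a factorial ring with finitely many units. -/
theorem finiteIndex_two_nsmul (hunit : ∀ u : R, IsUnit u → u = 1 ∨ u = -1) {n : ℕ}
    {f : Fin n → R} (hf : ∀ i, Prime (f i)) (hne : ∀ i j, i ≠ j → ¬ f i ∣ f j) {M N : R}
    (hS : IsSplit (algebraMap R K M) (algebraMap R K N))
    (hprime : ∀ q, Prime q → q ∣ M * N * (N - M) → ∃ i, q ∣ f i) :
    (nsmulAddMonoidHom 2 : (twoTorsionCurve (algebraMap R K M + algebraMap R K N)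
      (algebraMap R K M * algebraMap R K N)).toAffine.Point →+ _).range.FiniteIndex := by
  set M' := algebraMap R K M
  set N' := algebraMap R K N
  have hinj := IsFractionRing.injective R K
  -- the classes of a point whose second coordinate does not vanish
  let C : (Fin n → ZMod 2) × ZMod 2 → R := fun β => (-1) ^ β.2.val * ∏ i, f i ^ (β.1 i).val
  have hC : ∀ β, algebraMap R K (C β) ≠ 0 := fun β h0 => by
    have : C β ≠ 0 := mul_ne_zero (pow_ne_zero _ (neg_ne_zero.2 one_ne_zero))
      (Finset.prod_ne_zero_iff.2 fun i _ => pow_ne_zero _ (hf i).ne_zero)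
    exact this (hinj (by rw [h0, _root_.map_zero]))
  have hclass : ∀ (x y : K) (h : (twoTorsionCurve (M' + N') (M' * N')).toAffine.Nonsingular x y),
      y ≠ 0 → ∃ β : Fin 3 → (Fin n → ZMod 2) × ZMod 2, ∀ j,
        IsSquare (descentMap (splitRoot M' N' j) (some x y h) * algebraMap R K (C (β j))) := by
    intro x y h hy
    obtain ⟨m, e, k, he, hme, hx, hyk⟩ := exists_eq_div_sq (split_equation h)
    have he' : algebraMap R K e ≠ 0 := fun h0 => he (hinj (by rw [h0, _root_.map_zero]))
    have hx2 : x + M' = algebraMap R K (m + M * e ^ 2) / algebraMap R K e ^ 2 := by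
      rw [hx]; simp only [map_add, map_mul, map_pow, M']; field_simp
    have hx3 : x + N' = algebraMap R K (m + N * e ^ 2) / algebraMap R K e ^ 2 := by
      rw [hx]; simp only [map_add, map_mul, map_pow, N']; field_simp
    have hprod : m * (m + M * e ^ 2) * (m + N * e ^ 2) = k ^ 2 := by
      apply hinj
      have h' := split_equation h
      rw [hx2, hx3, hx, hyk] at h'
      simp only [map_mul, map_pow] at h' ⊢
      field_simp at h'
      rw [h']
    have hk : k ≠ 0 := by
      rintro rfl
      exact hy (by rw [hyk, _root_.map_zero, zero_div])
    have hm0 : m * (m + M * e ^ 2) * (m + N * e ^ 2) ≠ 0 := by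
      rw [hprod]; exact pow_ne_zero 2 hk
    have hdiff : ∀ q, Prime q → ∀ L L', q ∣ m + L * e ^ 2 → q ∣ m + L' * e ^ 2 → q ∣ L' - L := by
      intro q hq L L' h1 h2
      refine (hq.dvd_or_dvd (a := L' - L) (b := e ^ 2) (by
        have := dvd_sub h2 h1
        convert this using 1; ring)).resolve_right fun h3 => ?_
      exact hq.not_isUnit (hme ((dvd_add_left (h3.mul_left L)).1 h1) (hq.dvd_of_dvd_pow h3))
    -- outside the given primes all multiplicities are even
    have hev : ∀ L L' L'', (m + L * e ^ 2) * (m + L' * e ^ 2) * (m + L'' * e ^ 2) = k ^ 2 →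
        L' - L ∣ M * N * (N - M) → L'' - L ∣ M * N * (N - M) → ∃ β,
        IsSquare (algebraMap R K (m + L * e ^ 2) / algebraMap R K e ^ 2 *
          algebraMap R K (C β)) := by
      intro L L' L'' hp h' h''
      have hmL : m + L * e ^ 2 ≠ 0 := fun h0 => hk (by
        rw [h0, zero_mul, zero_mul] at hp
        exact pow_eq_zero_iff two_ne_zero |>.1 hp.symm)
      obtain ⟨u, c, hu, hc⟩ := exists_mul_prod_pow_eq_unit_mul_sq hf hne Finset.univ hmL
        fun q hq hq' => even_multiplicity hk hp hq fun h1 =>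
          ⟨fun h2 => by
            obtain ⟨i, hi⟩ := hprime q hq ((hdiff q hq L L' h1 h2).trans h')
            exact hq' i (Finset.mem_univ i) hi,
          fun h2 => by
            obtain ⟨i, hi⟩ := hprime q hq ((hdiff q hq L L'' h1 h2).trans h'')
            exact hq' i (Finset.mem_univ i) hi⟩
      obtain ⟨s, hs⟩ : ∃ s : ZMod 2, u = (-1) ^ s.val := by
        rcases hunit u hu with h | h
        · exact ⟨0, by rw [h]; simp⟩
        · exact ⟨1, by rw [h]; simp [ZMod.val_one]⟩
      have h1 : IsSquare ((∏ i, f i ^ multiplicity (f i) (m + L * e ^ 2)) *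
          ∏ i, f i ^ ((multiplicity (f i) (m + L * e ^ 2) : ZMod 2)).val) := by
        rw [← Finset.prod_mul_distrib]
        exact Finset.isSquare_prod _ fun i _ => isSquare_pow_mul_pow_mod_two _ _
      obtain ⟨r, hr⟩ := h1
      have hP0 : ∏ i, f i ^ multiplicity (f i) (m + L * e ^ 2) ≠ 0 :=
        Finset.prod_ne_zero_iff.2 fun j _ => pow_ne_zero _ (hf j).ne_zero
      refine ⟨(fun i => multiplicity (f i) (m + L * e ^ 2), s), ?_⟩
      set P := ∏ i, f i ^ multiplicity (f i) (m + L * e ^ 2)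
      have hP0' : algebraMap R K P ≠ 0 := fun h0 => hP0 (hinj (by rw [h0, _root_.map_zero]))
      refine ⟨algebraMap R K (u * c * r) / (algebraMap R K P * algebraMap R K e), ?_⟩
      have hPe := mul_ne_zero hP0' he'
      rw [div_mul_div_comm, eq_div_iff (mul_ne_zero hPe hPe), div_mul_eq_mul_div,
        div_mul_eq_mul_div, div_eq_iff (pow_ne_zero 2 he')]
      have : (m + L * e ^ 2) * C (fun i => multiplicity (f i) (m + L * e ^ 2), s) * (P * P) =
          (u * c * r) * (u * c * r) := by
        simp only [C, ← hs]
        linear_combination (u * P * ∏ i, f i ^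
          ((multiplicity (f i) (m + L * e ^ 2) : ZMod 2)).val) * hc + u * u * c ^ 2 * hr
      have := congrArg (algebraMap R K) this
      simp only [map_mul] at this ⊢
      linear_combination algebraMap R K e ^ 2 * this
    obtain ⟨β₀, h₀⟩ := hev 0 M N (by simpa using hprod) ⟨N * (N - M), by ring⟩
      ⟨M * (N - M), by ring⟩
    obtain ⟨β₁, h₁⟩ := hev M 0 N (by linear_combination hprod) ⟨-(N * (N - M)), by ring⟩
      ⟨M * N, by ring⟩
    obtain ⟨β₂, h₂⟩ := hev N 0 M (by linear_combination hprod) ⟨-(M * (N - M)), by ring⟩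
      ⟨-(M * N), by ring⟩
    refine ⟨![β₀, β₁, β₂], fun j => ?_⟩
    rw [descentMap_splitRoot h hy]
    fin_cases j
    · simpa [hx] using h₀
    · change IsSquare ((x + M') * _)
      rw [hx2]; exact h₁
    · change IsSquare ((x + N') * _)
      rw [hx3]; exact h₂
  refine finiteIndex_of_forall_sub_mem
    (D := Option (Fin 3 ⊕ (Fin 3 → (Fin n → ZMod 2) × ZMod 2)))
    (fun P d => match d with
      | none => P = 0
      | Option.some (Sum.inl j) => ∃ h, P = some (splitRoot M' N' j) 0 h
      | Option.some (Sum.inr β) => ∀ j, IsSquare (descentMap (splitRoot M' N' j) P *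
          algebraMap R K (C (β j)))) (fun P => ?_) (fun P Q d hP hQ => ?_)
  · rcases split_cases P with h | ⟨j, h⟩ | ⟨x, y, h, hy, rfl⟩
    · exact ⟨none, h⟩
    · exact ⟨Option.some (Sum.inl j), h⟩
    · obtain ⟨β, hβ⟩ := hclass x y h hy
      exact ⟨Option.some (Sum.inr β), hβ⟩
  · rcases d with _ | j | β
    · have hP : P = 0 := hP
      have hQ : Q = 0 := hQ
      rw [hP, hQ, sub_self]
      exact zero_mem _
    · obtain ⟨_, rfl⟩ := hP
      obtain ⟨_, rfl⟩ := hQ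
      rw [sub_self]
      exact zero_mem _
    · obtain ⟨S, hS⟩ := hS.exists_sub_eq_two_nsmul P Q fun j =>
        isSquare_mul_of_isSquare_mul (hC (β j)) (hP j) (by rw [mul_comm]; exact hQ j)
      exact ⟨S, hS.symm⟩

end WeakMordellWeil

end DiophantineCurves

/-! ### The Mordell-Weil theorem for `y² = x (x + M) (x + N)` over `ℚ` -/

namespace DiophantineCurves

open WeierstrassCurve.Affine WeierstrassCurve.Affine.Point

section ParallelogramLaw

variable {F : Type*} [Field F] [DecidableEq F] {A B : F}

omit [DecidableEq F] in
theorem twoTorsionCurve_isElliptic (hD : 2 * B * (A ^ 2 - 4 * B) ≠ 0) :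
    (twoTorsionCurve A B).IsElliptic := by
  refine ⟨?_⟩
  rw [isUnit_iff_ne_zero]
  have : (twoTorsionCurve A B).Δ = 2 ^ 3 * (B * (2 * B * (A ^ 2 - 4 * B))) := by
    simp only [WeierstrassCurve.Δ, WeierstrassCurve.b₂, WeierstrassCurve.b₄, WeierstrassCurve.b₆,
      WeierstrassCurve.b₈, twoTorsionCurve]
    ring
  rw [this]
  have h2 : (2 : F) * B ≠ 0 := left_ne_zero_of_mul hD
  exact mul_ne_zero (pow_ne_zero _ (left_ne_zero_of_mul h2))
    (mul_ne_zero (right_ne_zero_of_mul h2) hD)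

omit [DecidableEq F] in
theorem eval_addSubMap_twoTorsionCurve (v : Fin 3 → F) :
    (fun i => (WeierstrassCurve.addSubMap (twoTorsionCurve A B) i).eval v) =
      ![v 0 ^ 2 - 2 * B * v 0 * v 2 + B ^ 2 * v 2 ^ 2,
        2 * v 1 * v 0 + 4 * A * v 0 * v 2 + 2 * B * v 1 * v 2, v 1 ^ 2 - 4 * v 0 * v 2] := by
  funext i
  fin_cases i <;>
  simp [WeierstrassCurve.addSubMap, WeierstrassCurve.b₂, WeierstrassCurve.b₄, WeierstrassCurve.b₆,
      WeierstrassCurve.b₈, twoTorsionCurve]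

theorem some_add_some_of_ne {x₁ y₁ x₂ y₂ : F}
    {h₁ : (twoTorsionCurve A B).toAffine.Nonsingular x₁ y₁}
    {h₂ : (twoTorsionCurve A B).toAffine.Nonsingular x₂ y₂} (hx : x₁ ≠ x₂) :
    ∃ y h, some x₁ y₁ h₁ + some x₂ y₂ h₂ =
      some (((y₁ - y₂) / (x₁ - x₂)) ^ 2 - A - x₁ - x₂) y h := by
  have hxy : ¬(x₁ = x₂ ∧ y₁ = (twoTorsionCurve A B).toAffine.negY x₂ y₂) := fun h => hx h.1
  have hX : (twoTorsionCurve A B).toAffine.addX x₁ x₂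
      ((twoTorsionCurve A B).toAffine.slope x₁ x₂ y₁ y₂) =
      ((y₁ - y₂) / (x₁ - x₂)) ^ 2 - A - x₁ - x₂ := by
    rw [slope_of_X_ne hx]
    simp [addX, twoTorsionCurve]
  have hn := nonsingular_add h₁ h₂ hxy
  rw [hX] at hn
  refine ⟨_, hn, ?_⟩
  rw [add_some hxy]
  exact some_congr hX rfl

theorem some_add_self_of_ne {x y : F} {h : (twoTorsionCurve A B).toAffine.Nonsingular x y}
    (hy : 2 * y ≠ 0) : ∃ y' h', some x y h + some x y h =
      some (((3 * x ^ 2 + 2 * A * x + B) / (2 * y)) ^ 2 - A - x - x) y' h' := by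
  have hneg : y ≠ (twoTorsionCurve A B).toAffine.negY x y := by
    rw [twoTorsionCurve_negY]
    intro h0
    exact hy (by linear_combination h0)
  have hxy : ¬(x = x ∧ y = (twoTorsionCurve A B).toAffine.negY x y) := fun h => hneg h.2
  have hX : (twoTorsionCurve A B).toAffine.addX x x
      ((twoTorsionCurve A B).toAffine.slope x x y y) =
      ((3 * x ^ 2 + 2 * A * x + B) / (2 * y)) ^ 2 - A - x - x := by
    rw [slope_of_Y_ne rfl hneg, twoTorsionCurve_negY]
    simp [addX, twoTorsionCurve, two_mul]
  have hn := nonsingular_add h h hxy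
  rw [hX] at hn
  refine ⟨_, hn, ?_⟩
  rw [add_some hxy]
  exact some_congr hX rfl

/-- The map `addSubMap` describes the coordinates of `P + Q` and `P - Q`, up to a factor. -/
theorem exists_eval_addSubMap_eq_smul (hD : 2 * B * (A ^ 2 - 4 * B) ≠ 0)
    (P Q : (twoTorsionCurve A B).toAffine.Point) :
    ∃ c : F, c ≠ 0 ∧
      (fun i => (WeierstrassCurve.addSubMap (twoTorsionCurve A B) i).eval (P.sym2x Q)) =
        c • (P + Q).sym2x (P - Q) := by
  have := twoTorsionCurve_isElliptic hD
  suffices h : ∃ c : F,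
      (fun i => (WeierstrassCurve.addSubMap (twoTorsionCurve A B) i).eval (P.sym2x Q)) =
        c • (P + Q).sym2x (P - Q) by
    obtain ⟨c, hc⟩ := h
    refine ⟨c, fun h0 => ?_, hc⟩
    apply WeierstrassCurve.addSubMap_ne_zero (twoTorsionCurve A B) (sym2x_ne_zero P Q)
    rw [hc, h0, zero_smul]
  rw [eval_addSubMap_twoTorsionCurve]
  have h2 : (2 : F) ≠ 0 := left_ne_zero_of_mul (left_ne_zero_of_mul hD)
  -- the case of equal points
  have hself : ∀ P : (twoTorsionCurve A B).toAffine.Point, ∃ c : F,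
      ![P.sym2x P 0 ^ 2 - 2 * B * P.sym2x P 0 * P.sym2x P 2 + B ^ 2 * P.sym2x P 2 ^ 2,
        2 * P.sym2x P 1 * P.sym2x P 0 + 4 * A * P.sym2x P 0 * P.sym2x P 2 +
          2 * B * P.sym2x P 1 * P.sym2x P 2, P.sym2x P 1 ^ 2 - 4 * P.sym2x P 0 * P.sym2x P 2] =
        c • (P + P).sym2x 0 := by
    rintro (_ | ⟨x, y, h⟩)
    · refine ⟨1, ?_⟩
      rw [← zero_def, add_zero, sym2x_zero_zero]
      funext i
      fin_cases i <;> simp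
    · have hE := twoTorsionCurve_equation_iff.1 h.1
      by_cases hy : y = 0
      · refine ⟨(x ^ 2 - B) ^ 2, ?_⟩
        rw [(some_add_self_eq_zero_iff h2).2 hy, sym2x_zero_zero, sym2x_some_some]
        subst hy
        funext i
        fin_cases i
        · simp; ring
        · simp; linear_combination -4 * hE
        · simp; ring
      · have h2y := mul_ne_zero h2 hy
        obtain ⟨y', h', hadd⟩ := some_add_self_of_ne (h := h) h2y
        refine ⟨(2 * y) ^ 2, ?_⟩
        rw [hadd, sym2x_some_zero, sym2x_some_some]
        funext i
        fin_cases i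
        · simp
          field_simp
          linear_combination (4 * A + 8 * x) * hE
        · simp; linear_combination -4 * hE
        · simp; ring
  rcases P with _ | ⟨x₁, y₁, h₁⟩
  · refine ⟨1, ?_⟩
    rw [← zero_def, zero_add, zero_sub, sym2x_neg_right]
    rcases Q with _ | ⟨x₂, y₂, h₂⟩
    · rw [← zero_def, sym2x_zero_zero]
      funext i
      fin_cases i <;> simp
    · rw [sym2x_zero_some, sym2x_some_some]
      funext i
      fin_cases i <;> simp <;> ring
  rcases Q with _ | ⟨x₂, y₂, h₂⟩
  · refine ⟨1, ?_⟩
    rw [← zero_def, add_zero, sub_zero, sym2x_some_zero, sym2x_some_some]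
    funext i
    fin_cases i <;> simp <;> ring
  by_cases hx : x₁ = x₂
  · rcases X_eq_iff.1 hx with hPQ | hPQ
    · rw [hPQ, sub_self]
      exact hself _
    · rw [hPQ, sym2x_neg_left, neg_add_cancel, sym2x_comm, ← neg_add', sym2x_neg_right,
        sym2x_comm 0]
      exact hself _
  · obtain ⟨y, h, hadd⟩ := some_add_some_of_ne (h₁ := h₁) (h₂ := h₂) hx
    obtain ⟨y', h', hsub⟩ := some_add_some_of_ne (h₁ := h₁) (h₂ := nonsingular_neg_y h₂) hx
    have hE₁ := twoTorsionCurve_equation_iff.1 h₁.1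
    have hE₂ := twoTorsionCurve_equation_iff.1 h₂.1
    have hx' := sub_ne_zero.2 hx
    refine ⟨(x₁ - x₂) ^ 2, ?_⟩
    rw [sub_eq_add_neg (some x₁ y₁ h₁), neg_some_eq h₂ (nonsingular_neg_y h₂), hadd, hsub,
      sym2x_some_some, sym2x_some_some]
    funext i
    fin_cases i
    · simp
      field_simp
      linear_combination (-(y₁ ^ 2 - y₂ ^ 2 + (x₁ ^ 3 + A * x₁ ^ 2 + B * x₁) -
        (x₂ ^ 3 + A * x₂ ^ 2 + B * x₂)) + 2 * (A + x₁ + x₂) * (x₁ - x₂) ^ 2) * hE₁ +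
        (y₁ ^ 2 - y₂ ^ 2 + (x₁ ^ 3 + A * x₁ ^ 2 + B * x₁) -
        (x₂ ^ 3 + A * x₂ ^ 2 + B * x₂) + 2 * (A + x₁ + x₂) * (x₁ - x₂) ^ 2) * hE₂
    · simp
      field_simp
      linear_combination -2 * hE₁ - 2 * hE₂
    · simp; ring

end ParallelogramLaw

section Height

open Height

variable {A B : ℚ}

/-- The naive height of a point. -/
noncomputable def naiveHeight (P : (twoTorsionCurve A B).toAffine.Point) : ℝ := logHeight P.xRep

theorem exists_parallelogram_bound (hD : 2 * B * (A ^ 2 - 4 * B) ≠ 0) :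
    ∃ C : ℝ, ∀ P Q : (twoTorsionCurve A B).toAffine.Point,
      |naiveHeight (P + Q) + naiveHeight (P - Q) - 2 * (naiveHeight P + naiveHeight Q)| ≤ C := by
  have := twoTorsionCurve_isElliptic hD
  obtain ⟨C₁, h₁⟩ :=
    WeierstrassCurve.abs_logHeight_addSubMap_sub_two_mul_logHeight_le (twoTorsionCurve A B)
  obtain ⟨C₂, h₂⟩ := abs_logHeight_sym2_sub_le ℚ
  have key : ∀ P Q : (twoTorsionCurve A B).toAffine.Point,
      |logHeight (P.sym2x Q) - (naiveHeight P + naiveHeight Q)| ≤ C₂ := fun P Q => by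
    have hP : P.xRep = ![P.xRep 0, P.xRep 1] := by funext i; fin_cases i <;> rfl
    have hQ : Q.xRep = ![Q.xRep 0, Q.xRep 1] := by funext i; fin_cases i <;> rfl
    have := h₂ (hP ▸ xRep_ne_zero P) (hQ ▸ xRep_ne_zero Q)
    rwa [← hP, ← hQ] at this
  refine ⟨C₁ + 3 * C₂, fun P Q => ?_⟩
  obtain ⟨c, hc, h⟩ := exists_eval_addSubMap_eq_smul hD P Q
  have h3 := h₁ (P.sym2x Q)
  rw [h, logHeight_smul_eq_logHeight _ hc] at h3
  have h4 := key P Q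
  have h5 := key (P + Q) (P - Q)
  rw [abs_le] at *
  constructor <;> linarith [h3.1, h3.2, h4.1, h4.2, h5.1, h5.2]

instance northcott_naiveHeight :
    Northcott (naiveHeight : (twoTorsionCurve A B).toAffine.Point → ℝ) where
  finite_le b := by
    have hfin : {x : ℚ | logHeight₁ x ≤ b}.Finite := Northcott.finite_le b
    have hx : ∀ x : ℚ, {P : (twoTorsionCurve A B).toAffine.Point | P.xRep = ![x, 1]}.Finite := by
      intro x
      by_cases h : ∃ P : (twoTorsionCurve A B).toAffine.Point, P.xRep = ![x, 1]
      · obtain ⟨P, hP⟩ := h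
        refine (Set.toFinite {P, -P}).subset fun Q hQ => ?_
        exact xRep_eq_xRep_iff.1 (Eq.trans hQ hP.symm)
      · push Not at h
        convert Set.finite_empty
        ext P
        simpa using h P
    refine ((hfin.biUnion fun x _ => hx x).union (Set.finite_singleton 0)).subset fun P hP => ?_
    rcases P with _ | ⟨x, y, h⟩
    · exact Or.inr rfl
    · refine Or.inl (Set.mem_biUnion (x := x) ?_ rfl)
      rw [Set.mem_ofPred_eq, logHeight₁_eq_logHeight]
      exact hP

end Height

theorem rat_fg_of_isSplit {M N : ℤ} (hS : IsSplit (M : ℚ) (N : ℚ)) :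
    AddGroup.FG (twoTorsionCurve ((M : ℚ) + N) (M * N)).toAffine.Point := by
  obtain ⟨C, hC⟩ := exists_parallelogram_bound hS.discr_ne_zero
  have hfin : (nsmulAddMonoidHom 2 : (twoTorsionCurve ((M : ℚ) + N) (M * N)).toAffine.Point →+
      _).range.FiniteIndex := by
    have hD : M * N * (N - M) ≠ 0 := by
      have h1 : M ≠ 0 := by exact_mod_cast hS.left_ne
      have h2 : N ≠ 0 := by exact_mod_cast hS.right_ne
      have h3 : M ≠ N := by exact_mod_cast hS.ne
      exact mul_ne_zero (mul_ne_zero h1 h2) (sub_ne_zero.2 h3.symm)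
    -- the primes that divide `M N (N - M)`
    set S := (M * N * (N - M)).natAbs.primeFactors
    let g : Fin S.card ≃ S := (Fintype.equivFinOfCardEq (by simp)).symm
    refine finiteIndex_two_nsmul (R := ℤ) (f := fun i => ((g i : ℕ) : ℤ))
      (fun u hu => Int.isUnit_iff.1 hu)
      (fun i => Nat.prime_iff_prime_int.1 (Nat.prime_of_mem_primeFactors (g i).2))
      (fun i j hij hd => ?_) hS fun q hq hqd => ?_
    · have hd' : (g i : ℕ) ∣ (g j : ℕ) := by exact_mod_cast hd
      have := (Nat.prime_dvd_prime_iff_eq (Nat.prime_of_mem_primeFactors (g i).2)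
        (Nat.prime_of_mem_primeFactors (g j).2)).1 hd'
      exact hij (g.injective (Subtype.ext this))
    · have hmem : q.natAbs ∈ S :=
        Nat.mem_primeFactors.2 ⟨Int.prime_iff_natAbs_prime.1 hq, Int.natAbs_dvd_natAbs.2 hqd,
          Int.natAbs_ne_zero.2 hD⟩
      refine ⟨g.symm ⟨_, hmem⟩, ?_⟩
      simp
  exact AddCommGroup.fg_of_descent' (h := naiveHeight) hfin (fun P => Height.logHeight_nonneg _) hC

end DiophantineCurves

/-! ### Square classes at a place -/

namespace DiophantineCurves

open WeierstrassCurve.Affine WeierstrassCurve.Affine.Point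

namespace Place

variable {K k : Type*} [Field K] [Field k] {p : Place K k}

theorem isSquare_res {x : K} (hx : x ∈ p.ring) (h : IsSquare x) : IsSquare (p.res x) := by
  obtain ⟨t, rfl⟩ := h
  have ht : t ∈ p.ring := mem_of_pow_mem (n := 2) two_ne_zero (by rwa [pow_two])
  exact ⟨p.res t, res_mul ht ht⟩

/-- The factor `1 + ε`, with `ε` infinitesimal, does not change the residue. -/
theorem isSquare_res_of_isSquare_mul_one_add {D ε : K} (hD : D ∈ p.ring) (hε : p.val ε < 1)
    (h : IsSquare (D * (1 + ε))) : IsSquare (p.res D) := by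
  have hε' := mem_of_val_lt_one hε
  have h1 : (1 + ε) ∈ p.ring := add_mem (one_mem _) hε'
  have := isSquare_res (mul_mem hD h1) h
  rwa [res_mul hD h1, res_add (one_mem _) hε', res_one, res_eq_zero_of_val_lt_one hε, add_zero,
    mul_one] at this

theorem isSquare_of_mul_mul_self {F : Type*} [Field F] {a b : F} (hb : b ≠ 0)
    (h : IsSquare (a * (b * b))) : IsSquare a := by
  obtain ⟨r, hr⟩ := h
  refine ⟨r / b, ?_⟩
  rw [div_mul_div_comm, eq_div_iff (mul_ne_zero hb hb), hr]

/-- The class of a factor of `x (x + δ) (x + η)` at a place where `δ` vanishes and `η` is a non-zero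
square. -/
theorem isSquare_res_of_multiplicative {X δ η y D : K} (hδ : p.val δ < 1) (hη : η ∈ p.ring)
    (hη0 : p.res η ≠ 0) (hηs : IsSquare (p.res η)) (hD : D ∈ p.ring)
    (hy : y ^ 2 = X * (X + δ) * (X + η)) (hy0 : y ≠ 0) (h : IsSquare ((X + η) * D)) :
    IsSquare (p.res D) := by
  have h0 : X * (X + δ) * (X + η) ≠ 0 := by rw [← hy]; exact pow_ne_zero 2 hy0
  have hX : X ≠ 0 := left_ne_zero_of_mul (left_ne_zero_of_mul h0)
  have hX3 : X + η ≠ 0 := right_ne_zero_of_mul h0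
  by_cases hXδ : p.val (δ / X) < 1
  · apply isSquare_res_of_isSquare_mul_one_add hD hXδ
    apply isSquare_of_mul_mul_self (mul_ne_zero hX3 hX)
    obtain ⟨s, hs⟩ := h
    refine ⟨s * y, ?_⟩
    have : s * y * (s * y) = (s * s) * y ^ 2 := by ring
    rw [this, ← hs, hy]
    field_simp
  · -- here `X` vanishes at the place, so that the third factor is congruent to `η`
    have hXv : p.val X < 1 := by
      refine lt_of_le_of_lt ?_ hδ
      rw [map_div₀, not_lt] at hXδ
      have h2 := mul_le_mul_left hXδ (p.val X)
      rwa [one_mul, div_mul_cancel₀ _ ((Valuation.ne_zero_iff _).2 hX)] at h2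
    have hXr := mem_of_val_lt_one hXv
    have h3 := isSquare_res (mul_mem (add_mem hXr hη) hD) h
    rw [res_mul (add_mem hXr hη) hD, res_add hXr hη, res_eq_zero_of_val_lt_one hXv, zero_add] at h3
    obtain ⟨q, hq⟩ := hηs
    have hq0 : q ≠ 0 := by rintro rfl; exact hη0 (by simpa using hq)
    apply isSquare_of_mul_mul_self hq0
    rwa [← hq, mul_comm]

/-- A uniformizer times a unit is not a square. -/
theorem not_isSquare_uniformizer_mul {π u : K} (hπ : π ∈ p.ring) (hπ0 : π ≠ 0)
    (hπr : p.res π = 0) (hdiv : ∀ x ∈ p.ring, p.res x = 0 → x / π ∈ p.ring) (hu : u ∈ p.ring)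
    (hu0 : p.res u ≠ 0) : ¬ IsSquare (π * u) := by
  rintro ⟨t, ht⟩
  have htr : t ∈ p.ring := mem_of_pow_mem (n := 2) two_ne_zero (by
    rw [pow_two, ← ht]; exact mul_mem hπ hu)
  have ht0 : p.res t = 0 := by
    have := res_mul htr htr
    rw [← ht, res_mul hπ hu, hπr, zero_mul] at this
    exact mul_self_eq_zero.1 this.symm
  apply hu0
  have : u = t / π * t := by field_simp; linear_combination ht
  rw [this, res_mul (hdiv t htr ht0) htr, ht0, mul_zero]

/-- The class of a factor of `x (x + δ) (x + η)` at a place where `δ` is a uniformizer and `η` is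
`-3` times a non-zero square: it is `1` or `-3` according to the exponent of the uniformizer in the
class of `x`. -/
theorem isSquare_res_mul_of_simple {X δ η y D D' π u c : K} {β : ℕ} (hβ : β < 2)
    (hπ : π ∈ p.ring) (hπ0 : π ≠ 0) (hπr : p.res π = 0)
    (hdiv : ∀ x ∈ p.ring, p.res x = 0 → x / π ∈ p.ring)
    (hδ : δ = π * u) (hu : u ∈ p.ring) (hu0 : p.res u ≠ 0) (hη : η ∈ p.ring)
    (hη0 : p.res η ≠ 0) (hc : c ∈ p.ring) (hηs : IsSquare (p.res η * p.res c))
    (hD : D ∈ p.ring) (hD' : D' ∈ p.ring) (hD'0 : p.res D' ≠ 0)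
    (hy : y ^ 2 = X * (X + δ) * (X + η)) (hy0 : y ≠ 0)
    (h : IsSquare ((X + η) * D)) (h' : IsSquare (X * (π ^ β * D'))) :
    IsSquare (p.res (D * c ^ β)) := by
  have h0 : X * (X + δ) * (X + η) ≠ 0 := by rw [← hy]; exact pow_ne_zero 2 hy0
  have hX : X ≠ 0 := left_ne_zero_of_mul (left_ne_zero_of_mul h0)
  have hX2 : X + δ ≠ 0 := right_ne_zero_of_mul (left_ne_zero_of_mul h0)
  have hX3 : X + η ≠ 0 := right_ne_zero_of_mul h0
  have hδr : δ ∈ p.ring := by rw [hδ]; exact mul_mem hπ hu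
  have hδ0 : p.res δ = 0 := by rw [hδ, res_mul hπ hu, hπr, zero_mul]
  have hδv : p.val δ < 1 := (res_eq_zero_iff hδr).1 hδ0
  have nosq : ∀ v ∈ p.ring, p.res v ≠ 0 → ¬ IsSquare (π * v) := fun v hv hv0 =>
    not_isSquare_uniformizer_mul hπ hπ0 hπr hdiv hv hv0
  have hne : ∀ v, p.res v ≠ 0 → v ≠ 0 := fun v hv h => hv (by rw [h, res_zero])
  by_cases hXr : X ∈ p.ring ∧ p.res X = 0
  · obtain ⟨hXr, hX0⟩ := hXr
    have h3 := isSquare_res (mul_mem (add_mem hXr hη) hD) h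
    rw [res_mul (add_mem hXr hη) hD, res_add hXr hη, hX0, zero_add] at h3
    -- the exponent is one, since otherwise `X + δ` would be a uniformizer times a unit
    have hβ1 : β = 1 := by
      by_contra hβ1
      have hβ0 : β = 0 := by lia
      rw [hβ0, pow_zero, one_mul] at h'
      have hz := hdiv X hXr hX0
      have hz0 : p.res (X / π) = 0 := by
        by_contra hz0
        apply nosq (X / π * D') (mul_mem hz hD') (by
          rw [res_mul hz hD']; exact mul_ne_zero hz0 hD'0)
        rwa [← mul_assoc, mul_div_cancel₀ _ hπ0]
      apply nosq ((X / π + u) * (X + η) * D')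
        (mul_mem (mul_mem (add_mem hz hu) (add_mem hXr hη)) hD')
      · rw [res_mul (mul_mem (add_mem hz hu) (add_mem hXr hη)) hD',
          res_mul (add_mem hz hu) (add_mem hXr hη), res_add hz hu, res_add hXr hη, hz0, hX0,
          zero_add, zero_add]
        exact mul_ne_zero (mul_ne_zero hu0 hη0) hD'0
      · apply isSquare_of_mul_mul_self hX
        obtain ⟨s, hs⟩ := h'
        refine ⟨s * y, ?_⟩
        have : s * y * (s * y) = (s * s) * y ^ 2 := by ring
        rw [this, ← hs, hy, hδ]
        field_simp
    rw [hβ1, pow_one, res_mul hD hc]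
    exact isSquare_of_mul_mul_self hη0 (by
      have e : p.res D * p.res c * (p.res η * p.res η) =
        p.res η * p.res D * (p.res η * p.res c) := by ring
      rw [e]
      exact h3.mul hηs)
  · have hXδ : p.val (δ / X) < 1 := by
      by_contra hXδ
      rw [map_div₀, not_lt] at hXδ
      have h2 := mul_le_mul_left hXδ (p.val X)
      rw [one_mul, div_mul_cancel₀ _ ((Valuation.ne_zero_iff _).2 hX)] at h2
      have hXv := lt_of_le_of_lt h2 hδv
      exact hXr ⟨mem_of_val_lt_one hXv, res_eq_zero_of_val_lt_one hXv⟩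
    have hX2s : IsSquare ((1 + δ / X) * (X + η)) := by
      refine ⟨y / X, ?_⟩
      rw [div_mul_div_comm, ← pow_two, hy]
      field_simp
    have hDs : IsSquare (D * (1 + δ / X)) := by
      apply isSquare_of_mul_mul_self hX3
      have e : D * (1 + δ / X) * ((X + η) * (X + η)) =
        (X + η) * D * ((1 + δ / X) * (X + η)) := by ring
      rw [e]
      exact h.mul hX2s
    -- the exponent is zero, since `X` is a unit or has the same class as `X + η`
    have hβ0 : β = 0 := by
      by_contra hβ0
      have hβ1 : β = 1 := by lia
      rw [hβ1, pow_one] at h'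
      by_cases hXm : X ∈ p.ring
      · have hX0 : p.res X ≠ 0 := fun h0 => hXr ⟨hXm, h0⟩
        apply nosq (X * D') (mul_mem hXm hD') (by
          rw [res_mul hXm hD']; exact mul_ne_zero hX0 hD'0)
        rwa [mul_left_comm]
      · have hηX : p.val (η / X) < 1 := by
          rw [mem_iff, not_le] at hXm
          rw [map_div₀]
          exact (div_lt_one₀ (zero_lt_one.trans hXm)).2 (lt_of_le_of_lt (mem_iff.1 hη) hXm)
        have hδX' := mem_of_val_lt_one hXδ
        have hηX' := mem_of_val_lt_one hηX
        apply nosq (D' * (1 + δ / X) * (1 + η / X))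
          (mul_mem (mul_mem hD' (add_mem (one_mem _) hδX')) (add_mem (one_mem _) hηX'))
        · rw [res_mul (mul_mem hD' (add_mem (one_mem _) hδX')) (add_mem (one_mem _) hηX'),
            res_mul hD' (add_mem (one_mem _) hδX'), res_add (one_mem _) hδX',
            res_add (one_mem _) hηX', res_one, res_eq_zero_of_val_lt_one hXδ,
            res_eq_zero_of_val_lt_one hηX, add_zero, mul_one, mul_one]
          exact hD'0
        · apply isSquare_of_mul_mul_self hX
          have e : π * (D' * (1 + δ / X) * (1 + η / X)) * (X * X) =
            X * (π * D') * ((1 + δ / X) * (X + η)) := by field_simp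
          rw [e]
          exact h'.mul hX2s
    rw [hβ0, pow_zero, mul_one]
    exact isSquare_res_of_isSquare_mul_one_add hD hXδ hDs

/-- The class of a factor of `x (x + δ) (x + η)` at a place where `x` has a pole. -/
theorem isSquare_res_of_pole {X δ η y D : K} (hX : 1 < p.val X) (hδ : δ ∈ p.ring)
    (hη : η ∈ p.ring) (hD : D ∈ p.ring)
    (hy : y ^ 2 = X * (X + δ) * (X + η)) (h : IsSquare (X * D)) :
    IsSquare (p.res D) := by
  have hX0 : X ≠ 0 := by rintro rfl; simp at hX
  have hlt : ∀ z ∈ p.ring, p.val (z / X) < 1 := fun z hz => by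
    rw [map_div₀]
    exact (div_lt_one₀ (zero_lt_one.trans hX)).2 (lt_of_le_of_lt (mem_iff.1 hz) hX)
  have hδX := hlt δ hδ
  have hηX := hlt η hη
  have hε : p.val (δ / X + η / X + δ / X * (η / X)) < 1 := by
    refine Valuation.map_add_lt _ (Valuation.map_add_lt _ hδX hηX) ?_
    rw [map_mul]
    exact mul_lt_one_of_lt_of_le hδX hηX.le
  apply isSquare_res_of_isSquare_mul_one_add hD hε
  obtain ⟨s, hs⟩ := h
  refine ⟨s * y / (X * X), ?_⟩
  have : s * y * (s * y) = (s * s) * y ^ 2 := by ring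
  rw [div_mul_div_comm (s * y), this, ← hs, hy]
  field_simp
  ring

end Place

end DiophantineCurves

/-! ### Places of the field of fractions of `ℤ[w]` -/

namespace DiophantineCurves

open Polynomial

/-- Divisibility by an irreducible polynomial is vanishing at a root of it. -/
theorem eval₂_eq_zero_iff_dvd {L : Type*} [Field L] [CharZero L] {f : ℤ[X]} (hf : Irreducible f)
    (hd : f.natDegree ≠ 0) {α : L} (hα : eval₂ (Int.castRingHom L) α f = 0) (g : ℤ[X]) :
    eval₂ (Int.castRingHom L) α g = 0 ↔ f ∣ g := by
  constructor
  · intro hg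
    have hprim := hf.isPrimitive hd
    rw [IsPrimitive.Int.dvd_iff_map_cast_dvd_map_cast _ _ hprim]
    have hirr := (IsPrimitive.Int.irreducible_iff_irreducible_map_cast hprim).1 hf
    have key : ∀ g : ℤ[X], aeval α (g.map (Int.castRingHom ℚ)) =
        eval₂ (Int.castRingHom L) α g := fun g => by
      rw [aeval_def, eval₂_map]
      congr 1
      exact RingHom.ext_int _ _
    have h1 := minpoly.eq_of_irreducible hirr (by rw [key, hα] : aeval α _ = 0)
    exact (Dvd.intro _ h1).trans (minpoly.dvd ℚ α (by rw [key, hg]))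
  · rintro ⟨h, rfl⟩
    rw [eval₂_mul, hα, zero_mul]

/-- A simple root of an irreducible polynomial modulo `p` gives an embedding of `ℤ[w] / (f)` into
the `p`-adic numbers, which detects squares modulo `p`. -/
theorem exists_ringHom_padic (p : ℕ) [Fact p.Prime] {f : ℤ[X]} (hf : Irreducible f)
    (hd : f.natDegree ≠ 0) {r : ℤ} (h0 : (p : ℤ) ∣ f.eval r)
    (h1 : ¬ (p : ℤ) ∣ f.derivative.eval r) :
    ∃ φ : ℤ[X] →+* ℚ_[p], (∀ g, φ g = 0 ↔ f ∣ g) ∧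
      ∀ g : ℤ[X], IsSquare (φ g) → IsSquare ((g.eval r : ℤ) : ZMod p) := by
  have hev : ∀ g : ℤ[X], aeval (r : ℤ_[p]) g = ((g.eval r : ℤ) : ℤ_[p]) := fun g => by
    have := aeval_algebraMap_apply ℤ_[p] r g
    simpa using this
  have hunit : ‖aeval (r : ℤ_[p]) (derivative f)‖ = 1 := by
    rw [hev]
    refine le_antisymm (PadicInt.norm_le_one _) (not_lt.1 fun h => h1 ?_)
    exact (PadicInt.norm_int_lt_one_iff_dvd _).1 h
  obtain ⟨α, hα, hαr, -⟩ := hensels_lemma (p := p) (F := f) (a := (r : ℤ_[p])) (by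
    rw [hunit, one_pow, hev]
    exact (PadicInt.norm_int_lt_one_iff_dvd _).2 h0)
  rw [hunit] at hαr
  have hmod : PadicInt.toZMod α = (r : ZMod p) := by
    have h2 : α - r ∈ IsLocalRing.maximalIdeal ℤ_[p] := by
      rw [IsLocalRing.mem_maximalIdeal, mem_nonunits_iff, PadicInt.isUnit_iff]
      exact hαr.ne
    rw [← PadicInt.ker_toZMod, RingHom.mem_ker, map_sub, map_intCast, sub_eq_zero] at h2
    exact h2
  let φ₀ : ℤ[X] →+* ℤ_[p] := eval₂RingHom (Int.castRingHom _) α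
  have hφ₀ : ∀ g, φ₀ g = aeval α g := fun g => rfl
  have hφ : ∀ g, ((φ₀ g : ℤ_[p]) : ℚ_[p]) = eval₂ (Int.castRingHom ℚ_[p]) (α : ℚ_[p]) g :=
    fun g => by
      have := hom_eval₂ g (Int.castRingHom ℤ_[p]) PadicInt.Coe.ringHom α
      rw [show PadicInt.Coe.ringHom.comp (Int.castRingHom ℤ_[p]) = Int.castRingHom ℚ_[p] from
        RingHom.ext_int _ _] at this
      exact this
  refine ⟨PadicInt.Coe.ringHom.comp φ₀, fun g => ?_, fun g hg => ?_⟩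
  · have := eval₂_eq_zero_iff_dvd (L := ℚ_[p]) hf hd (α := (α : ℚ_[p])) (by
      rw [← hφ, hφ₀, hα]; rfl) g
    rw [← hφ] at this
    exact this
  · obtain ⟨c, hc⟩ := hg
    have hc' : ((φ₀ g : ℤ_[p]) : ℚ_[p]) = c * c := hc
    have hcn : ‖c‖ ≤ 1 := by
      have h3 : ‖c‖ * ‖c‖ ≤ 1 := by
        rw [← norm_mul, ← hc']
        exact PadicInt.norm_le_one _
      nlinarith [norm_nonneg c]
    let c' : ℤ_[p] := ⟨c, hcn⟩
    have h4 : φ₀ g = c' * c' := Subtype.ext hc'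
    have h5 : PadicInt.toZMod (φ₀ g) = ((g.eval r : ℤ) : ZMod p) := by
      have h6 := hom_eval₂ g (Int.castRingHom ℤ_[p]) (PadicInt.toZMod (p := p)) α
      rw [show (PadicInt.toZMod (p := p)).comp (Int.castRingHom ℤ_[p]) =
        Int.castRingHom (ZMod p) from RingHom.ext_int _ _, hmod] at h6
      have h7 : eval₂ (Int.castRingHom (ZMod p)) (r : ZMod p) g = ((g.eval r : ℤ) : ZMod p) := by
        simp
      rw [← h7]
      exact h6
    rw [← h5, h4, map_mul]
    exact ⟨_, rfl⟩

/-- Evaluation at an integer. -/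
noncomputable def evalRat (w₀ : ℤ) : ℤ[X] →+* ℚ := (Int.castRingHom ℚ).comp (evalRingHom w₀)

theorem evalRat_apply (w₀ : ℤ) (g : ℤ[X]) : evalRat w₀ g = (g.eval w₀ : ℤ) := rfl

theorem evalRat_eq_zero_iff (w₀ : ℤ) (g : ℤ[X]) : evalRat w₀ g = 0 ↔ X - C w₀ ∣ g := by
  rw [evalRat_apply, Int.cast_eq_zero, dvd_iff_isRoot, IsRoot]

variable (K : Type*) [Field K] [Algebra ℤ[X] K] [IsFractionRing ℤ[X] K]

/-- The place of the function field given by evaluation at an integer. -/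
noncomputable def evalPlace (w₀ : ℤ) : Place K ℚ :=
  Place.ofPrime K (evalRat w₀) (prime_X_sub_C w₀) (evalRat_eq_zero_iff w₀)

/-- The place of `ℚ` given by reduction modulo a prime number. -/
noncomputable def modPlace (p : ℕ) [Fact p.Prime] : Place ℚ (ZMod p) :=
  Place.ofPrime ℚ (Int.castRingHom (ZMod p)) (Nat.prime_iff_prime_int.1 Fact.out)
    fun x => ZMod.intCast_zmod_eq_zero_iff_dvd x p

/-! ### Legendre symbols of square classes -/

section Legendre

open Place

variable {K}

/-- The square class test at an irreducible factor of `δ` modulo which `η` is a square. -/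
theorem isSquare_eval_of_multiplicative (p : ℕ) [Fact p.Prime] {f δ η s D : ℤ[X]}
    (hf : Irreducible f) (hd : f.natDegree ≠ 0) {r : ℤ} (h0 : (p : ℤ) ∣ f.eval r)
    (h1 : ¬ (p : ℤ) ∣ f.derivative.eval r) (hδ : f ∣ δ) (hη : f ∣ η - s ^ 2) (hs : ¬ f ∣ s)
    {x y : K} (hy : y ^ 2 = x * (x + algebraMap _ K δ) * (x + algebraMap _ K η)) (hy0 : y ≠ 0)
    (h : IsSquare ((x + algebraMap _ K η) * algebraMap _ K D)) :
    IsSquare ((D.eval r : ℤ) : ZMod p) := by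
  obtain ⟨φ, hφ, hsq⟩ := exists_ringHom_padic p hf hd h0 h1
  apply hsq
  set P := ofPrime K φ hf.prime hφ
  have hmem : ∀ g, algebraMap _ K g ∈ P.ring := algebraMap_mem_ofPrime hf.prime hφ
  have hres : ∀ g, P.res (algebraMap _ K g) = φ g := res_ofPrime_algebraMap hf.prime hφ
  have hη' : φ η = φ s ^ 2 := by
    rw [← map_pow, ← sub_eq_zero, ← map_sub]
    exact (hφ _).2 hη
  have hs' : φ s ≠ 0 := fun h => hs ((hφ _).1 h)
  rw [← hres]
  refine isSquare_res_of_multiplicative (X := x) (δ := algebraMap _ K δ)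
    (η := algebraMap _ K η) (y := y) ?_ (hmem η) ?_ ?_ (hmem D) hy hy0 h
  · rw [← res_eq_zero_iff (hmem δ), hres]
    exact (hφ _).2 hδ
  · rw [hres, hη']
    exact pow_ne_zero 2 hs'
  · rw [hres, hη']
    exact ⟨_, pow_two _⟩

/-- The square class test at a simple irreducible factor of `δ` modulo which `η` is `-3` times a
square. -/
theorem isSquare_eval_of_simple (p : ℕ) [Fact p.Prime] {f δ η s u D D' : ℤ[X]}
    (hf : Irreducible f) (hd : f.natDegree ≠ 0) {r : ℤ} (h0 : (p : ℤ) ∣ f.eval r)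
    (h1 : ¬ (p : ℤ) ∣ f.derivative.eval r) (hδ : δ = f * u) (hu : ¬ f ∣ u)
    (hη : f ∣ η + 3 * s ^ 2) (hs : ¬ f ∣ s) (hD' : ¬ f ∣ D') {β : ℕ} (hβ : β < 2)
    {x y : K} (hy : y ^ 2 = x * (x + algebraMap _ K δ) * (x + algebraMap _ K η)) (hy0 : y ≠ 0)
    (h : IsSquare ((x + algebraMap _ K η) * algebraMap _ K D))
    (h' : IsSquare (x * algebraMap _ K (f ^ β * D'))) :
    IsSquare (((D * C (-3) ^ β).eval r : ℤ) : ZMod p) := by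
  obtain ⟨φ, hφ, hsq⟩ := exists_ringHom_padic p hf hd h0 h1
  apply hsq
  set P := ofPrime K φ hf.prime hφ
  have hmem : ∀ g, algebraMap _ K g ∈ P.ring := algebraMap_mem_ofPrime hf.prime hφ
  have hres : ∀ g, P.res (algebraMap _ K g) = φ g := res_ofPrime_algebraMap hf.prime hφ
  have hη' : φ η = -3 * φ s ^ 2 := by
    have := (hφ _).2 hη
    rw [map_add, map_mul, map_pow, map_ofNat] at this
    linear_combination this
  have hs' : φ s ≠ 0 := fun h => hs ((hφ _).1 h)
  have hc : φ (C (-3)) = -3 := by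
    rw [show (C (-3) : ℤ[X]) = ((-3 : ℤ) : ℤ[X]) from by simp, map_intCast]
    norm_num
  rw [← hres, map_mul, map_pow]
  refine isSquare_res_mul_of_simple (X := x) (δ := algebraMap _ K δ)
    (η := algebraMap _ K η) (y := y) (D' := algebraMap _ K D') (π := algebraMap _ K f)
    (u := algebraMap _ K u) hβ (hmem f) ?_ ?_
    (fun z hz h => div_mem_of_res_eq_zero hf.prime hφ hz h) ?_ (hmem u) ?_ (hmem η) ?_ (hmem _) ?_
    (hmem D) (hmem D') ?_ hy hy0 h ?_
  · exact fun h => hf.ne_zero ((IsFractionRing.to_map_eq_zero_iff (K := K)).1 h)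
  · rw [hres]; exact (hφ _).2 dvd_rfl
  · rw [hδ, map_mul]
  · rw [hres]; exact fun h => hu ((hφ _).1 h)
  · rw [hres, hη']
    exact mul_ne_zero (by norm_num) (pow_ne_zero 2 hs')
  · rw [hres, hres, hη', hc]
    exact ⟨3 * φ s, by ring⟩
  · rw [hres]; exact fun h => hD' ((hφ _).1 h)
  · rw [map_mul, map_pow] at h'
    exact h'

/-- The Legendre symbol in additive form: `0` at non-zero squares and `1` at non-squares. It is
computed through Euler's criterion. -/
def legendreBit (p : ℕ) (a : ℤ) : ZMod 2 := if a ^ (p / 2) % p = 1 then 0 else 1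

theorem neg_one_pow_legendreBit {p : ℕ} [Fact p.Prime] (hp : 2 < p) {a : ℤ} (ha : ¬ (p : ℤ) ∣ a) :
    (a : ZMod p) ^ (p / 2) = (-1) ^ (legendreBit p a).val := by
  have ha' : (a : ZMod p) ≠ 0 := by rwa [Ne, ZMod.intCast_zmod_eq_zero_iff_dvd]
  have hiff : a ^ (p / 2) % p = 1 ↔ (a : ZMod p) ^ (p / 2) = 1 := by
    have h1 : (a : ZMod p) ^ (p / 2) = ((a ^ (p / 2) : ℤ) : ZMod p) := by push_cast; rfl
    rw [h1, ← Int.cast_one (R := ZMod p), ZMod.intCast_eq_intCast_iff',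
      Int.emod_eq_of_lt (a := 1) zero_le_one (by exact_mod_cast (by lia : 1 < p))]
  by_cases h : a ^ (p / 2) % p = 1
  · rw [hiff.1 h]
    simp [legendreBit, h]
  · rw [(ZMod.pow_div_two_eq_neg_one_or_one p ha').resolve_left (fun h' => h (hiff.2 h'))]
    simp [legendreBit, h, ZMod.val_one]

/-- When a product of integers prime to `p` is a square modulo `p`, the Legendre symbols cancel. -/
theorem sum_legendreBit_eq_zero {p : ℕ} [Fact p.Prime] (hp : 2 < p) {ι : Type*} (S : Finset ι)
    (a : ι → ℤ) (e : ι → ZMod 2) (ha : ∀ i ∈ S, ¬ (p : ℤ) ∣ a i)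
    (h : IsSquare (((∏ i ∈ S, a i ^ (e i).val : ℤ)) : ZMod p)) :
    ∑ i ∈ S, legendreBit p (a i) * e i = 0 := by
  have hpp : p.Prime := Fact.out
  have key : (((∏ i ∈ S, a i ^ (e i).val : ℤ)) : ZMod p) ^ (p / 2) =
      (-1) ^ (∑ i ∈ S, legendreBit p (a i) * e i).val := by
    clear h
    classical
    induction S using Finset.induction_on with
    | empty => simp
    | insert i S hi ih =>
      rw [Finset.prod_insert hi, Finset.sum_insert hi]
      push_cast at ih ⊢
      rw [mul_pow, ih fun j hj => ha j (Finset.mem_insert_of_mem hj), ← pow_mul, mul_comm (e i).val,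
        pow_mul, neg_one_pow_legendreBit hp (ha i (Finset.mem_insert_self i S)), ← pow_mul,
        ← pow_add]
      generalize legendreBit p (a i) = u
      generalize e i = v
      generalize ∑ i ∈ S, legendreBit p (a i) * e i = z
      refine neg_one_pow_congr ?_
      revert u v z
      decide
  have h0 : (((∏ i ∈ S, a i ^ (e i).val : ℤ)) : ZMod p) ≠ 0 := by
    rw [Ne, ZMod.intCast_zmod_eq_zero_iff_dvd]
    intro hd
    obtain ⟨i, hi, hd⟩ := (Nat.prime_iff_prime_int.1 hpp).exists_mem_finset_dvd hd
    exact ha i hi ((Nat.prime_iff_prime_int.1 hpp).dvd_of_dvd_pow hd)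
  rw [ZMod.euler_criterion p h0, key] at h
  generalize ∑ i ∈ S, legendreBit p (a i) * e i = z at h
  by_contra hz
  have : z = 1 := by
    clear key h
    revert z
    decide
  rw [this] at h
  have : Fact (2 < p) := ⟨hp⟩
  simp [ZMod.val_one, ZMod.neg_one_ne_one] at h

end Legendre

end DiophantineCurves

/-! ### Polynomials given by lists of coefficients -/

namespace DiophantineCurves

open Polynomial

section Lists

variable {R : Type*} [CommRing R]

/-- The polynomial with a given list of coefficients, from the constant term upwards. -/
noncomputable def ofList (l : List R) : R[X] := l.foldr (fun a q => C a + X * q) 0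

/-- The value of the polynomial `ofList l`, by Horner's rule. -/
def listEval (l : List R) (r : R) : R := l.foldr (fun a v => a + r * v) 0

/-- The value of the derivative of the polynomial `ofList l`. -/
def listDerivEval : List R → R → R
  | [], _ => 0
  | _ :: l, r => listEval l r + r * listDerivEval l r

/-- The sum of two polynomials given by lists. -/
def listAdd : List R → List R → List R
  | [], m => m
  | l, [] => l
  | a :: l, b :: m => (a + b) :: listAdd l m

/-- The product of two polynomials given by lists. -/
def listMul : List R → List R → List R
  | [], _ => []
  | a :: l, m => listAdd (m.map (a * ·)) (0 :: listMul l m)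

@[simp] theorem ofList_nil : ofList ([] : List R) = 0 := rfl

@[simp] theorem ofList_cons (a : R) (l : List R) : ofList (a :: l) = C a + X * ofList l := rfl

theorem eval_ofList (l : List R) (r : R) : (ofList l).eval r = listEval l r := by
  induction l with
  | nil => simp [listEval]
  | cons a l ih => simp [listEval, ih] at *

theorem eval_derivative_ofList (l : List R) (r : R) :
    (derivative (ofList l)).eval r = listDerivEval l r := by
  induction l with
  | nil => simp [listDerivEval]
  | cons a l ih => simp [listDerivEval, ih, eval_ofList]

theorem ofList_listAdd (l m : List R) : ofList (listAdd l m) = ofList l + ofList m := by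
  induction l generalizing m with
  | nil => simp [listAdd]
  | cons a l ih =>
    cases m with
    | nil => simp [listAdd]
    | cons b m => simp only [listAdd, ofList_cons, ih, C_add]; ring

theorem ofList_map_mul (a : R) (l : List R) : ofList (l.map (a * ·)) = C a * ofList l := by
  induction l with
  | nil => simp
  | cons b l ih => simp only [List.map_cons, ofList_cons, ih, C_mul]; ring

theorem ofList_listMul (l m : List R) : ofList (listMul l m) = ofList l * ofList m := by
  induction l with
  | nil => simp [listMul]
  | cons a l ih =>
    simp only [listMul, ofList_listAdd, ofList_map_mul, ofList_cons, ih, C_0]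
    ring

theorem map_ofList {S : Type*} [CommRing S] (φ : R →+* S) (l : List R) :
    (ofList l).map φ = ofList (l.map φ) := by
  induction l with
  | nil => simp
  | cons a l ih => simp [ih]

theorem coeff_ofList (l : List R) (i : ℕ) : (ofList l).coeff i = l.getD i 0 := by
  induction l generalizing i with
  | nil => simp
  | cons a l ih => cases i <;> simp [ih]

theorem natDegree_ofList_lt (l : List R) (hl : l ≠ []) : (ofList l).natDegree < l.length := by
  have : 0 < l.length := List.length_pos_iff.2 hl
  have h : (ofList l).natDegree ≤ l.length - 1 := by
    rw [natDegree_le_iff_coeff_eq_zero]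
    intro i hi
    rw [coeff_ofList, List.getD_eq_getElem?_getD, List.getElem?_eq_none (by lia)]
    rfl
  lia

theorem natDegree_ofList {l : List R} {n : ℕ} (hl : l.length = n + 1) (hn : l.getD n 0 ≠ 0) :
    (ofList l).natDegree = n :=
  natDegree_eq_of_le_of_coeff_ne_zero
    (by have := natDegree_ofList_lt l (by rintro rfl; simp at hl); lia)
    (by rwa [coeff_ofList])

/-- The remainder of the polynomial `ofList l` modulo `X ^ 2 + u X + v`. -/
def listRem (u v : R) : List R → R × R
  | [] => (0, 0)
  | a :: l => (a - v * (listRem u v l).2, (listRem u v l).1 - u * (listRem u v l).2)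

theorem dvd_sub_listRem (u v : R) (l : List R) :
    X ^ 2 + C u * X + C v ∣ ofList l - (C (listRem u v l).1 + C (listRem u v l).2 * X) := by
  induction l with
  | nil => simp [listRem]
  | cons a l ih =>
    obtain ⟨q, hq⟩ := ih
    refine ⟨X * q + C (listRem u v l).2, ?_⟩
    simp only [listRem, ofList_cons, C_sub, C_mul]
    linear_combination X * hq

end Lists

/-- A criterion for a polynomial of degree at most five with integral coefficients to be
irreducible, in terms of its reduction modulo a prime `p`. There must be no linear factor modulo
`p`; quadratic factors are allowed (polynomials whose Galois group is the Klein group have them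
modulo all primes), but no divisor of the value at `e` may be congruent to the value of such a
factor. -/
theorem prime_ofList {l : List ℤ} {n : ℕ} (hn0 : n ≠ 0) (hn5 : n ≤ 5) (hl : l.length = n + 1)
    (hgcd : l.foldr (fun a g => Nat.gcd a.natAbs g) 0 = 1) (p : ℕ) (e : ℤ)
    (hlc : ((l.getD n 0 : ℤ) : ZMod p) ≠ 0)
    (h1 : n = 1 ∨ ∀ r : ZMod p, listEval (l.map (Int.cast : ℤ → ZMod p)) r ≠ 0)
    (h2 : n ≤ 3 ∨ listEval l e ≠ 0 ∧
      ∀ u v : ZMod p, listRem u v (l.map (Int.cast : ℤ → ZMod p)) = (0, 0) →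
        ∀ c ∈ (l.getD n 0).natAbs.divisors, ∀ d ∈ (listEval l e).natAbs.divisors,
          (d : ZMod p) ≠ c * ((e : ZMod p) ^ 2 + u * e + v) ∧
          (d : ZMod p) ≠ -(c * ((e : ZMod p) ^ 2 + u * e + v)))
    (hp : p.Prime) : Prime (ofList l) := by
  have : Fact p.Prime := ⟨hp⟩
  have hlc0 : l.getD n 0 ≠ 0 := fun h => hlc (by rw [h, Int.cast_zero])
  have hdeg := natDegree_ofList hl hlc0
  have hlead : (ofList l).leadingCoeff = l.getD n 0 := by
    rw [leadingCoeff, hdeg, coeff_ofList]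
  have hf0 : ofList l ≠ 0 := by
    intro h; rw [h] at hdeg; exact hn0 (by simpa using hdeg.symm)
  have hprim : (ofList l).IsPrimitive := by
    intro c hc
    rw [C_dvd_iff_dvd_coeff] at hc
    have h3 : ∀ m : List ℤ, (∀ i, c ∣ m.getD i 0) →
        c.natAbs ∣ m.foldr (fun a g => Nat.gcd a.natAbs g) 0 := by
      intro m
      induction m with
      | nil => simp
      | cons a m ih =>
        intro hm
        exact Nat.dvd_gcd (Int.natAbs_dvd_natAbs.2 (by simpa using hm 0))
          (ih fun i => by simpa using hm (i + 1))
    have h4 := h3 l fun i => by rw [← coeff_ofList]; exact hc i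
    rw [hgcd, Nat.dvd_one] at h4
    exact Int.isUnit_iff_natAbs_eq.2 h4
  set φ := Int.castRingHom (ZMod p)
  have hmap : (ofList l).map φ = ofList (l.map (Int.cast : ℤ → ZMod p)) := map_ofList φ l
  -- the leading coefficient of a factor is prime to `p`
  have hlcg : ∀ g h : ℤ[X], ofList l = g * h → φ g.leadingCoeff ≠ 0 := fun g h hgh h0 => by
    rw [← hlead, hgh, leadingCoeff_mul] at hlc
    push_cast at hlc
    exact hlc (by rw [show ((g.leadingCoeff : ℤ) : ZMod p) = 0 from h0, zero_mul])
  have key : ∀ g h : ℤ[X], ofList l = g * h → g.natDegree ≤ h.natDegree → IsUnit g := by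
    intro g h hgh hle
    have hg0 : g ≠ 0 := by rintro rfl; exact hf0 (by rw [hgh, zero_mul])
    have hh0 : h ≠ 0 := by rintro rfl; exact hf0 (by rw [hgh, mul_zero])
    have hsum : g.natDegree + h.natDegree = n := by rw [← hdeg, hgh, natDegree_mul hg0 hh0]
    have hlg := hlcg g h hgh
    have hdvd : g.map φ ∣ ofList (l.map (Int.cast : ℤ → ZMod p)) := by
      rw [← hmap, hgh, Polynomial.map_mul]
      exact dvd_mul_right _ _
    have hcases : g.natDegree = 0 ∨ g.natDegree = 1 ∨ g.natDegree = 2 := by lia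
    rcases hcases with hd | hd | hd
    · rw [eq_C_of_natDegree_eq_zero hd] at hgh ⊢
      exact isUnit_C.2 (hprim _ ⟨h, hgh⟩)
    · exfalso
      have hc1 : φ (g.coeff 1) ≠ 0 := by rwa [leadingCoeff, hd] at hlg
      refine h1.resolve_left (by lia) (-(φ (g.coeff 0)) / φ (g.coeff 1)) ?_
      rw [← eval_ofList]
      apply eval_eq_zero_of_dvd_of_eval_eq_zero hdvd
      have hg1 : g.map φ = C (φ (g.coeff 1)) * X + C (φ (g.coeff 0)) := by
        conv_lhs => rw [eq_X_add_C_of_natDegree_le_one hd.le]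
        simp only [Polynomial.map_add, Polynomial.map_mul, map_C, map_X]
      rw [hg1]
      simp only [eval_add, eval_mul, eval_C, eval_X]
      rw [mul_div_cancel₀ _ hc1, neg_add_cancel]
    · exfalso
      obtain ⟨he, h2⟩ := h2.resolve_left (by lia)
      set c := φ g.leadingCoeff
      set u := φ (g.coeff 1) / c
      set v := φ (g.coeff 0) / c
      have hgq : g.map φ = C c * (X ^ 2 + C u * X + C v) := by
        have hc2 : C c * C u = C (φ (g.coeff 1)) := by rw [← C_mul, mul_div_cancel₀ _ hlg]
        have hc3 : C c * C v = C (φ (g.coeff 0)) := by rw [← C_mul, mul_div_cancel₀ _ hlg]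
        have h5 := eq_quadratic_of_degree_le_two (p := g)
          (natDegree_le_iff_degree_le.1 hd.le)
        have h6 : g.coeff 2 = g.leadingCoeff := by rw [leadingCoeff, hd]
        rw [h6] at h5
        rw [h5]
        simp only [Polynomial.map_add, Polynomial.map_mul, map_C, map_X, Polynomial.map_pow]
        rw [← hc2, ← hc3]
        ring
      have hq : X ^ 2 + C u * X + C v ∣ ofList (l.map (Int.cast : ℤ → ZMod p)) :=
        (Dvd.intro_left _ hgq.symm).trans hdvd
      have hrem := (dvd_sub_right hq).1 (dvd_sub_listRem u v (l.map (Int.cast : ℤ → ZMod p)))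
      have hq2 : (X ^ 2 + C u * X + C v).natDegree = 2 := by compute_degree!
      have hrem0 : C (listRem u v (l.map (Int.cast : ℤ → ZMod p))).1 +
          C (listRem u v (l.map (Int.cast : ℤ → ZMod p))).2 * X = 0 := by
        apply eq_zero_of_dvd_of_natDegree_lt hrem
        rw [hq2]
        refine lt_of_le_of_lt ?_ one_lt_two
        compute_degree
      have hrem1 : listRem u v (l.map (Int.cast : ℤ → ZMod p)) = (0, 0) := by
        ext
        · simpa using congrArg (fun q => q.coeff 0) hrem0
        · simpa using congrArg (fun q => q.coeff 1) hrem0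
      have hge : g.eval e ∣ listEval l e := by
        rw [← eval_ofList, hgh, eval_mul]
        exact dvd_mul_right _ _
      have hgl : g.leadingCoeff ∣ l.getD n 0 := by
        rw [← hlead, hgh, leadingCoeff_mul]
        exact dvd_mul_right _ _
      have h7 := h2 u v hrem1 g.leadingCoeff.natAbs
        (Nat.mem_divisors.2 ⟨Int.natAbs_dvd_natAbs.2 hgl, Int.natAbs_ne_zero.2 hlc0⟩)
        (g.eval e).natAbs
        (Nat.mem_divisors.2 ⟨Int.natAbs_dvd_natAbs.2 hge, Int.natAbs_ne_zero.2 he⟩)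
      have h8 : ((g.eval e : ℤ) : ZMod p) = c * ((e : ZMod p) ^ 2 + u * e + v) := by
        have h9 := eval_intCast_map φ g e
        rw [hgq] at h9
        simp only [eval_add, eval_mul, eval_C, eval_X, eval_pow] at h9
        exact h9.symm
      have hcc : ((g.leadingCoeff : ℤ) : ZMod p) = c := rfl
      have hsgn : ∀ z : ℤ, ((z.natAbs : ℕ) : ZMod p) = z ∨ ((z.natAbs : ℕ) : ZMod p) = -z := by
        intro z
        rcases Int.natAbs_eq z with hz | hz
        · left
          conv_rhs => rw [hz]
          simp
        · right
          conv_rhs => rw [hz]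
          simp
      rcases hsgn (g.eval e) with h9 | h9 <;> rcases hsgn g.leadingCoeff with h10 | h10 <;>
        rw [h9, h10, h8, hcc] at h7
      · exact h7.1 rfl
      · exact h7.2 (by ring)
      · exact h7.2 rfl
      · exact h7.1 (by ring)
  apply Irreducible.prime
  refine ⟨fun hu => hn0 (by rw [← hdeg]; exact natDegree_eq_zero_of_isUnit hu),
    fun g h hgh => ?_⟩
  rcases le_total g.natDegree h.natDegree with hle | hle
  · exact Or.inl (key g h hgh hle)
  · exact Or.inr (key h g (by rw [hgh, mul_comm]) hle)

theorem prime_ofList_singleton {p : ℕ} (hp : p.Prime) : Prime (ofList [(p : ℤ)]) := by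
  rw [ofList_cons, ofList_nil, mul_zero, add_zero, prime_C_iff]
  exact Nat.prime_iff_prime_int.1 hp

end DiophantineCurves

/-! ### The local conditions on square classes -/

namespace DiophantineCurves

open Polynomial

/-- The data of a curve `y² = x (x + M) (x + N)` over `ℤ[w]` with `M = a³ (a + 2 b)` and
`N = b³ (b + 2 a)`: a list `f` of polynomials, the factors of `M`, `N` and
`N - M = (b - a) (a + b)³`, sorted into types `0`, `1` and `2` accordingly, and the factorizations
of `a`, `b`, `a + 2 b`, `b + 2 a`, `a + b` and `b - a`. -/
structure FamilyData (n : ℕ) where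
  /-- The prime factors. -/
  f : Fin n → List ℤ
  /-- The types of the prime factors. -/
  t : Fin n → Fin 3
  /-- The factors of `a`. -/
  fa : List (Fin n)
  /-- The factors of `b`. -/
  fb : List (Fin n)
  /-- The factors of `a + 2 b`. -/
  fa2b : List (Fin n)
  /-- The factors of `b + 2 a`. -/
  fb2a : List (Fin n)
  /-- The factors of `a + b`. -/
  fab : List (Fin n)
  /-- The factors of `b - a`. -/
  fba : List (Fin n)

namespace FamilyData

variable {n : ℕ} (D : FamilyData n)

/-- The product of the factors with the given indices. -/
def listProd (s : List (Fin n)) : List ℤ := s.foldr (fun i l => listMul (D.f i) l) [1]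

/-- The coefficients of `a`. -/
def aList : List ℤ := D.listProd D.fa

/-- The coefficients of `b`. -/
def bList : List ℤ := D.listProd D.fb

/-- The polynomial `a`. -/
noncomputable def a : ℤ[X] := ofList D.aList

/-- The polynomial `b`. -/
noncomputable def b : ℤ[X] := ofList D.bList

/-- The polynomial `M = a³ (a + 2 b)`. -/
noncomputable def M : ℤ[X] := D.a ^ 3 * (D.a + 2 * D.b)

/-- The polynomial `N = b³ (b + 2 a)`. -/
noncomputable def N : ℤ[X] := D.b ^ 3 * (D.b + 2 * D.a)

/-- The prime factors as polynomials. -/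
noncomputable def F (i : Fin n) : ℤ[X] := ofList (D.f i)

/-- The conditions on the data: the factorizations hold, all factors have the right type, and no
factor divides another one, as is seen from the values at some integers. -/
structure Consistent (pts : List ℤ) : Prop where
  ta : ∀ i ∈ D.fa ++ D.fa2b, D.t i = 0
  tb : ∀ i ∈ D.fb ++ D.fb2a, D.t i = 1
  tab : ∀ i ∈ D.fab ++ D.fba, D.t i = 2
  a2b : D.listProd D.fa2b = listAdd D.aList (D.bList.map (2 * ·))
  b2a : D.listProd D.fb2a = listAdd D.bList (D.aList.map (2 * ·))
  ab : D.listProd D.fab = listAdd D.aList D.bList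
  ba : D.listProd D.fba = listAdd D.bList (D.aList.map (-1 * ·))
  not_dvd : ∀ i j, i ≠ j → ∃ e ∈ pts, ¬ listEval (D.f i) e ∣ listEval (D.f j) e

variable {D}

theorem prime_dvd_listProd {q : ℤ[X]} (hq : Prime q) (s : List (Fin n))
    (h : q ∣ ofList (D.listProd s)) : ∃ i ∈ s, q ∣ D.F i := by
  induction s with
  | nil =>
    exact absurd (isUnit_of_dvd_one (by simpa [listProd] using h)) hq.not_isUnit
  | cons i s ih =>
    have h' : q ∣ D.F i * ofList (D.listProd s) := by
      have h1 : ofList (D.listProd (i :: s)) = D.F i * ofList (D.listProd s) := ofList_listMul _ _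
      rwa [← h1]
    rcases hq.dvd_or_dvd h' with h | h
    · exact ⟨i, List.mem_cons_self, h⟩
    · obtain ⟨j, hj, hd⟩ := ih h
      exact ⟨j, List.mem_cons_of_mem _ hj, hd⟩

/-- The data are consistent and the factors are prime elements of `ℤ[w]`. A prime number may occur
among the factors, as a constant polynomial. -/
structure Valid (D : FamilyData n) : Prop where
  consistent : ∃ pts, D.Consistent pts
  prime : ∀ i, Prime (D.F i)

namespace Valid

variable (hD : D.Valid)
include hD

theorem not_dvd (i j : Fin n) (hij : i ≠ j) : ¬ D.F i ∣ D.F j := by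
  obtain ⟨pts, h⟩ := hD.consistent
  obtain ⟨e, -, he⟩ := h.not_dvd i j hij
  intro hd
  apply he
  rw [← eval_ofList, ← eval_ofList]
  exact eval_dvd hd

theorem ofList_fa2b : ofList (D.listProd D.fa2b) = D.a + 2 * D.b := by
  obtain ⟨pts, h⟩ := hD.consistent
  rw [h.a2b, ofList_listAdd, ofList_map_mul]; rfl

theorem ofList_fb2a : ofList (D.listProd D.fb2a) = D.b + 2 * D.a := by
  obtain ⟨pts, h⟩ := hD.consistent
  rw [h.b2a, ofList_listAdd, ofList_map_mul]; rfl

theorem ofList_fab : ofList (D.listProd D.fab) = D.a + D.b := by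
  obtain ⟨pts, h⟩ := hD.consistent
  rw [h.ab, ofList_listAdd]; rfl

theorem ofList_fba : ofList (D.listProd D.fba) = D.b - D.a := by
  obtain ⟨pts, h⟩ := hD.consistent
  rw [h.ba, ofList_listAdd, ofList_map_mul, C_neg, C_1, neg_one_mul, ← sub_eq_add_neg]; rfl

theorem prime_dvd_M (q : ℤ[X]) (hq : Prime q) (h : q ∣ D.M) : ∃ i, D.t i = 0 ∧ q ∣ D.F i := by
  obtain ⟨pts, hc⟩ := hD.consistent
  rcases hq.dvd_or_dvd h with h | h
  · obtain ⟨i, hi, hd⟩ := prime_dvd_listProd hq D.fa (hq.dvd_of_dvd_pow h)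
    exact ⟨i, hc.ta i (List.mem_append_left _ hi), hd⟩
  · rw [← hD.ofList_fa2b] at h
    obtain ⟨i, hi, hd⟩ := prime_dvd_listProd hq D.fa2b h
    exact ⟨i, hc.ta i (List.mem_append_right _ hi), hd⟩

theorem prime_dvd_N (q : ℤ[X]) (hq : Prime q) (h : q ∣ D.N) : ∃ i, D.t i = 1 ∧ q ∣ D.F i := by
  obtain ⟨pts, hc⟩ := hD.consistent
  rcases hq.dvd_or_dvd h with h | h
  · obtain ⟨i, hi, hd⟩ := prime_dvd_listProd hq D.fb (hq.dvd_of_dvd_pow h)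
    exact ⟨i, hc.tb i (List.mem_append_left _ hi), hd⟩
  · rw [← hD.ofList_fb2a] at h
    obtain ⟨i, hi, hd⟩ := prime_dvd_listProd hq D.fb2a h
    exact ⟨i, hc.tb i (List.mem_append_right _ hi), hd⟩

theorem prime_dvd_N_sub_M (q : ℤ[X]) (hq : Prime q) (h : q ∣ D.N - D.M) :
    ∃ i, D.t i = 2 ∧ q ∣ D.F i := by
  obtain ⟨pts, hc⟩ := hD.consistent
  have hfac : D.N - D.M = (D.b - D.a) * (D.a + D.b) ^ 3 := by simp only [N, M]; ring
  rw [hfac] at h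
  rcases hq.dvd_or_dvd h with h | h
  · rw [← hD.ofList_fba] at h
    obtain ⟨i, hi, hd⟩ := prime_dvd_listProd hq D.fba h
    exact ⟨i, hc.tab i (List.mem_append_right _ hi), hd⟩
  · replace h := hq.dvd_of_dvd_pow h
    rw [← hD.ofList_fab] at h
    obtain ⟨i, hi, hd⟩ := prime_dvd_listProd hq D.fab h
    exact ⟨i, hc.tab i (List.mem_append_left _ hi), hd⟩

theorem listProd_ne_zero (s : List (Fin n)) : ofList (D.listProd s) ≠ 0 := by
  induction s with
  | nil => simp [listProd]
  | cons i s ih =>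
    have : ofList (D.listProd (i :: s)) = D.F i * ofList (D.listProd s) := ofList_listMul _ _
    rw [this]
    exact mul_ne_zero (hD.prime i).ne_zero ih

theorem a_ne_zero : D.a ≠ 0 := hD.listProd_ne_zero _

theorem b_ne_zero : D.b ≠ 0 := hD.listProd_ne_zero _

theorem M_ne_zero : D.M ≠ 0 :=
  mul_ne_zero (pow_ne_zero _ hD.a_ne_zero) (by rw [← hD.ofList_fa2b]; exact hD.listProd_ne_zero _)

theorem N_ne_zero : D.N ≠ 0 :=
  mul_ne_zero (pow_ne_zero _ hD.b_ne_zero) (by rw [← hD.ofList_fb2a]; exact hD.listProd_ne_zero _)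

theorem add_ne_zero : D.a + D.b ≠ 0 := by
  rw [← hD.ofList_fab]; exact hD.listProd_ne_zero _

theorem N_sub_M_ne_zero : D.N - D.M ≠ 0 := by
  have hfac : D.N - D.M = (D.b - D.a) * (D.a + D.b) ^ 3 := by simp only [N, M]; ring
  rw [hfac]
  exact mul_ne_zero (by rw [← hD.ofList_fba]; exact hD.listProd_ne_zero _)
    (pow_ne_zero _ hD.add_ne_zero)

theorem isSplit (K : Type*) [Field K] [Algebra ℤ[X] K] [IsFractionRing ℤ[X] K] :
    IsSplit (algebraMap ℤ[X] K D.M) (algebraMap ℤ[X] K D.N) := by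
  have hinj := IsFractionRing.injective ℤ[X] K
  have h0 : ∀ g : ℤ[X], g ≠ 0 → algebraMap ℤ[X] K g ≠ 0 := fun g hg h => hg
    ((IsFractionRing.to_map_eq_zero_iff (K := K)).1 h)
  refine ⟨?_, h0 _ hD.M_ne_zero, h0 _ hD.N_ne_zero, fun h => hD.N_sub_M_ne_zero ?_⟩
  · have := h0 2 two_ne_zero
    rwa [map_ofNat] at this
  · rw [hinj h, sub_self]

end Valid

theorem eval_withSigns (r : ℤ) (i : Fin (n + 2)) :
    (withSigns D.F i).eval r = withSigns (fun i => listEval (D.f i) r) i := by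
  refine Fin.cases ?_ (fun i => Fin.cases ?_ (fun i => ?_) i) i
  · simp [withSigns]
  · simp [withSigns]
  · simp [withSigns, F, eval_ofList]

theorem exempt_exempt (j : Fin 3) : exempt (exempt j) = j := by revert j; decide

/-- The value at `r` of the class of a factor, as a product. -/
theorem eval_classProd (r : ℤ) (β : Fin (n + 2) → ZMod 2) (j : Fin 3) :
    (classProd (withSigns D.F) (withSignTypes D.t) β (exempt j)).eval r =
      ∏ i, (if withSignTypes D.t i = j then 1 else
        withSigns (fun i => listEval (D.f i) r) i) ^ (β i).val := by
  rw [classProd, eval_prod]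
  refine Finset.prod_congr rfl fun i _ => ?_
  rw [eval_pow, eval_withSigns, exempt_exempt]
  split_ifs <;> simp

theorem Valid.not_dvd_withSigns (hD : D.Valid) (i : Fin n) {i' : Fin (n + 2)}
    (h : i' ≠ i.succ.succ) : ¬ D.F i ∣ withSigns D.F i' := by
  revert h
  have h1 : ¬ D.F i ∣ -1 := fun h => (hD.prime i).not_isUnit
    (isUnit_of_dvd_unit h isUnit_one.neg)
  refine Fin.cases ?_ (fun i' => Fin.cases ?_ (fun i' => ?_) i') i'
  · intro _
    simpa [withSigns] using h1
  · intro _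
    simpa [withSigns] using h1
  · intro h
    have hne : i ≠ i' := fun h' => h (by rw [h'])
    simpa [withSigns] using hD.not_dvd i i' hne

end FamilyData

/-- A local condition on the square classes: a root `r` modulo `p` of a factor of `a`, `b`,
`a + 2 b` or `b + 2 a`, with the cofactor `c`; in the last two cases it is called simple. -/
structure LocalTest (n : ℕ) where
  /-- The index of the factor. -/
  i : Fin n
  /-- Whether the factor divides `a + 2 b` or `b + 2 a` rather than `a` or `b`. -/
  simple : Bool
  /-- The prime number. -/
  p : ℕ
  /-- The root. -/
  r : ℤ
  /-- The cofactor. -/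
  c : List ℤ

namespace LocalTest

variable {n : ℕ} (D : FamilyData n) (T : LocalTest n)

/-- The integer of which the Legendre symbol is taken for each of the generators. The class tested
is that of the one factor of `x (x + M) (x + N)` in which primes of the type of `T.i` do not occur;
at a simple root the exponent of `T.i` enters nevertheless, with the class of `-3`. -/
def value (i : Fin (n + 2)) : ℤ :=
  if withSignTypes D.t i = D.t T.i then (if T.simple ∧ i = T.i.succ.succ then -3 else 1)
  else withSigns (fun i => listEval (D.f i) T.r) i

/-- The conditions under which a local test is meaningful, for the polynomials `s = a`, `s' = b` or
the other way round. -/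
structure Consistent (s s' : List ℤ) : Prop where
  three_lt : 3 < T.p
  root : (T.p : ℤ) ∣ listEval (D.f T.i) T.r
  simple_root : ¬ (T.p : ℤ) ∣ listDerivEval (D.f T.i) T.r
  not_dvd_value : ∀ i, ¬ (T.p : ℤ) ∣ T.value D i
  not_dvd : ¬ (T.p : ℤ) ∣ listEval s' T.r
  eq_mul : T.simple = false → s = listMul (D.f T.i) T.c
  eq_mul' : T.simple = true → listAdd s (s'.map (2 * ·)) = listMul (D.f T.i) T.c
  not_dvd' : T.simple = true → ¬ (T.p : ℤ) ∣ listEval s T.r ∧ ¬ (T.p : ℤ) ∣ listEval T.c T.r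

/-- The test is consistent with the type of the factor. -/
def Valid : Prop :=
  T.p.Prime ∧ (D.t T.i = 0 ∧ T.Consistent D D.aList D.bList ∨
    D.t T.i = 1 ∧ T.Consistent D D.bList D.aList)

variable {D T} {K : Type*} [Field K] [Algebra ℤ[X] K] [IsFractionRing ℤ[X] K]

/-- The linear relation between the exponents of the square classes given by a local test. -/
theorem sum_eq_zero_of_consistent (hD : D.Valid) [Fact T.p.Prime] {s s' : List ℤ}
    (hT : T.Consistent D s s') (h2 : D.t T.i ≠ 2) {x y : K} (hy0 : y ≠ 0)
    (hy : y ^ 2 = x * (x + algebraMap ℤ[X] K (ofList s ^ 3 * (ofList s + 2 * ofList s'))) *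
      (x + algebraMap ℤ[X] K (ofList s' ^ 3 * (ofList s' + 2 * ofList s))))
    {β : Fin (n + 2) → ZMod 2}
    (h : IsSquare ((x + algebraMap ℤ[X] K (ofList s' ^ 3 * (ofList s' + 2 * ofList s))) *
      algebraMap ℤ[X] K (classProd (withSigns D.F) (withSignTypes D.t) β (exempt (D.t T.i)))))
    (h₀ : IsSquare (x * algebraMap ℤ[X] K
      (classProd (withSigns D.F) (withSignTypes D.t) β 0))) :
    ∑ i, legendreBit T.p (T.value D i) * β i = 0 := by
  refine sum_legendreBit_eq_zero (lt_trans (by norm_num) hT.three_lt) _ _ _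
    (fun i _ => hT.not_dvd_value i) ?_
  have hr0 : (T.p : ℤ) ∣ (D.F T.i).eval T.r := by
    rw [FamilyData.F, eval_ofList]; exact hT.root
  have hr1 : ¬ (T.p : ℤ) ∣ (derivative (D.F T.i)).eval T.r := by
    rw [FamilyData.F, eval_derivative_ofList]; exact hT.simple_root
  have hd : (D.F T.i).natDegree ≠ 0 := by
    intro hd
    rw [eq_C_of_natDegree_eq_zero hd] at hr1
    simp at hr1
  have hirr := (hD.prime T.i).irreducible
  -- a polynomial whose value is prime to `p` is not divisible by the factor
  have hnd : ∀ l : List ℤ, ¬ (T.p : ℤ) ∣ listEval l T.r → ¬ D.F T.i ∣ ofList l := by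
    intro l hl hdvd
    apply hl
    rw [← eval_ofList]
    exact hr0.trans (eval_dvd hdvd)
  have hs' := hnd s' hT.not_dvd
  cases hsim : T.simple with
  | false =>
    have hs : D.F T.i ∣ ofList s := by
      rw [hT.eq_mul hsim, ofList_listMul]
      exact dvd_mul_right _ _
    have key := isSquare_eval_of_multiplicative T.p hirr hd hr0 hr1
      (δ := ofList s ^ 3 * (ofList s + 2 * ofList s'))
      (η := ofList s' ^ 3 * (ofList s' + 2 * ofList s)) (s := ofList s' ^ 2)
      (hs.trans ⟨ofList s ^ 2 * (ofList s + 2 * ofList s'), by ring⟩)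
      (hs.trans ⟨2 * ofList s' ^ 3, by ring⟩)
      (fun h => hs' ((hD.prime T.i).dvd_of_dvd_pow h)) hy hy0 h
    rw [FamilyData.eval_classProd] at key
    have e : ∏ i, T.value D i ^ (β i).val = ∏ i, (if withSignTypes D.t i = D.t T.i then 1 else
        withSigns (fun i => listEval (D.f i) T.r) i) ^ (β i).val :=
      Finset.prod_congr rfl fun i _ => by simp [value, hsim]
    rw [e]
    exact key
  | true =>
    have hs : ofList s + 2 * ofList s' = D.F T.i * ofList T.c := by
      have := congrArg ofList (hT.eq_mul' hsim)
      rw [ofList_listAdd, ofList_map_mul, ofList_listMul] at this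
      exact this
    have hne : withSignTypes D.t T.i.succ.succ ≠ exempt 0 := by
      simpa [withSignTypes, exempt] using h2
    have hsplit : classProd (withSigns D.F) (withSignTypes D.t) β 0 =
        D.F T.i ^ (β T.i.succ.succ).val * ∏ i ∈ Finset.univ.erase T.i.succ.succ,
          withSigns D.F i ^ (if withSignTypes D.t i = exempt 0 then 0 else (β i).val) := by
      rw [classProd, ← Finset.mul_prod_erase _ _ (Finset.mem_univ T.i.succ.succ), if_neg hne]
      rfl
    rw [hsplit] at h₀
    have key := isSquare_eval_of_simple T.p hirr hd hr0 hr1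
      (δ := ofList s ^ 3 * (ofList s + 2 * ofList s'))
      (η := ofList s' ^ 3 * (ofList s' + 2 * ofList s)) (s := ofList s' ^ 2)
      (u := ofList s ^ 3 * ofList T.c)
      (by rw [hs]; ring)
      (fun hdvd => ((hD.prime T.i).dvd_or_dvd hdvd).elim
        (fun h => hnd s (hT.not_dvd' hsim).1 ((hD.prime T.i).dvd_of_dvd_pow h))
        (hnd _ (hT.not_dvd' hsim).2))
      (by
        have : ofList s' ^ 3 * (ofList s' + 2 * ofList s) + 3 * (ofList s' ^ 2) ^ 2 =
          D.F T.i * (ofList T.c * (2 * ofList s' ^ 3)) := by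
          rw [← mul_assoc, ← hs]; ring
        rw [this]
        exact dvd_mul_right _ _)
      (fun h => hs' ((hD.prime T.i).dvd_of_dvd_pow h))
      (fun hdvd => by
        obtain ⟨i, hi, hdi⟩ := ((hD.prime T.i).dvd_finsetProd_iff _).1 hdvd
        exact hD.not_dvd_withSigns T.i (Finset.ne_of_mem_erase hi)
          ((hD.prime T.i).dvd_of_dvd_pow hdi))
      (ZMod.val_lt _) hy hy0 h h₀
    rw [eval_mul, eval_pow, eval_C, FamilyData.eval_classProd] at key
    have ht : withSignTypes D.t T.i.succ.succ = D.t T.i := rfl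
    rw [← Finset.mul_prod_erase _ _ (Finset.mem_univ T.i.succ.succ), if_pos ht, one_pow, one_mul,
      mul_comm] at key
    have e : ∏ i, T.value D i ^ (β i).val = (-3) ^ (β T.i.succ.succ).val *
        ∏ i ∈ Finset.univ.erase T.i.succ.succ, (if withSignTypes D.t i = D.t T.i then 1 else
        withSigns (fun i => listEval (D.f i) T.r) i) ^ (β i).val := by
      rw [← Finset.mul_prod_erase _ _ (Finset.mem_univ T.i.succ.succ)]
      congr 1
      · simp [value, ht, hsim]
      · exact Finset.prod_congr rfl fun i hi => by simp [value, Finset.ne_of_mem_erase hi]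
    rw [e]
    exact key

theorem Valid.sum_eq_zero (hT : T.Valid D) (hD : D.Valid) {x y : K} (hy0 : y ≠ 0)
    (hy : y ^ 2 = x * (x + algebraMap ℤ[X] K D.M) * (x + algebraMap ℤ[X] K D.N))
    {β : Fin (n + 2) → ZMod 2}
    (h : ∀ j : Fin 3, IsSquare ((![x, x + algebraMap ℤ[X] K D.M, x + algebraMap ℤ[X] K D.N] j) *
        algebraMap ℤ[X] K (classProd (withSigns D.F) (withSignTypes D.t) β j))) :
    ∑ i, legendreBit T.p (T.value D i) * β i = 0 := by
  obtain ⟨hp, hT⟩ := hT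
  have : Fact T.p.Prime := ⟨hp⟩
  rcases hT with ⟨ht, hT⟩ | ⟨ht, hT⟩
  · refine sum_eq_zero_of_consistent hD hT (by rw [ht]; decide) hy0 hy ?_ (h 0)
    rw [ht]
    exact h 2
  · refine sum_eq_zero_of_consistent hD hT (by rw [ht]; decide) hy0 (x := x) (y := y) ?_ ?_ (h 0)
    · rw [hy, mul_right_comm]; rfl
    · rw [ht]
      exact h 1

end LocalTest

end DiophantineCurves

/-! ### Abelian groups with a known number of classes modulo two -/

namespace DiophantineCurves

section Groups

variable {G : Type*} [AddCommGroup G]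

/-- A subgroup has index at most the number of kinds into which the elements of the group fall, when
the difference of any two elements of the same kind lies in the subgroup. -/
theorem finite_and_card_quotient_le {D : Type*} [Finite D] {H : AddSubgroup G}
    (rel : G → D → Prop) (hrel : ∀ P, ∃ d, rel P d)
    (h : ∀ P Q d, rel P d → rel Q d → P - Q ∈ H) :
    Finite (G ⧸ H) ∧ Nat.card (G ⧸ H) ≤ Nat.card D := by
  choose f hf using hrel
  have hinj : Function.Injective fun q : G ⧸ H => f q.out := fun q q' hq => by
    rw [← q.out_eq', ← q'.out_eq', eq_comm, QuotientAddGroup.eq, ← sub_eq_neg_add]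
    exact h _ _ _ (hf _) (by
      have : f q.out = f q'.out := hq
      rw [this]; exact hf _)
  exact ⟨Finite.of_injective _ hinj, Nat.card_le_card_of_injective _ hinj⟩

/-- In a finitely generated abelian group, a subgroup on which multiplication by two is surjective
is killed by a positive integer. -/
theorem exists_nsmul_eq_zero_of_two_divisible [AddGroup.FG G] (H : AddSubgroup G)
    (hH : ∀ h ∈ H, ∃ h' ∈ H, h = 2 • h') : ∃ r : ℕ, r ≠ 0 ∧ ∀ h ∈ H, r • h = 0 := by
  have : Module.Finite ℤ G := Module.Finite.iff_addGroup_fg.2 inferInstance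
  obtain ⟨r, hr, hr'⟩ := Submodule.exists_sub_one_mem_and_smul_eq_zero_of_fg_of_le_smul
    (Ideal.span {(2 : ℤ)}) (AddSubgroup.toIntSubmodule H) (IsNoetherian.noetherian _) (by
      intro h hh
      obtain ⟨h', hh', rfl⟩ := hH h hh
      have := Submodule.smul_mem_smul (Ideal.mem_span_singleton_self (2 : ℤ))
        (show h' ∈ AddSubgroup.toIntSubmodule H from hh')
      rwa [ofNat_zsmul] at this)
  refine ⟨r.natAbs, fun h0 => ?_, fun h hh => ?_⟩
  · rw [Int.natAbs_eq_zero.1 h0, Ideal.mem_span_singleton] at hr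
    lia
  · have := hr' h hh
    rcases Int.natAbs_eq r with h1 | h1
    · rw [h1, natCast_zsmul] at this
      exact this
    · rw [h1, neg_smul, neg_eq_zero, natCast_zsmul] at this
      exact this

/-- Elements `P₁`, `P₂`, `T₁`, `T₂` which are independent modulo two, the last two of which generate
the elements of order two. -/
structure IsTwoBasis (P₁ P₂ T₁ T₂ : G) : Prop where
  two_nsmul_left : 2 • T₁ = 0
  two_nsmul_right : 2 • T₂ = 0
  exists_of_two_nsmul : ∀ P : G, 2 • P = 0 → ∃ c d : ℤ, P = c • T₁ + d • T₂
  even : ∀ c : Fin 4 → ℤ, (∃ Q : G, c 0 • P₁ + c 1 • P₂ + c 2 • T₁ + c 3 • T₂ = 2 • Q) →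
    ∀ i, Even (c i)

namespace IsTwoBasis

variable {P₁ P₂ T₁ T₂ : G} (h : IsTwoBasis P₁ P₂ T₁ T₂)
include h

/-- No combination of `P₁` and `P₂` is a combination of `T₁` and `T₂`, by infinite descent. -/
theorem eq_zero (m : ℕ) : ∀ a b c d : ℤ, a.natAbs + b.natAbs ≤ m →
    a • P₁ + b • P₂ = c • T₁ + d • T₂ → a = 0 ∧ b = 0 := by
  induction m with
  | zero => intro a b c d hm _; lia
  | succ m ih =>
    intro a b c d hm heq
    have hev := h.even ![a, b, -c, -d] ⟨0, by
      simp only [Matrix.cons_val]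
      rw [heq, neg_smul, neg_smul]
      abel⟩
    obtain ⟨a', ha'⟩ : Even a := hev 0
    obtain ⟨b', hb'⟩ : Even b := hev 1
    obtain ⟨c', hc'⟩ : Even (-c) := hev 2
    obtain ⟨d', hd'⟩ : Even (-d) := hev 3
    have hzero : 2 • (a' • P₁ + b' • P₂) = 0 := by
      have h1 : c • T₁ = -c' • (2 • T₁) := by
        rw [show c = -c' * 2 by lia, mul_smul, ofNat_zsmul]
      have h2 : d • T₂ = -d' • (2 • T₂) := by
        rw [show d = -d' * 2 by lia, mul_smul, ofNat_zsmul]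
      rw [h1, h2, h.two_nsmul_left, h.two_nsmul_right, smul_zero, smul_zero, add_zero,
        ha', hb'] at heq
      rw [← heq]
      simp only [add_smul, two_nsmul]
      abel
    obtain ⟨c'', d'', hcd⟩ := h.exists_of_two_nsmul _ hzero
    have := ih a' b' c'' d'' (by lia) hcd
    lia

theorem linearIndependent : LinearIndependent ℤ ![P₁, P₂] := by
  rw [LinearIndependent.pair_iff]
  intro s t hst
  exact h.eq_zero (s.natAbs + t.natAbs) s t 0 0 le_rfl (by simpa using hst)

/-- The rank is two when there are at most sixteen classes modulo two. -/
theorem rank_eq_two [AddGroup.FG G]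
    (hfin : Finite (G ⧸ (nsmulAddMonoidHom 2 : G →+ G).range))
    (hcard : Nat.card (G ⧸ (nsmulAddMonoidHom 2 : G →+ G).range) ≤ 16) :
    Module.rank ℤ G = 2 := by
  have : Module.Finite ℤ G := Module.Finite.iff_addGroup_fg.2 inferInstance
  set T := Submodule.torsion ℤ G
  have hrank : Module.finrank ℤ (G ⧸ T) = Module.finrank ℤ G := by
    rw [Module.finrank, rank_quotient_eq_of_le_torsion le_rfl]; rfl
  let e := Module.finBasis ℤ (G ⧸ T)
  set r := Module.finrank ℤ (G ⧸ T)
  choose g hg using fun i => Submodule.mkQ_surjective T (e i)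
  have hT : ∀ t : G, 2 • t = 0 → Submodule.mkQ T t = 0 := fun t ht => by
    rw [Submodule.mkQ_apply, Submodule.Quotient.mk_eq_zero]
    exact ⟨⟨2, by simp⟩, by
      change (2 : ℤ) • t = 0
      rw [ofNat_zsmul, ht]⟩
  let φ : (Fin r → ZMod 2) × (ZMod 2 × ZMod 2) → G := fun v =>
    (∑ i, ((v.1 i).val : ℤ) • g i) + ((v.2.1.val : ℤ) • T₁ + (v.2.2.val : ℤ) • T₂)
  have hval : ∀ a b : ZMod 2, Even ((a.val : ℤ) - b.val) → a = b := by decide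
  have hinj : Function.Injective fun v =>
      (QuotientAddGroup.mk (φ v) : G ⧸ (nsmulAddMonoidHom 2 : G →+ G).range) := by
    intro v v' hvv
    have hvv' := QuotientAddGroup.eq.1 hvv.symm
    obtain ⟨S, hS⟩ := hvv'
    have hS' : φ v - φ v' = 2 • S := by
      rw [sub_eq_neg_add]
      exact hS.symm
    have h1 : v.1 = v'.1 := by
      funext i
      apply hval
      have h3 := congrArg (fun z => e.repr (Submodule.mkQ T z) i) hS'
      have hφ : ∀ v, e.repr (Submodule.mkQ T (φ v)) i = ((v.1 i).val : ℤ) := fun v => by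
        simp only [φ]
        rw [map_add, map_add (Submodule.mkQ T), map_smul, map_smul, hT T₁ h.two_nsmul_left,
          hT T₂ h.two_nsmul_right, smul_zero, smul_zero, add_zero, add_zero, map_sum]
        simp_rw [map_smul, hg]
        exact e.repr_sum_self (fun i => ((v.1 i).val : ℤ)) ▸ rfl
      simp only [map_sub, Finsupp.coe_sub, Pi.sub_apply, hφ] at h3
      rw [h3, map_nsmul, map_nsmul]
      exact ⟨e.repr (Submodule.mkQ T S) i, by simp [two_mul]⟩
    have h2 := h.even ![0, 0, (v.2.1.val : ℤ) - v'.2.1.val, (v.2.2.val : ℤ) - v'.2.2.val]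
      ⟨S, by
        rw [← hS']
        simp only [φ, h1, Matrix.cons_val, sub_smul, zero_smul]
        abel⟩
    exact Prod.ext h1 (Prod.ext (hval _ _ (h2 2)) (hval _ _ (h2 3)))
  have hle := (Nat.card_le_card_of_injective _ hinj).trans hcard
  have hr : r ≤ 2 := by
    simp only [Nat.card_eq_fintype_card, Fintype.card_prod, Fintype.card_fun, ZMod.card,
      Fintype.card_fin] at hle
    by_contra! hr
    have := Nat.pow_le_pow_right (n := 2) (by norm_num) hr
    lia
  have hge := h.linearIndependent.fintype_card_le_finrank
  rw [Fintype.card_fin, ← hrank] at hge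
  rw [← Module.finrank_eq_rank, ← hrank, show r = 2 from le_antisymm hr hge]
  rfl

end IsTwoBasis

/-- An abelian group with at most twelve torsion elements, among them two of order two and one of
order three, has the torsion subgroup `ℤ/2 × ℤ/6`. -/
theorem nonempty_torsion_equiv [Finite (AddCommGroup.torsion G)]
    (hcard : Nat.card (AddCommGroup.torsion G) ≤ 12) {T₁ T₂ R : G} (h₁ : 2 • T₁ = 0)
    (h₂ : 2 • T₂ = 0) (hR : 3 • R = 0) (hR0 : R ≠ 0) (h₁0 : T₁ ≠ 0) (h₂0 : T₂ ≠ 0)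
    (h₁₂ : T₁ ≠ T₂) : Nonempty (AddCommGroup.torsion G ≃+ ZMod 2 × ZMod 6) := by
  set S := T₂ + R
  have hS : 6 • S = 0 := by
    have : 6 • S = 3 • (2 • T₂) + 2 • (3 • R) := by simp only [S]; abel
    rw [this, h₂, hR, smul_zero, smul_zero, add_zero]
  have memT : ∀ (n : ℕ) (P : G), n ≠ 0 → n • P = 0 → P ∈ AddCommGroup.torsion G :=
    fun n P hn h => isOfFinAddOrder_iff_nsmul_eq_zero.2 ⟨n, Nat.pos_of_ne_zero hn, h⟩
  let t₁ : AddCommGroup.torsion G := ⟨T₁, memT 2 _ two_ne_zero h₁⟩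
  let s : AddCommGroup.torsion G := ⟨S, memT 6 _ (by norm_num) hS⟩
  let f₁ : ZMod 2 →+ AddCommGroup.torsion G := ZMod.lift 2 ⟨zmultiplesHom _ t₁, by
    apply Subtype.ext
    simpa [t₁, ofNat_zsmul] using h₁⟩
  let f₂ : ZMod 6 →+ AddCommGroup.torsion G := ZMod.lift 6 ⟨zmultiplesHom _ s, by
    apply Subtype.ext
    simpa [s, ofNat_zsmul] using hS⟩
  let f : ZMod 2 × ZMod 6 →+ AddCommGroup.torsion G := f₁.coprod f₂
  have hf : ∀ (i j : ℕ), ((f (i, j) : AddCommGroup.torsion G) : G) = i • T₁ + j • S := by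
    intro i j
    have e₁ : f₁ i = i • t₁ := by
      have := ZMod.lift_coe 2 (⟨zmultiplesHom _ t₁, by
        apply Subtype.ext
        simpa [t₁, ofNat_zsmul] using h₁⟩ : {g : ℤ →+ AddCommGroup.torsion G // g (2 : ℕ) = 0}) i
      simpa using this
    have e₂ : f₂ j = j • s := by
      have := ZMod.lift_coe 6 (⟨zmultiplesHom _ s, by
        apply Subtype.ext
        simpa [s, ofNat_zsmul] using hS⟩ : {g : ℤ →+ AddCommGroup.torsion G // g (6 : ℕ) = 0}) j
      simpa using this
    simp only [f, AddMonoidHom.coprod_apply, e₁, e₂]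
    rfl
  have hinj : Function.Injective f := by
    rw [injective_iff_map_eq_zero]
    rintro ⟨x, y⟩ hxy
    have hxy' : x.val • T₁ + y.val • S = 0 := by
      rw [← hf, ZMod.natCast_zmod_val, ZMod.natCast_zmod_val, hxy]
      rfl
    have h3 : 3 • (x.val • T₁ + y.val • S) = x.val • T₁ + y.val • T₂ +
        x.val • (2 • T₁) + y.val • (2 • T₂) + y.val • (3 • R) := by
      simp only [S]
      module
    rw [hxy', h₁, h₂, hR] at h3
    simp only [smul_zero, add_zero] at h3
    have hyR : y.val • R = 0 := by
      have : x.val • T₁ + y.val • S = (x.val • T₁ + y.val • T₂) + y.val • R := by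
        simp only [S]
        module
      rw [hxy', ← h3, zero_add] at this
      exact this.symm
    have hmul : ∀ (m : ℕ) (P : G), 2 • P = 0 → m • P = (m % 2) • P := fun m P hP => by
      conv_lhs => rw [← Nat.mod_add_div m 2, add_smul, mul_comm, mul_smul, hP, smul_zero, add_zero]
    rw [hmul y.val T₂ h₂] at h3
    have hx : x.val = 0 := by
      have hx2 := ZMod.val_lt x
      by_contra hx0
      rw [show x.val = 1 by lia, one_smul] at h3
      rcases Nat.mod_two_eq_zero_or_one y.val with hy | hy
      · exact h₁0 (by simpa [hy] using h3.symm)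
      · rw [hy, one_smul] at h3
        apply h₁₂
        have h5 : T₁ - T₂ = (T₁ + T₂) - 2 • T₂ := by module
        rw [← sub_eq_zero, h5, ← h3, h₂, sub_zero]
    have hy : y.val = 0 := by
      have hy6 := ZMod.val_lt y
      rw [hx, zero_smul, zero_add] at h3
      have hy2 : y.val % 2 = 0 := by
        by_contra hy2
        rw [show y.val % 2 = 1 by lia, one_smul] at h3
        exact h₂0 h3.symm
      by_contra hy0
      apply hR0
      have h24 : y.val = 2 ∨ y.val = 4 := by lia
      rcases h24 with h24 | h24 <;> rw [h24] at hyR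
      · have : R = 3 • R - 2 • R := by module
        rw [this, hR, hyR, sub_zero]
      · have : R = 4 • R - 3 • R := by module
        rw [this, hR, hyR, sub_zero]
    exact Prod.ext ((ZMod.val_eq_zero x).1 hx) ((ZMod.val_eq_zero y).1 hy)
  have hbij : Function.Bijective f := by
    refine (Nat.bijective_iff_injective_and_card f).2 ⟨hinj, ?_⟩
    refine le_antisymm (Nat.card_le_card_of_injective f hinj) ?_
    simpa using hcard
  exact ⟨(AddEquiv.ofBijective f hbij).symm⟩

end Groups

end DiophantineCurves

/-! ### At most sixteen classes modulo two -/

namespace DiophantineCurves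

open Polynomial WeierstrassCurve.Affine WeierstrassCurve.Affine.Point

section TorsionPoints

variable {F : Type*} [Field F] [DecidableEq F] {M N : F}

omit [DecidableEq F] in
theorem IsSplit.nonsingular (hS : IsSplit M N) {x y : F} (h : y ^ 2 = x * (x + M) * (x + N)) :
    (twoTorsionCurve (M + N) (M * N)).toAffine.Nonsingular x y :=
  nonsingular_of_discr hS.discr_ne_zero (by rw [h]; ring)

omit [DecidableEq F] in
/-- The points of order two have the abscissas `0`, `-M` and `-N`. -/
theorem IsSplit.nonsingular_splitRoot (hS : IsSplit M N) (j : Fin 3) :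
    (twoTorsionCurve (M + N) (M * N)).toAffine.Nonsingular (splitRoot M N j) 0 :=
  nonsingular_of_discr hS.discr_ne_zero (by rw [splitRoot_isRoot, zero_pow two_ne_zero])

omit [DecidableEq F] in
theorem splitRoot_ne (hS : IsSplit M N) {i j : Fin 3} (h : i ≠ j) :
    splitRoot M N i ≠ splitRoot M N j := by
  have h1 := hS.left_ne
  have h2 := hS.right_ne
  have h3 := hS.ne
  fin_cases i <;> fin_cases j <;> simp_all [splitRoot, eq_comm]

theorem two_nsmul_splitRoot (h2 : (2 : F) ≠ 0) {j : Fin 3}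
    (h : (twoTorsionCurve (M + N) (M * N)).toAffine.Nonsingular (splitRoot M N j) 0) :
    2 • (some (splitRoot M N j) 0 h) = 0 := by
  rw [two_nsmul, some_add_self_eq_zero_iff h2]

theorem two_nsmul_eq_zero_cases (h2 : (2 : F) ≠ 0)
    {P : (twoTorsionCurve (M + N) (M * N)).toAffine.Point} (h : 2 • P = 0) :
    P = 0 ∨ ∃ j : Fin 3, ∃ h, P = some (splitRoot M N j) 0 h := by
  rcases split_cases P with h' | h' | ⟨x, y, h', hy, rfl⟩
  · exact Or.inl h'
  · exact Or.inr h'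
  · rw [two_nsmul, some_add_self_eq_zero_iff h2] at h
    exact absurd h hy

theorem IsSplit.splitRoot_add_add (hS : IsSplit M N) :
    some (splitRoot M N 0) 0 (hS.nonsingular_splitRoot 0) +
      some (splitRoot M N 1) 0 (hS.nonsingular_splitRoot 1) +
      some (splitRoot M N 2) 0 (hS.nonsingular_splitRoot 2) = 0 := by
  refine add_eq_zero_of_lineSection hS.two_ne (ℓ := 0) (n := 0) _ _ _ ⟨?_, ?_, ?_, ?_, ?_, ?_⟩ <;>
    (simp [splitRoot]; try ring)

/-- A curve `y² = x (x + M) (x + N)` with `M = a³ (a + 2 b)` and `N = b³ (b + 2 a)` has a point of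
order three. -/
theorem IsSplit.exists_three_nsmul (hS : IsSplit M N) {a b : F} (hM : M = a ^ 3 * (a + 2 * b))
    (hN : N = b ^ 3 * (b + 2 * a)) :
    ∃ R : (twoTorsionCurve (M + N) (M * N)).toAffine.Point, R ≠ 0 ∧ R + R + R = 0 := by
  have h : (twoTorsionCurve (M + N) (M * N)).toAffine.Nonsingular (a ^ 2 * b ^ 2)
      (a ^ 2 * b ^ 2 * (a + b) ^ 2) := hS.nonsingular (by rw [hM, hN]; ring)
  refine ⟨some _ _ h, some_ne_zero h, ?_⟩
  refine add_eq_zero_of_lineSection hS.two_ne (ℓ := a ^ 2 + a * b + b ^ 2) (n := a ^ 3 * b ^ 3)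
    h h h ⟨?_, ?_, ?_, ?_, ?_, ?_⟩ <;> (try rw [hM, hN]) <;> ring

/-- Modulo twice a point, every point has a non-vanishing second coordinate, when there is a point
of order three. -/
theorem IsSplit.exists_eq_some_add (hS : IsSplit M N)
    {R : (twoTorsionCurve (M + N) (M * N)).toAffine.Point} (hR0 : R ≠ 0) (hR : R + R + R = 0)
    (P : (twoTorsionCurve (M + N) (M * N)).toAffine.Point) :
    ∃ x y h S, y ≠ 0 ∧ P = some x y h + 2 • S := by
  by_cases hP : 2 • P = 0
  · -- `P = (P + R) + 2 R`, as `3 R = 0`, and the order of `P + R` does not divide two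
    have hPR : 2 • (P + R) ≠ 0 := fun h => hR0 <| by
      have : R = (R + R + R) - (2 • (P + R) - 2 • P) := by module
      rw [this, hR, h, hP, sub_zero, sub_zero]
    rcases hc : P + R with _ | ⟨x, y, h⟩
    · exact absurd (by rw [hc]; exact smul_zero 2) hPR
    · refine ⟨x, y, h, R, fun hy => hPR ?_, ?_⟩
      · rw [hc, two_nsmul, some_add_self_eq_zero_iff hS.two_ne]
        exact hy
      · have : P = (P + R) + 2 • R - (R + R + R) := by module
        rw [this, hR, sub_zero, hc]
  · rcases P with _ | ⟨x, y, h⟩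
    · exact absurd (smul_zero 2) hP
    · refine ⟨x, y, h, 0, fun hy => hP ?_, by rw [smul_zero, add_zero]⟩
      rw [two_nsmul, some_add_self_eq_zero_iff hS.two_ne]
      exact hy

end TorsionPoints

/-- The linear forms `rows` over the field with two elements have no common zero other than `0`. -/
def Detects {m : ℕ} (rows : List (Fin m → ZMod 2)) : Prop :=
  ∀ β : Fin m → ZMod 2, (∀ ρ ∈ rows, ∑ i, ρ i * β i = 0) → β = 0

/-- A criterion for `Detects`: every coordinate is a sum of the given linear forms. -/
theorem detects_of_combination {m : ℕ} {rows : List (Fin m → ZMod 2)}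
    (c : Fin m → List (Fin m → ZMod 2)) (hc : ∀ i, ∀ ρ ∈ c i, ρ ∈ rows)
    (h : ∀ i j, ((c i).map (fun ρ => ρ j)).sum = if i = j then 1 else 0) : Detects rows := by
  intro β hβ
  funext i
  have key : ∀ l : List (Fin m → ZMod 2), (∀ ρ ∈ l, ρ ∈ rows) →
      ∑ j, (l.map (fun ρ => ρ j)).sum * β j = 0 := by
    intro l hl
    induction l with
    | nil => simp
    | cons ρ l ih =>
      simp only [List.map_cons, List.sum_cons, add_mul, Finset.sum_add_distrib]
      rw [ih fun σ hσ => hl σ (List.mem_cons_of_mem _ hσ), hβ ρ (hl ρ List.mem_cons_self), add_zero]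
  have := key (c i) (hc i)
  simp only [h, ite_mul, one_mul, zero_mul, Finset.sum_ite_eq, Finset.mem_univ, if_true] at this
  exact this

theorem isUnit_int_polynomial {u : ℤ[X]} (h : IsUnit u) : u = 1 ∨ u = -1 := by
  obtain ⟨r, hr, rfl⟩ := Polynomial.isUnit_iff.1 h
  rcases Int.isUnit_iff.1 hr with rfl | rfl
  · exact Or.inl C_1
  · exact Or.inr (by rw [C_neg, C_1])

namespace FamilyData

variable {n : ℕ} (D : FamilyData n) (K : Type*) [Field K] [Algebra ℤ[X] K]

/-- The curve `y² = x (x + M) (x + N)` given by the data. -/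
noncomputable abbrev curve : WeierstrassCurve K :=
  twoTorsionCurve (algebraMap ℤ[X] K D.M + algebraMap ℤ[X] K D.N)
    (algebraMap ℤ[X] K D.M * algebraMap ℤ[X] K D.N)

/-- The linear form of a local test. -/
def testRow (T : LocalTest n) : Fin (n + 2) → ZMod 2 := fun i => legendreBit T.p (T.value D i)

/-- A coordinate as a linear form. -/
def bitRow (k : Fin (n + 2)) : Fin (n + 2) → ZMod 2 := fun i => if k = i then 1 else 0

variable {D K} [IsFractionRing ℤ[X] K]

/-- The exponents `β` describe the square classes of `x`, `x + M` and `x + N`. -/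
def HasClass (D : FamilyData n) (x : K) (β : Fin (n + 2) → ZMod 2) : Prop :=
  ∀ j : Fin 3, IsSquare ((![x, x + algebraMap ℤ[X] K D.M, x + algebraMap ℤ[X] K D.N] j) *
    algebraMap ℤ[X] K (classProd (withSigns D.F) (withSignTypes D.t) β j))

theorem Valid.exists_hasClass (hD : D.Valid) {x y : K}
    (h : (D.curve K).toAffine.Nonsingular x y) (hy : y ≠ 0) : ∃ β, D.HasClass x β :=
  exists_isSquare_mul_classProd (fun _ => isUnit_int_polynomial) hD.prime hD.not_dvd hD.prime_dvd_M
    hD.prime_dvd_N hD.prime_dvd_N_sub_M (split_equation h) hy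

theorem Valid.classProd_ne_zero (hD : D.Valid) (β : Fin (n + 2) → ZMod 2) (j : Fin 3) :
    algebraMap ℤ[X] K (classProd (withSigns D.F) (withSignTypes D.t) β j) ≠ 0 := by
  intro h
  replace h := (IsFractionRing.to_map_eq_zero_iff (K := K)).1 h
  rw [classProd, Finset.prod_eq_zero_iff] at h
  obtain ⟨i, -, hi⟩ := h
  have hne : withSigns D.F i ≠ 0 := by
    refine Fin.cases ?_ (fun i => Fin.cases ?_ (fun i => ?_) i) i
    · simp [withSigns]
    · simp [withSigns]
    · simpa [withSigns] using (hD.prime i).ne_zero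
  exact pow_ne_zero _ hne hi

variable [DecidableEq K]

theorem Valid.exists_three_nsmul (hD : D.Valid) :
    ∃ R : (D.curve K).toAffine.Point, R ≠ 0 ∧ R + R + R = 0 :=
  (hD.isSplit K).exists_three_nsmul (a := algebraMap ℤ[X] K D.a) (b := algebraMap ℤ[X] K D.b)
    (by simp only [M, map_mul, map_pow, map_add, map_ofNat])
    (by simp only [N, map_mul, map_pow, map_add, map_ofNat])

/-- There are at most sixteen classes modulo two, when the local tests determine the exponents of a
square class up to the four coordinates `idx`. -/
theorem Valid.card_quotient_le (hD : D.Valid) {Ts : List (LocalTest n)} (hTs : ∀ T ∈ Ts, T.Valid D)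
    (idx : Fin 4 → Fin (n + 2))
    (hdet : Detects (Ts.map D.testRow ++ List.ofFn (fun k => bitRow (idx k)))) :
    Finite ((D.curve K).toAffine.Point ⧸
        (nsmulAddMonoidHom 2 : (D.curve K).toAffine.Point →+ _).range)
      ∧ Nat.card ((D.curve K).toAffine.Point ⧸
        (nsmulAddMonoidHom 2 : (D.curve K).toAffine.Point →+ _).range) ≤ 16 := by
  obtain ⟨R, hR0, hR⟩ := hD.exists_three_nsmul (K := K)
  have hS := hD.isSplit K
  have h := finite_and_card_quotient_le (D := Fin 4 → ZMod 2)
    (H := (nsmulAddMonoidHom 2 : (D.curve K).toAffine.Point →+ _).range)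
    (fun P d => ∃ x y h S β, y ≠ 0 ∧ P = some x y h + 2 • S ∧ D.HasClass x β ∧
      ∀ k, β (idx k) = d k) (fun P => by
        obtain ⟨x, y, h, S, hy, hP⟩ := hS.exists_eq_some_add hR0 hR P
        obtain ⟨β, hβ⟩ := hD.exists_hasClass h hy
        exact ⟨fun k => β (idx k), x, y, h, S, β, hy, hP, hβ, fun k => rfl⟩) (by
      rintro P Q d ⟨x, y, h, S, β, hy, rfl, hβ, hd⟩ ⟨x', y', h', S', β', hy', rfl, hβ', hd'⟩
      have hββ : β - β' = 0 := by
        apply hdet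
        intro ρ hρ
        simp only [Pi.sub_apply, mul_sub, Finset.sum_sub_distrib]
        rcases List.mem_append.1 hρ with hρ | hρ
        · obtain ⟨T, hT, rfl⟩ := List.mem_map.1 hρ
          have h1 := (hTs T hT).sum_eq_zero hD hy (split_equation h) hβ
          have h2 := (hTs T hT).sum_eq_zero hD hy' (split_equation h') hβ'
          simp only [testRow, h1, h2, sub_zero]
        · obtain ⟨k, rfl⟩ := List.mem_ofFn.1 hρ
          simp [bitRow, hd, hd']
      rw [sub_eq_zero] at hββ
      subst hββ
      obtain ⟨U, hU⟩ := hS.exists_sub_eq_two_nsmul (some x y h) (some x' y' h') fun j => by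
        rw [descentMap_splitRoot h hy, descentMap_splitRoot h' hy']
        refine isSquare_mul_of_isSquare_mul (hD.classProd_ne_zero β j) (hβ j) ?_
        rw [mul_comm]
        exact hβ' j
      refine ⟨U + S - S', ?_⟩
      change 2 • (U + S - S') = _
      rw [smul_sub, smul_add, ← hU]
      abel)
  refine ⟨h.1, h.2.trans ?_⟩
  simp

end FamilyData

end DiophantineCurves

/-! ### Finite generation and torsion by specialization -/

namespace DiophantineCurves

open Polynomial WeierstrassCurve.Affine WeierstrassCurve.Affine.Point

section Reduction

theorem Place.goodReduction_of_isSplit {K k : Type*} [Field K] [Field k] {p : Place K k} {M N : K}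
    {m n : k} (hM : M ∈ p.ring) (hN : N ∈ p.ring) (hm : p.res M = m) (hn : p.res N = n)
    (hS : IsSplit m n) : p.GoodReduction (M + N) (M * N) (m + n) (m * n) where
  memA := add_mem hM hN
  memB := mul_mem hM hN
  resA := by rw [Place.res_add hM hN, hm, hn]
  resB := by rw [Place.res_mul hM hN, hm, hn]
  discr := hS.discr_ne_zero

variable {p : ℕ} [Fact p.Prime] {m n : ℤ}

theorem isSplit_rat_of_zmod (h : IsSplit (m : ZMod p) (n : ZMod p)) : IsSplit (m : ℚ) (n : ℚ) where
  two_ne := two_ne_zero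
  left_ne := fun h0 => h.left_ne (by rw [Int.cast_eq_zero.1 h0, Int.cast_zero])
  right_ne := fun h0 => h.right_ne (by rw [Int.cast_eq_zero.1 h0, Int.cast_zero])
  ne := fun h0 => h.ne (by rw [Int.cast_injective h0])

theorem goodReduction_modPlace (h : IsSplit (m : ZMod p) (n : ZMod p)) :
    (modPlace p).GoodReduction ((m : ℚ) + n) (m * n) ((m : ZMod p) + n) (m * n) := by
  have hker : ∀ x, Int.castRingHom (ZMod p) x = 0 ↔ (p : ℤ) ∣ x :=
    fun x => ZMod.intCast_zmod_eq_zero_iff_dvd x p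
  have hprime := Nat.prime_iff_prime_int.1 (Fact.out : p.Prime)
  have hmem := Place.algebraMap_mem_ofPrime (K := ℚ) hprime hker
  have hres := Place.res_ofPrime_algebraMap (K := ℚ) hprime hker
  exact Place.goodReduction_of_isSplit (hmem m) (hmem n) (hres m) (hres n) h

variable (p m n) in
/-- The curve `y² = x (x + m) (x + n)` has good reduction at `p`, and the reduced curve has twelve
points. -/
structure HasTwelvePoints : Prop where
  isSplit : IsSplit (m : ZMod p) (n : ZMod p)
  card_eq : Nat.card (twoTorsionCurve ((m : ZMod p) + n) (m * n)).toAffine.Point = 12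

theorem HasTwelvePoints.nsmul_eq_zero (h : HasTwelvePoints p m n)
    (P : (twoTorsionCurve ((m : ZMod p) + n) (m * n)).toAffine.Point) : 12 • P = 0 := by
  rw [← h.card_eq]
  exact card_nsmul_eq_zero'

/-- The points of `y² = x (x + M) (x + N)` over a finite field are the solutions and the point at
infinity. -/
theorem IsSplit.card_point {F : Type*} [Field F] [Fintype F] [DecidableEq F] {M N : F}
    (hS : IsSplit M N) : Nat.card (twoTorsionCurve (M + N) (M * N)).toAffine.Point =
      Fintype.card {v : F × F // v.2 ^ 2 = v.1 * (v.1 + M) * (v.1 + N)} + 1 := by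
  let e : (twoTorsionCurve (M + N) (M * N)).toAffine.Point ≃
      Option {v : F × F // v.2 ^ 2 = v.1 * (v.1 + M) * (v.1 + N)} :=
    { toFun := fun P => match P with
        | .zero => none
        | .some x y h => Option.some ⟨(x, y), split_equation h⟩
      invFun := fun v => match v with
        | none => 0
        | Option.some v => .some v.1.1 v.1.2 (hS.nonsingular v.2)
      left_inv := by rintro (_ | ⟨x, y, h⟩) <;> rfl
      right_inv := by rintro (_ | v) <;> rfl }
  rw [Nat.card_congr e, Nat.card_eq_fintype_card, Fintype.card_option]

/-- The torsion of `y² = x (x + m) (x + n)` over `ℚ` is killed by twelve when there are twelve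
points modulo two distinct primes. -/
theorem HasTwelvePoints.nsmul_eq_zero_of_nsmul_eq_zero {q : ℕ} [Fact q.Prime] (hpq : p ≠ q)
    (hp : HasTwelvePoints p m n) (hq : HasTwelvePoints q m n)
    {g : (twoTorsionCurve ((m : ℚ) + n) (m * n)).toAffine.Point} {r : ℕ} (hr : r ≠ 0)
    (hg : r • g = 0) : 12 • g = 0 := by
  have hgp := goodReduction_modPlace hp.isSplit
  have hgq := goodReduction_modPlace hq.isSplit
  have hredp : Place.reduce hgp (12 • g) = 0 := by rw [map_nsmul, hp.nsmul_eq_zero]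
  have hredq : Place.reduce hgq (12 • g) = 0 := by rw [map_nsmul, hq.nsmul_eq_zero]
  obtain ⟨a, s, hs, rfl⟩ := Nat.exists_eq_pow_mul_and_not_dvd hr p (Fact.out : p.Prime).ne_one
  -- the part prime to `p` is killed modulo `p`, and the power of `p` modulo `q`
  have h1 : p ^ a • 12 • g = 0 := by
    refine Place.eq_zero_of_nsmul_eq_zero hgp (n := s) ?_ ?_ ?_
    · rw [map_nsmul, hredp, smul_zero]
    · rwa [Ne, ZMod.natCast_eq_zero_iff]
    · rw [smul_smul, mul_comm s, smul_comm, hg, smul_zero]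
  refine Place.eq_zero_of_nsmul_eq_zero hgq hredq (n := p ^ a) ?_ h1
  rw [Nat.cast_pow]
  refine pow_ne_zero _ fun h0 => hpq ?_
  rw [ZMod.natCast_eq_zero_iff] at h0
  exact ((Nat.prime_dvd_prime_iff_eq Fact.out Fact.out).1 h0).symm

end Reduction

namespace FamilyData

variable {n : ℕ} (D : FamilyData n)

/-- The value of `M` at an integer. -/
def MVal (w : ℤ) : ℤ := listEval D.aList w ^ 3 * (listEval D.aList w + 2 * listEval D.bList w)

/-- The value of `N` at an integer. -/
def NVal (w : ℤ) : ℤ := listEval D.bList w ^ 3 * (listEval D.bList w + 2 * listEval D.aList w)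

theorem eval_M (w : ℤ) : D.M.eval w = D.MVal w := by
  simp [M, MVal, a, b, eval_ofList]

theorem eval_N (w : ℤ) : D.N.eval w = D.NVal w := by
  simp [N, NVal, a, b, eval_ofList]

/-- The linear form on exponents of square classes given by a prime number `p`, for points that
reduce to zero at `w₀`: the class of `x` is a square at `w₀`, since `x` has a pole there, and primes
of type `2` do not occur in it. -/
def poleRow (w₀ : ℤ) (p : ℕ) : Fin (n + 2) → ZMod 2 := fun i => legendreBit p
  (if withSignTypes D.t i = 2 then 1 else withSigns (fun i => listEval (D.f i) w₀) i)

/-- The conditions on the prime numbers used for `poleRow`. -/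
def IsPolePrime (w₀ : ℤ) (p : ℕ) : Prop := p.Prime ∧ 2 < p ∧
  ∀ i, ¬ (p : ℤ) ∣ (if withSignTypes D.t i = 2 then 1 else
    withSigns (fun i => listEval (D.f i) w₀) i)

variable {D} {K : Type*} [Field K] [Algebra ℤ[X] K] [IsFractionRing ℤ[X] K]

theorem algebraMap_mem_evalPlace (w : ℤ) (g : ℤ[X]) : algebraMap ℤ[X] K g ∈ (evalPlace K w).ring :=
  Place.algebraMap_mem_ofPrime _ _ g

theorem res_evalPlace (w : ℤ) (g : ℤ[X]) :
    (evalPlace K w).res (algebraMap ℤ[X] K g) = (g.eval w : ℤ) :=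
  Place.res_ofPrime_algebraMap _ _ g

variable (D K) in
theorem goodReduction_evalPlace {w : ℤ} (hw : IsSplit (D.MVal w : ℚ) (D.NVal w : ℚ)) :
    (evalPlace K w).GoodReduction (algebraMap ℤ[X] K D.M + algebraMap ℤ[X] K D.N)
      (algebraMap ℤ[X] K D.M * algebraMap ℤ[X] K D.N) ((D.MVal w : ℚ) + D.NVal w)
      (D.MVal w * D.NVal w) :=
  Place.goodReduction_of_isSplit (algebraMap_mem_evalPlace w _) (algebraMap_mem_evalPlace w _)
    (by rw [res_evalPlace, eval_M]) (by rw [res_evalPlace, eval_N]) hw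

/-- An element of the function field is finite at some place of an arithmetic progression, since it
has only finitely many poles. -/
theorem exists_mem_evalPlace (x : K) (w₀ : ℤ) {d : ℤ} (hd : d ≠ 0) :
    ∃ k : ℕ, x ∈ (evalPlace K (w₀ + d * k)).ring := by
  obtain ⟨a, b, hb, rfl⟩ := IsFractionRing.div_surjective (A := ℤ[X]) x
  have hb0 := nonZeroDivisors.ne_zero hb
  by_contra! hk
  apply hb0
  refine eq_zero_of_infinite_isRoot b (Set.Infinite.mono (s := Set.range fun k : ℕ => w₀ + d * k)
    ?_ (Set.infinite_range_of_injective fun k k' h => ?_))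
  · rintro _ ⟨k, rfl⟩
    by_contra h
    refine hk k ((Place.mem_ofPrime_iff _ _).2 ⟨a, b, ?_, rfl⟩)
    rw [evalRat_apply, Int.cast_ne_zero]
    exact h
  · have h' : d * k = d * k' := by simpa using h
    exact_mod_cast mul_left_cancel₀ hd h'

variable [DecidableEq K]

/-- The points that reduce to zero at `w₀` can be halved among themselves: the local tests and the
pole at `w₀` leave only the trivial square class. -/
theorem Valid.exists_half_of_reduce_eq_zero (hD : D.Valid) {Ts : List (LocalTest n)}
    (hTs : ∀ T ∈ Ts, T.Valid D) {w₀ : ℤ} (hw : IsSplit (D.MVal w₀ : ℚ) (D.NVal w₀ : ℚ))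
    {ps : List ℕ} (hps : ∀ p ∈ ps, D.IsPolePrime w₀ p)
    (hdet : Detects (Ts.map D.testRow ++ ps.map (D.poleRow w₀)))
    {Q : (D.curve K).toAffine.Point} (hQ : Place.reduce (D.goodReduction_evalPlace K hw) Q = 0) :
    ∃ S : (D.curve K).toAffine.Point,
      Place.reduce (D.goodReduction_evalPlace K hw) S = 0 ∧ Q = 2 • S := by
  have hS := hD.isSplit K
  set hg := D.goodReduction_evalPlace K hw
  obtain ⟨S, hQS⟩ : ∃ S, Q = 2 • S := by
    rcases Q with _ | ⟨x, y, h⟩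
    · exact ⟨0, (smul_zero 2).symm⟩
    have hx := Place.val_of_reduce_eq_zero hg hQ
    have hroot : ∀ j, splitRoot (algebraMap ℤ[X] K D.M) (algebraMap ℤ[X] K D.N) j ∈
        (evalPlace K w₀).ring := fun j => by
      fin_cases j
      · exact zero_mem _
      · exact neg_mem (algebraMap_mem_evalPlace w₀ _)
      · exact neg_mem (algebraMap_mem_evalPlace w₀ _)
    have hy : y ≠ 0 := by
      rintro rfl
      rcases split_cases (some x 0 h) with h0 | ⟨j, h', hj⟩ | ⟨x', y', h', hy', hj⟩
      · exact some_ne_zero h h0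
      · rw [some.injEq] at hj
        rw [hj.1, ← not_le, ← Place.mem_iff] at hx
        exact hx (hroot j)
      · rw [some.injEq] at hj
        exact hy' hj.2.symm
    obtain ⟨β, hβ⟩ := hD.exists_hasClass h hy
    have hβ0 : β = 0 := by
      apply hdet
      intro ρ hρ
      rcases List.mem_append.1 hρ with hρ | hρ
      · obtain ⟨T, hT, rfl⟩ := List.mem_map.1 hρ
        exact (hTs T hT).sum_eq_zero hD hy (split_equation h) hβ
      · obtain ⟨p, hp, rfl⟩ := List.mem_map.1 hρ
        obtain ⟨hpp, hp2, hpd⟩ := hps p hp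
        have : Fact p.Prime := ⟨hpp⟩
        refine sum_legendreBit_eq_zero hp2 Finset.univ _ β (fun i _ => hpd i) ?_
        have h1 := Place.isSquare_res_of_pole hx (algebraMap_mem_evalPlace w₀ D.M)
          (algebraMap_mem_evalPlace w₀ D.N) (algebraMap_mem_evalPlace w₀ _) (split_equation h)
          (hβ 0)
        rw [res_evalPlace, Rat.isSquare_intCast_iff] at h1
        have h2 := D.eval_classProd w₀ β 2
        rw [show exempt 2 = 0 from rfl] at h2
        rw [← h2]
        exact h1.map (Int.castRingHom (ZMod p))
    refine hS.exists_eq_two_nsmul _ fun j => ?_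
    rw [descentMap_splitRoot h hy]
    simpa [hβ0, classProd] using hβ j
  -- the half reduces to a point of order two, which lifts and can be subtracted
  have h2S : 2 • Place.reduce hg S = 0 := by rw [← map_nsmul, ← hQS, hQ]
  rcases two_nsmul_eq_zero_cases hw.two_ne h2S with h0 | ⟨j, h', hj⟩
  · exact ⟨S, h0, hQS⟩
  · have hmem : splitRoot (algebraMap ℤ[X] K D.M) (algebraMap ℤ[X] K D.N) j ∈
        (evalPlace K w₀).ring := by
      fin_cases j
      · exact zero_mem _
      · exact neg_mem (algebraMap_mem_evalPlace w₀ _)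
      · exact neg_mem (algebraMap_mem_evalPlace w₀ _)
    refine ⟨S - some _ 0 (hS.nonsingular_splitRoot j), ?_, ?_⟩
    · rw [map_sub, hj, Place.reduce_of_mem hg hmem, sub_eq_zero]
      refine some_congr ?_ Place.res_zero.symm
      fin_cases j
      · exact Place.res_zero.symm
      · change -_ = Place.res _ (-_)
        rw [Place.res_neg (algebraMap_mem_evalPlace w₀ _), res_evalPlace, eval_M]
      · change -_ = Place.res _ (-_)
        rw [Place.res_neg (algebraMap_mem_evalPlace w₀ _), res_evalPlace, eval_N]
    · rw [smul_sub, two_nsmul_splitRoot hS.two_ne, sub_zero, hQS]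

theorem cast_eval_add_mul (g : ℤ[X]) (p : ℕ) (w₀ d : ℤ) (k : ℕ) (hd : (p : ℤ) ∣ d) :
    ((g.eval (w₀ + d * k) : ℤ) : ZMod p) = (g.eval w₀ : ℤ) := by
  rw [← sub_eq_zero, ← Int.cast_sub, ZMod.intCast_zmod_eq_zero_iff_dvd]
  refine (hd.mul_right k).trans ?_
  have := sub_dvd_eval_sub (w₀ + d * k) w₀ g
  rwa [add_sub_cancel_left] at this

theorem hasTwelvePoints_add_mul {p : ℕ} [Fact p.Prime] {w₀ : ℤ}
    (h : HasTwelvePoints p (D.MVal w₀) (D.NVal w₀)) {d : ℤ} (hd : (p : ℤ) ∣ d) (k : ℕ) :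
    HasTwelvePoints p (D.MVal (w₀ + d * k)) (D.NVal (w₀ + d * k)) := by
  have h1 := cast_eval_add_mul D.M p w₀ d k hd
  have h2 := cast_eval_add_mul D.N p w₀ d k hd
  rw [eval_M, eval_M] at h1
  rw [eval_N, eval_N] at h2
  obtain ⟨h3, h4⟩ := h
  constructor
  · rwa [h1, h2]
  · rwa [h1, h2]

/-- The conditions at an integer `w₀` under which the specialization at `w₀` is injective: the
primes `ps` and the local tests detect the square classes of points that reduce to zero, and the
specialized curve has twelve points modulo `p` and modulo `q`. -/
structure Specializes (D : FamilyData n) (Ts : List (LocalTest n)) (w₀ : ℤ) (p q : ℕ)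
    [Fact p.Prime] [Fact q.Prime] (ps : List ℕ) : Prop where
  isPolePrime : ∀ l ∈ ps, D.IsPolePrime w₀ l
  detects : Detects (Ts.map D.testRow ++ ps.map (D.poleRow w₀))
  ne : p ≠ q
  left : HasTwelvePoints p (D.MVal w₀) (D.NVal w₀)
  right : HasTwelvePoints q (D.MVal w₀) (D.NVal w₀)

namespace Specializes

variable {Ts : List (LocalTest n)} {w₀ : ℤ} {p q : ℕ} [Fact p.Prime] [Fact q.Prime]
  {ps : List ℕ}

/-- Specialization at `w₀` is injective: the kernel is divisible by two, so that its image in every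
other specialization is a finitely generated group divisible by two, which is torsion and therefore
killed by twelve. -/
theorem reduce_injective (h : D.Specializes Ts w₀ p q ps) (hD : D.Valid)
    (hTs : ∀ T ∈ Ts, T.Valid D) :
    Function.Injective (Place.reduce
      (D.goodReduction_evalPlace K (isSplit_rat_of_zmod h.left.isSplit))) := by
  set hg := D.goodReduction_evalPlace K (isSplit_rat_of_zmod h.left.isSplit)
  rw [injective_iff_map_eq_zero]
  intro Q hQ
  refine Place.eq_zero_of_nsmul_eq_zero hg hQ (n := 12) (by norm_num) ?_
  -- the other specializations are taken at integers congruent to `w₀` modulo `p q`, where the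
  -- numbers of points modulo `p` and `q` are the same
  have hd : (p * q : ℤ) ≠ 0 :=
    mul_ne_zero (by exact_mod_cast (Fact.out : p.Prime).ne_zero)
      (by exact_mod_cast (Fact.out : q.Prime).ne_zero)
  have key : ∀ k : ℕ, ∃ hw : IsSplit (D.MVal (w₀ + p * q * k) : ℚ) (D.NVal (w₀ + p * q * k) : ℚ),
      Place.reduce (D.goodReduction_evalPlace K hw) (12 • Q) = 0 := by
    intro k
    have hp := hasTwelvePoints_add_mul h.left (Dvd.intro _ rfl : (p : ℤ) ∣ p * q) k
    have hq := hasTwelvePoints_add_mul h.right (Dvd.intro_left _ rfl : (q : ℤ) ∣ p * q) k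
    have hw := isSplit_rat_of_zmod hp.isSplit
    refine ⟨hw, ?_⟩
    have := rat_fg_of_isSplit hw
    set hg' := D.goodReduction_evalPlace K hw
    obtain ⟨r, hr, hr'⟩ := exists_nsmul_eq_zero_of_two_divisible
      ((Place.reduce hg).ker.map (Place.reduce hg')) (by
        rintro _ ⟨P, hP, rfl⟩
        obtain ⟨S, hS, rfl⟩ := hD.exists_half_of_reduce_eq_zero hTs
          (isSplit_rat_of_zmod h.left.isSplit) h.isPolePrime h.detects hP
        exact ⟨_, ⟨S, hS, rfl⟩, map_nsmul _ _ _⟩)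
    rw [map_nsmul]
    exact hp.nsmul_eq_zero_of_nsmul_eq_zero h.ne hq hr (hr' _ ⟨Q, hQ, rfl⟩)
  rcases hQ12 : 12 • Q with _ | ⟨x, y, hxy⟩
  · rfl
  · exfalso
    obtain ⟨k, hk⟩ := exists_mem_evalPlace x w₀ hd
    obtain ⟨hw, h0⟩ := key k
    rw [hQ12] at h0
    exact Place.notMem_of_reduce_eq_zero _ h0 hk

theorem fg (h : D.Specializes Ts w₀ p q ps) (hD : D.Valid) (hTs : ∀ T ∈ Ts, T.Valid D) :
    AddGroup.FG (D.curve K).toAffine.Point := by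
  have := rat_fg_of_isSplit (isSplit_rat_of_zmod h.left.isSplit)
  have h1 : Module.Finite ℤ (twoTorsionCurve ((D.MVal w₀ : ℚ) + D.NVal w₀)
      (D.MVal w₀ * D.NVal w₀)).toAffine.Point := Module.Finite.iff_addGroup_fg.2 this
  have := Module.Finite.of_injective
    (Place.reduce (D.goodReduction_evalPlace K
      (isSplit_rat_of_zmod h.left.isSplit))).toIntLinearMap (h.reduce_injective hD hTs)
  exact Module.Finite.iff_addGroup_fg.1 this

/-- There are at most twelve torsion points, since the torsion subgroup embeds in the group of
points modulo `p` of the curve at `w₀`. -/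
theorem card_torsion_le (h : D.Specializes Ts w₀ p q ps) (hD : D.Valid)
    (hTs : ∀ T ∈ Ts, T.Valid D) (hp : (12 : ZMod p) ≠ 0) :
    Finite (AddCommGroup.torsion (D.curve K).toAffine.Point) ∧
      Nat.card (AddCommGroup.torsion (D.curve K).toAffine.Point) ≤ 12 := by
  set hg := D.goodReduction_evalPlace K (isSplit_rat_of_zmod h.left.isSplit)
  have hgp := goodReduction_modPlace h.left.isSplit
  let φ : AddCommGroup.torsion (D.curve K).toAffine.Point →+ _ :=
    (Place.reduce hgp).comp ((Place.reduce hg).comp (AddSubgroup.subtype _))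
  have hinj : Function.Injective φ := by
    rw [injective_iff_map_eq_zero]
    rintro ⟨P, hP⟩ hφ
    obtain ⟨r, hr, hr'⟩ := isOfFinAddOrder_iff_nsmul_eq_zero.1 hP
    have h12 := h.left.nsmul_eq_zero_of_nsmul_eq_zero h.ne h.right hr.ne'
      (g := Place.reduce hg P) (by rw [← map_nsmul, hr', _root_.map_zero])
    have h0 := Place.eq_zero_of_nsmul_eq_zero hgp hφ (n := 12) (by simpa using hp) h12
    apply Subtype.ext
    apply h.reduce_injective hD hTs (K := K)
    rw [AddSubgroup.coe_zero, _root_.map_zero]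
    exact h0
  have hfin : Finite (twoTorsionCurve ((D.MVal w₀ : ZMod p) + D.NVal w₀)
      (D.MVal w₀ * D.NVal w₀)).toAffine.Point :=
    Nat.finite_of_card_ne_zero (by rw [h.left.card_eq]; norm_num)
  exact ⟨Finite.of_injective φ hinj, (Nat.card_le_card_of_injective φ hinj).trans h.left.card_eq.le⟩

end Specializes

end FamilyData

end DiophantineCurves

/-! ### Independent points -/

namespace DiophantineCurves

open Polynomial WeierstrassCurve.Affine WeierstrassCurve.Affine.Point

section DescentMap

variable {F : Type*} [Field F] [DecidableEq F] {A B e : F}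

theorem isSquare_descentMap_add_mul (he : e ^ 3 + A * e ^ 2 + B * e = 0)
    (hc : 3 * e ^ 2 + 2 * A * e + B ≠ 0) {P Q : (twoTorsionCurve A B).toAffine.Point} {d d' : F}
    (hP : IsSquare (descentMap e P * d)) (hQ : IsSquare (descentMap e Q * d')) :
    IsSquare (descentMap e (P + Q) * (d * d')) := by
  apply Place.isSquare_of_mul_mul_self
    (mul_ne_zero (descentMap_ne_zero hc P) (descentMap_ne_zero hc Q))
  have h : descentMap e (P + Q) * (d * d') *
      (descentMap e P * descentMap e Q * (descentMap e P * descentMap e Q)) =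
      descentMap e P * d * (descentMap e Q * d') *
        (descentMap e P * descentMap e Q * descentMap e (P + Q)) := by ring
  rw [h]
  exact (hP.mul hQ).mul (isSquare_descentMap_add he hc P Q)

theorem isSquare_descentMap_two_nsmul (he : e ^ 3 + A * e ^ 2 + B * e = 0)
    (hc : 3 * e ^ 2 + 2 * A * e + B ≠ 0) (P : (twoTorsionCurve A B).toAffine.Point) :
    IsSquare (descentMap e (2 • P)) := by
  apply Place.isSquare_of_mul_mul_self (descentMap_ne_zero hc P)
  rw [two_nsmul, mul_comm]
  exact isSquare_descentMap_add he hc P P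

theorem isSquare_descentMap_zsmul_mul (he : e ^ 3 + A * e ^ 2 + B * e = 0)
    (hc : 3 * e ^ 2 + 2 * A * e + B ≠ 0) {P : (twoTorsionCurve A B).toAffine.Point} {d : F}
    (hP : IsSquare (descentMap e P * d)) (c : ℤ) :
    IsSquare (descentMap e (c • P) * d ^ (c : ZMod 2).val) := by
  rcases Int.even_or_odd' c with ⟨m, rfl | rfl⟩
  · have h : (2 * m) • P = 2 • m • P := by rw [mul_smul, ofNat_zsmul]
    have h0 : ((2 * m : ℤ) : ZMod 2) = 0 := by
      rw [Int.cast_mul, show ((2 : ℤ) : ZMod 2) = 0 from rfl, zero_mul]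
    rw [h0, ZMod.val_zero, pow_zero, mul_one, h]
    exact isSquare_descentMap_two_nsmul he hc _
  · have h : (2 * m + 1) • P = 2 • m • P + P := by rw [add_smul, mul_smul, ofNat_zsmul, one_smul]
    have h0 : ((2 * m + 1 : ℤ) : ZMod 2) = 1 := by
      rw [Int.cast_add, Int.cast_mul, show ((2 : ℤ) : ZMod 2) = 0 from rfl, zero_mul, zero_add,
        Int.cast_one]
    rw [h0, ZMod.val_one, pow_one, h]
    have := isSquare_descentMap_add_mul he hc (d := 1)
      (by rw [mul_one]; exact isSquare_descentMap_two_nsmul he hc (m • P)) hP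
    rwa [one_mul] at this

end DescentMap

theorem isSquare_of_isSquare_algebraMap {R K : Type*} [CommRing R] [IsDomain R]
    [IsIntegrallyClosed R] [Field K] [Algebra R K] [IsFractionRing R K] {g : R}
    (h : IsSquare (algebraMap R K g)) : IsSquare g := by
  obtain ⟨t, ht⟩ := h
  obtain ⟨s, rfl⟩ := IsIntegrallyClosed.exists_algebraMap_eq_of_isIntegral_pow (R := R) (x := t)
    two_pos (by rw [pow_two, ← ht]; exact isIntegral_algebraMap)
  exact ⟨s, IsFractionRing.injective R K (by rw [ht, map_mul])⟩

namespace FamilyData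

variable {n : ℕ} (D : FamilyData n)

/-- The values at `r` of polynomials in the square classes of the `X`-coordinates of two points,
given by the lists `g₁` and `g₂`, and of the points of order two `(0, 0)` and `(-M, 0)`. -/
def classValue (g₁ g₂ : List ℤ) (r : ℤ) : Fin 4 → ℤ :=
  ![listEval g₁ r, listEval g₂ r,
    listEval D.aList r * listEval D.bList r * (listEval D.aList r + 2 * listEval D.bList r) *
      (listEval D.bList r + 2 * listEval D.aList r),
    -(listEval D.aList r * (listEval D.aList r + 2 * listEval D.bList r))]

/-- The polynomials with the values `classValue`. -/
noncomputable def classPoly (g₁ g₂ : List ℤ) : Fin 4 → ℤ[X] :=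
  ![ofList g₁, ofList g₂, D.a * D.b * (D.a + 2 * D.b) * (D.b + 2 * D.a), -(D.a * (D.a + 2 * D.b))]

theorem eval_classPoly (g₁ g₂ : List ℤ) (r : ℤ) (i : Fin 4) :
    (D.classPoly g₁ g₂ i).eval r = D.classValue g₁ g₂ r i := by
  fin_cases i <;> simp [classPoly, classValue, eval_ofList, a, b]

/-- Legendre symbols of values at integers `r` modulo primes `p` show that two points with the
square classes `g₁` and `g₂` and the points of order two are independent modulo two. -/
structure Separates (g₁ g₂ : List ℤ) (tests : List (ℤ × ℕ)) : Prop where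
  prime : ∀ v ∈ tests, v.2.Prime ∧ 2 < v.2
  not_dvd : ∀ v ∈ tests, ∀ i, ¬ (v.2 : ℤ) ∣ D.classValue g₁ g₂ v.1 i
  detects : Detects (tests.map fun v i => legendreBit v.2 (D.classValue g₁ g₂ v.1 i))

variable {D} {K : Type*} [Field K] [Algebra ℤ[X] K] [IsFractionRing ℤ[X] K] [DecidableEq K]

/-- When a combination of the four points is twice a point, the product of their square classes is
the square of a polynomial, so that the Legendre symbols of its values vanish. -/
theorem Separates.isTwoBasis (hD : D.Valid) {g₁ g₂ : List ℤ} {tests : List (ℤ × ℕ)}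
    (h : D.Separates g₁ g₂ tests) {x₁ y₁ x₂ y₂ : K} (h₁ : (D.curve K).toAffine.Nonsingular x₁ y₁)
    (h₂ : (D.curve K).toAffine.Nonsingular x₂ y₂) (hx₁ : x₁ ≠ 0) (hx₂ : x₂ ≠ 0)
    (hg₁ : IsSquare (x₁ * algebraMap ℤ[X] K (ofList g₁)))
    (hg₂ : IsSquare (x₂ * algebraMap ℤ[X] K (ofList g₂))) :
    IsTwoBasis (some x₁ y₁ h₁) (some x₂ y₂ h₂)
      (some _ 0 ((hD.isSplit K).nonsingular_splitRoot 0))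
      (some _ 0 ((hD.isSplit K).nonsingular_splitRoot 1)) := by
  have hS := hD.isSplit K
  refine ⟨two_nsmul_splitRoot hS.two_ne _, two_nsmul_splitRoot hS.two_ne _, fun P hP => ?_,
    fun c hc => ?_⟩
  · rcases two_nsmul_eq_zero_cases hS.two_ne hP with h0 | ⟨j, h', hj⟩
    · exact ⟨0, 0, by simp [h0]⟩
    · fin_cases j
      · exact ⟨1, 0, by simpa using hj⟩
      · exact ⟨0, 1, by simpa using hj⟩
      · refine ⟨-1, -1, ?_⟩
        rw [neg_one_smul, neg_one_smul, ← neg_add]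
        refine eq_neg_of_add_eq_zero_right ?_
        rw [hj]
        exact hS.splitRoot_add_add
  · obtain ⟨Q, hQ⟩ := hc
    set G := D.classPoly g₁ g₂
    set M := algebraMap ℤ[X] K D.M
    set N := algebraMap ℤ[X] K D.N
    have he := splitRoot_isRoot (M := M) (N := N) 0
    have hd := hS.deriv_ne_zero 0
    have e₁ : IsSquare (descentMap (splitRoot M N 0) (some x₁ y₁ h₁) *
        algebraMap ℤ[X] K (G 0)) := by
      rw [descentMap_some_of_ne (by simpa [splitRoot] using hx₁)]
      rw [show splitRoot M N 0 = 0 from rfl, sub_zero]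
      exact hg₁
    have e₂ : IsSquare (descentMap (splitRoot M N 0) (some x₂ y₂ h₂) *
        algebraMap ℤ[X] K (G 1)) := by
      rw [descentMap_some_of_ne (by simpa [splitRoot] using hx₂)]
      rw [show splitRoot M N 0 = 0 from rfl, sub_zero]
      exact hg₂
    have e₃ : IsSquare (descentMap (splitRoot M N 0) (some _ 0 (hS.nonsingular_splitRoot 0)) *
        algebraMap ℤ[X] K (G 2)) := by
      rw [descentMap_some_self]
      have hsq : IsSquare (D.M * D.N * G 2) :=
        ⟨D.a ^ 2 * D.b ^ 2 * (D.a + 2 * D.b) * (D.b + 2 * D.a), by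
          simp only [G, classPoly, FamilyData.M, FamilyData.N, Matrix.cons_val]
          ring⟩
      have := hsq.map (algebraMap ℤ[X] K)
      simpa [splitRoot, M, N] using this
    have e₄ : IsSquare (descentMap (splitRoot M N 0) (some _ 0 (hS.nonsingular_splitRoot 1)) *
        algebraMap ℤ[X] K (G 3)) := by
      rw [descentMap_some_of_ne (splitRoot_ne hS (by decide))]
      have hsq : IsSquare (-D.M * G 3) := ⟨D.a ^ 2 * (D.a + 2 * D.b), by
        simp only [G, classPoly, FamilyData.M, Matrix.cons_val]
        ring⟩
      have := hsq.map (algebraMap ℤ[X] K)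
      simpa [splitRoot, M, N] using this
    have key := isSquare_descentMap_add_mul he hd (isSquare_descentMap_add_mul he hd
      (isSquare_descentMap_add_mul he hd (isSquare_descentMap_zsmul_mul he hd e₁ (c 0))
        (isSquare_descentMap_zsmul_mul he hd e₂ (c 1)))
      (isSquare_descentMap_zsmul_mul he hd e₃ (c 2))) (isSquare_descentMap_zsmul_mul he hd e₄ (c 3))
    rw [hQ] at key
    have hsq : IsSquare (∏ i, G i ^ ((c i : ZMod 2)).val) := by
      apply isSquare_of_isSquare_algebraMap (K := K)
      have h1 := isSquare_mul_of_isSquare_mul (descentMap_ne_zero hd _)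
        (by rw [one_mul]; exact isSquare_descentMap_two_nsmul he hd Q) key
      rw [one_mul] at h1
      simpa [Fin.prod_univ_four] using h1
    have h0 : (fun i => (c i : ZMod 2)) = 0 := by
      apply h.detects
      intro ρ hρ
      obtain ⟨v, hv, rfl⟩ := List.mem_map.1 hρ
      obtain ⟨hp, hp2⟩ := h.prime v hv
      have : Fact v.2.Prime := ⟨hp⟩
      refine sum_legendreBit_eq_zero hp2 Finset.univ _ _ (fun i _ => h.not_dvd v hv i) ?_
      have h2 := (hsq.map (evalRingHom v.1)).map (Int.castRingHom (ZMod v.2))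
      rw [map_prod] at h2
      simp only [map_pow, coe_evalRingHom, G, eval_classPoly] at h2
      exact h2
    intro i
    rw [← ZMod.intCast_eq_zero_iff_even]
    exact congrFun h0 i

/-- The arithmetic of the curve given by the data: torsion subgroup, rank and independence of two
points. -/
theorem Valid.torsion_rank_independent (hD : D.Valid) {Ts : List (LocalTest n)}
    (hTs : ∀ T ∈ Ts, T.Valid D) (idx : Fin 4 → Fin (n + 2))
    (hdet : Detects (Ts.map D.testRow ++ List.ofFn (fun k => bitRow (idx k))))
    {w₀ : ℤ} {p q : ℕ} [Fact p.Prime] [Fact q.Prime] {ps : List ℕ}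
    (hw : D.Specializes Ts w₀ p q ps) (hp : (12 : ZMod p) ≠ 0)
    {g₁ g₂ : List ℤ} {tests : List (ℤ × ℕ)} (h : D.Separates g₁ g₂ tests)
    {x₁ y₁ x₂ y₂ : K} (h₁ : (D.curve K).toAffine.Nonsingular x₁ y₁)
    (h₂ : (D.curve K).toAffine.Nonsingular x₂ y₂) (hx₁ : x₁ ≠ 0) (hx₂ : x₂ ≠ 0)
    (hg₁ : IsSquare (x₁ * algebraMap ℤ[X] K (ofList g₁)))
    (hg₂ : IsSquare (x₂ * algebraMap ℤ[X] K (ofList g₂))) :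
    Nonempty (AddCommGroup.torsion (D.curve K).toAffine.Point ≃+ ZMod 2 × ZMod 6) ∧
      Module.rank ℤ (D.curve K).toAffine.Point = 2 ∧
      LinearIndependent ℤ ![some x₁ y₁ h₁, some x₂ y₂ h₂] := by
  have hS := hD.isSplit K
  have := hw.fg hD hTs (K := K)
  obtain ⟨hfin, hcard⟩ := hw.card_torsion_le hD hTs hp (K := K)
  obtain ⟨hfin', hcard'⟩ := hD.card_quotient_le hTs idx hdet (K := K)
  have hB := h.isTwoBasis hD h₁ h₂ hx₁ hx₂ hg₁ hg₂
  obtain ⟨R, hR0, hR⟩ := hD.exists_three_nsmul (K := K)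
  refine ⟨nonempty_torsion_equiv hcard hB.two_nsmul_left hB.two_nsmul_right
    (by rw [← hR]; module) hR0 (some_ne_zero _) (some_ne_zero _) fun heq => ?_,
    hB.rank_eq_two hfin' hcard', hB.linearIndependent⟩
  rw [some.injEq] at heq
  exact splitRoot_ne hS (by decide) heq.1

end FamilyData

end DiophantineCurves

/-! ### The curve induced by a triple -/

namespace DiophantineCurves

open WeierstrassCurve.Affine WeierstrassCurve.Affine.Point

section Induced

variable {F : Type*} [Field F] {q : Fin 3 → F} {u A B : F}

/-- The substitution `X = u² x - q₀ q₁`, `Y = u³ y` transforms the curve induced by `q` to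
`y² = x³ + A x² + B x`. -/
structure IsSubstitution (q : Fin 3 → F) (u A B : F) : Prop where
  ne_zero : u ≠ 0
  mul_A : u ^ 2 * A = q 0 * q 2 + q 1 * q 2 - 2 * (q 0 * q 1)
  mul_B : u ^ 4 * B = (q 0 * q 2 - q 0 * q 1) * (q 1 * q 2 - q 0 * q 1)

namespace IsSubstitution

variable (h : IsSubstitution q u A B)
include h

theorem smul_eq : (⟨Units.mk0 u h.ne_zero, -(q 0 * q 1), 0, 0⟩ :
    WeierstrassCurve.VariableChange F) • inducedCurve q = twoTorsionCurve A B := by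
  have hu := h.ne_zero
  have hA : A = (q 0 * q 2 + q 1 * q 2 - 2 * (q 0 * q 1)) / u ^ 2 := by
    rw [← h.mul_A]; field_simp
  have hB : B = (q 0 * q 2 - q 0 * q 1) * (q 1 * q 2 - q 0 * q 1) / u ^ 4 := by
    rw [← h.mul_B]; field_simp
  ext
  · simp [WeierstrassCurve.variableChange_a₁, inducedCurve, twoTorsionCurve]
  · simp only [WeierstrassCurve.variableChange_a₂, inducedCurve, twoTorsionCurve, hA,
      Units.val_inv_eq_inv_val, Units.val_mk0]
    field_simp
    ring
  · simp [WeierstrassCurve.variableChange_a₃, inducedCurve, twoTorsionCurve]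
  · simp only [WeierstrassCurve.variableChange_a₄, inducedCurve, twoTorsionCurve, hB,
      Units.val_inv_eq_inv_val, Units.val_mk0]
    field_simp
    ring
  · simp only [WeierstrassCurve.variableChange_a₆, inducedCurve, twoTorsionCurve,
      Units.val_inv_eq_inv_val, Units.val_mk0]
    ring

theorem isElliptic (hD : 2 * B * (A ^ 2 - 4 * B) ≠ 0) : (inducedCurve q).IsElliptic := by
  have hE := (twoTorsionCurve_isElliptic hD).isUnit
  rw [← h.smul_eq, WeierstrassCurve.variableChange_Δ] at hE
  exact ⟨isUnit_of_mul_isUnit_right hE⟩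

theorem equation_iff {x y : F} :
    (inducedCurve q).toAffine.Equation (u ^ 2 * x - q 0 * q 1) (u ^ 3 * y) ↔
      (twoTorsionCurve A B).toAffine.Equation x y := by
  rw [twoTorsionCurve_equation_iff, WeierstrassCurve.Affine.equation_iff,
    ← mul_right_inj' (pow_ne_zero 6 h.ne_zero) (b := y ^ 2)]
  simp only [inducedCurve]
  have hA := h.mul_A
  have hB := h.mul_B
  constructor <;> intro e
  · linear_combination e - (u ^ 4 * x ^ 2) * hA - u ^ 2 * x * hB
  · linear_combination e + (u ^ 4 * x ^ 2) * hA + u ^ 2 * x * hB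

variable (hD : 2 * B * (A ^ 2 - 4 * B) ≠ 0)
include hD

theorem nonsingular_iff {x y : F} :
    (inducedCurve q).toAffine.Nonsingular (u ^ 2 * x - q 0 * q 1) (u ^ 3 * y) ↔
      (twoTorsionCurve A B).toAffine.Nonsingular x y := by
  have := h.isElliptic hD
  have := twoTorsionCurve_isElliptic hD
  rw [← equation_iff_nonsingular, ← equation_iff_nonsingular, h.equation_iff]

theorem nonsingular_inv {x y : F} (hP : (inducedCurve q).toAffine.Nonsingular x y) :
    (twoTorsionCurve A B).toAffine.Nonsingular ((x + q 0 * q 1) / u ^ 2) (y / u ^ 3) := by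
  have hu := h.ne_zero
  rw [← h.nonsingular_iff hD]
  have e₁ : u ^ 2 * ((x + q 0 * q 1) / u ^ 2) - q 0 * q 1 = x := by field_simp; ring
  have e₂ : u ^ 3 * (y / u ^ 3) = y := by field_simp
  rwa [e₁, e₂]

/-- The substitution on points. -/
def pointEquiv : (twoTorsionCurve A B).toAffine.Point ≃ (inducedCurve q).toAffine.Point where
  toFun
    | .zero => .zero
    | .some x y hP => .some (u ^ 2 * x - q 0 * q 1) (u ^ 3 * y) ((h.nonsingular_iff hD).2 hP)
  invFun
    | .zero => .zero
    | .some x y hP => .some ((x + q 0 * q 1) / u ^ 2) (y / u ^ 3) (h.nonsingular_inv hD hP)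
  left_inv := by
    have hu := h.ne_zero
    rintro (_ | ⟨x, y, hP⟩)
    · rfl
    · simp only [some.injEq]
      constructor <;> field_simp
      ring
  right_inv := by
    have hu := h.ne_zero
    rintro (_ | ⟨x, y, hP⟩)
    · rfl
    · simp only [some.injEq]
      constructor <;> field_simp
      ring

variable [DecidableEq F]

omit hD in
theorem slope_eq (x₁ x₂ y₁ y₂ : F) :
    (inducedCurve q).toAffine.slope (u ^ 2 * x₁ - q 0 * q 1) (u ^ 2 * x₂ - q 0 * q 1)
      (u ^ 3 * y₁) (u ^ 3 * y₂) = u * (twoTorsionCurve A B).toAffine.slope x₁ x₂ y₁ y₂ := by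
  have hu := h.ne_zero
  have hx : u ^ 2 * x₁ - q 0 * q 1 = u ^ 2 * x₂ - q 0 * q 1 ↔ x₁ = x₂ := by
    rw [sub_left_inj, mul_right_inj' (pow_ne_zero 2 hu)]
  have hy : u ^ 3 * y₁ = -(u ^ 3 * y₂) ↔ y₁ = -y₂ := by
    rw [← mul_neg, mul_right_inj' (pow_ne_zero 3 hu)]
  simp only [WeierstrassCurve.Affine.slope, negY, inducedCurve, twoTorsionCurve, zero_mul, sub_zero,
    hx, hy]
  split_ifs with h₁ h₂
  · rw [mul_zero]
  · have hA : A = (q 0 * q 2 + q 1 * q 2 - 2 * (q 0 * q 1)) / u ^ 2 := by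
      rw [← h.mul_A]; field_simp
    have hB : B = (q 0 * q 2 - q 0 * q 1) * (q 1 * q 2 - q 0 * q 1) / u ^ 4 := by
      rw [← h.mul_B]; field_simp
    rw [sub_neg_eq_add, sub_neg_eq_add, ← mul_add (u ^ 3) y₁ y₁, mul_div_assoc', ← div_div, hA, hB]
    congr 1
    field_simp
    ring
  · rw [← mul_sub, sub_sub_sub_cancel_right, ← mul_sub]
    have := sub_ne_zero.2 h₁
    field_simp

/-- The substitution as an isomorphism of groups. -/
noncomputable def pointAddEquiv :
    (twoTorsionCurve A B).toAffine.Point ≃+ (inducedCurve q).toAffine.Point where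
  toEquiv := h.pointEquiv hD
  map_add' := by
    have hu := h.ne_zero
    rintro (_ | ⟨x₁, y₁, h₁⟩) (_ | ⟨x₂, y₂, h₂⟩)
    · rfl
    · exact (congrArg _ (zero_add _)).trans (zero_add _).symm
    · exact (congrArg _ (add_zero _)).trans (add_zero _).symm
    · have hiff : (u ^ 2 * x₁ - q 0 * q 1 = u ^ 2 * x₂ - q 0 * q 1 ∧
          u ^ 3 * y₁ = (inducedCurve q).toAffine.negY (u ^ 2 * x₂ - q 0 * q 1) (u ^ 3 * y₂)) ↔
          (x₁ = x₂ ∧ y₁ = (twoTorsionCurve A B).toAffine.negY x₂ y₂) := by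
        simp only [negY, inducedCurve, twoTorsionCurve, zero_mul, sub_zero]
        rw [sub_left_inj, mul_right_inj' (pow_ne_zero 2 hu), ← mul_neg,
          mul_right_inj' (pow_ne_zero 3 hu)]
      by_cases hxy : x₁ = x₂ ∧ y₁ = (twoTorsionCurve A B).toAffine.negY x₂ y₂
      · have e₁ : (some x₁ y₁ h₁ : (twoTorsionCurve A B).toAffine.Point) + some x₂ y₂ h₂ = 0 :=
          add_of_Y_eq hxy.1 hxy.2
        have e₂ : (some _ _ ((h.nonsingular_iff hD).2 h₁) : (inducedCurve q).toAffine.Point) +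
            some _ _ ((h.nonsingular_iff hD).2 h₂) = 0 :=
          add_of_Y_eq (hiff.2 hxy).1 (hiff.2 hxy).2
        exact (congrArg _ e₁).trans e₂.symm
      · refine (congrArg _ (add_some hxy)).trans (Eq.trans ?_ (add_some (mt hiff.1 hxy)).symm)
        have hA := h.mul_A
        have hX : u ^ 2 * (twoTorsionCurve A B).toAffine.addX x₁ x₂
            ((twoTorsionCurve A B).toAffine.slope x₁ x₂ y₁ y₂) - q 0 * q 1 =
            (inducedCurve q).toAffine.addX (u ^ 2 * x₁ - q 0 * q 1) (u ^ 2 * x₂ - q 0 * q 1)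
              (u * (twoTorsionCurve A B).toAffine.slope x₁ x₂ y₁ y₂) := by
          simp only [addX, inducedCurve, twoTorsionCurve]
          linear_combination -hA
        change some _ _ _ = some _ _ _
        rw [some.injEq, h.slope_eq]
        refine ⟨hX, ?_⟩
        simp only [addY, negAddY, ← hX]
        simp only [negY, inducedCurve, twoTorsionCurve]
        ring

end IsSubstitution

end Induced

theorem inducesRankTwoCurve_of_substitution {q : Fin 3 → RatFunc ℚ} {u A B x₁ y₁ x₂ y₂ : RatFunc ℚ}
    (hq : IsDiophantineTriple q) (h : IsSubstitution q u A B)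
    (hD : 2 * B * (A ^ 2 - 4 * B) ≠ 0)
    (h₁ : (twoTorsionCurve A B).toAffine.Nonsingular x₁ y₁)
    (h₂ : (twoTorsionCurve A B).toAffine.Nonsingular x₂ y₂)
    (htors : Nonempty
      (AddCommGroup.torsion (twoTorsionCurve A B).toAffine.Point ≃+ ZMod 2 × ZMod 6))
    (hrank : Module.rank ℤ (twoTorsionCurve A B).toAffine.Point = 2)
    (hind : LinearIndependent ℤ ![some x₁ y₁ h₁, some x₂ y₂ h₂]) :
    InducesRankTwoCurve q A B x₁ x₂ where
  isDiophantineTriple := hq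
  isElliptic := h.isElliptic hD
  exists_variableChange := ⟨_, h.smul_eq⟩
  torsion := by
    obtain ⟨e⟩ := htors
    let φ := h.pointAddEquiv hD
    refine ⟨AddEquiv.trans ?_ e⟩
    exact (
      { toFun := fun P => ⟨φ.symm P.1, φ.symm.toAddMonoidHom.isOfFinAddOrder P.2⟩
        invFun := fun P => ⟨φ P.1, φ.toAddMonoidHom.isOfFinAddOrder P.2⟩
        left_inv := fun P => Subtype.ext (φ.apply_symm_apply P.1)
        right_inv := fun P => Subtype.ext (φ.symm_apply_apply P.1)
        map_add' := fun P Q => Subtype.ext (map_add φ.symm P.1 Q.1) } :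
      AddCommGroup.torsion (inducedCurve q).toAffine.Point ≃+
        AddCommGroup.torsion (twoTorsionCurve A B).toAffine.Point)
  rank := by
    rw [← hrank]
    exact (LinearEquiv.rank_eq (h.pointAddEquiv hD).toIntLinearEquiv).symm
  independent := ⟨y₁, y₂, h₁, h₂, hind⟩

end DiophantineCurves

/-! ### Decidable forms of the conditions -/

namespace DiophantineCurves

open Polynomial

section Decidable

variable {n : ℕ} (D : FamilyData n)

instance (pts : List ℤ) : Decidable (D.Consistent pts) :=
  decidable_of_iff ((∀ i ∈ D.fa ++ D.fa2b, D.t i = 0) ∧ (∀ i ∈ D.fb ++ D.fb2a, D.t i = 1) ∧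
    (∀ i ∈ D.fab ++ D.fba, D.t i = 2) ∧
    D.listProd D.fa2b = listAdd D.aList (D.bList.map (2 * ·)) ∧
    D.listProd D.fb2a = listAdd D.bList (D.aList.map (2 * ·)) ∧
    D.listProd D.fab = listAdd D.aList D.bList ∧
    D.listProd D.fba = listAdd D.bList (D.aList.map (-1 * ·)) ∧
    ∀ i j, i ≠ j → ∃ e ∈ pts, ¬ listEval (D.f i) e ∣ listEval (D.f j) e)
    ⟨fun ⟨h₁, h₂, h₃, h₄, h₅, h₆, h₇, h₈⟩ => ⟨h₁, h₂, h₃, h₄, h₅, h₆, h₇, h₈⟩,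
      fun ⟨h₁, h₂, h₃, h₄, h₅, h₆, h₇, h₈⟩ => ⟨h₁, h₂, h₃, h₄, h₅, h₆, h₇, h₈⟩⟩

instance (T : LocalTest n) (s s' : List ℤ) : Decidable (T.Consistent D s s') :=
  decidable_of_iff (3 < T.p ∧ (T.p : ℤ) ∣ listEval (D.f T.i) T.r ∧
    ¬ (T.p : ℤ) ∣ listDerivEval (D.f T.i) T.r ∧ (∀ i, ¬ (T.p : ℤ) ∣ T.value D i) ∧
    ¬ (T.p : ℤ) ∣ listEval s' T.r ∧ (T.simple = false → s = listMul (D.f T.i) T.c) ∧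
    (T.simple = true → listAdd s (s'.map (2 * ·)) = listMul (D.f T.i) T.c) ∧
    (T.simple = true → ¬ (T.p : ℤ) ∣ listEval s T.r ∧ ¬ (T.p : ℤ) ∣ listEval T.c T.r))
    ⟨fun ⟨h₁, h₂, h₃, h₄, h₅, h₆, h₇, h₈⟩ => ⟨h₁, h₂, h₃, h₄, h₅, h₆, h₇, h₈⟩,
      fun ⟨h₁, h₂, h₃, h₄, h₅, h₆, h₇, h₈⟩ => ⟨h₁, h₂, h₃, h₄, h₅, h₆, h₇, h₈⟩⟩

instance (T : LocalTest n) : Decidable (T.Valid D) :=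
  inferInstanceAs (Decidable (T.p.Prime ∧ (D.t T.i = 0 ∧ T.Consistent D D.aList D.bList ∨
    D.t T.i = 1 ∧ T.Consistent D D.bList D.aList)))

instance (w₀ : ℤ) (p : ℕ) : Decidable (D.IsPolePrime w₀ p) :=
  inferInstanceAs (Decidable (p.Prime ∧ 2 < p ∧
    ∀ i, ¬ (p : ℤ) ∣ (if withSignTypes D.t i = 2 then 1 else
      withSigns (fun i => listEval (D.f i) w₀) i)))

end Decidable

instance : Fact (Nat.Prime 11) := ⟨by norm_num⟩

instance : Fact (Nat.Prime 13) := ⟨by norm_num⟩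

/-- The number of solutions modulo `p` decides whether there are twelve points. -/
theorem hasTwelvePoints_of_card {p : ℕ} [Fact p.Prime] {m n : ℤ}
    (h : (2 : ZMod p) ≠ 0 ∧ (m : ZMod p) ≠ 0 ∧ (n : ZMod p) ≠ 0 ∧ (m : ZMod p) ≠ n)
    (hcard : Fintype.card {v : ZMod p × ZMod p // v.2 ^ 2 = v.1 * (v.1 + m) * (v.1 + n)} = 11) :
    HasTwelvePoints p m n where
  isSplit := ⟨h.1, h.2.1, h.2.2.1, h.2.2.2⟩
  card_eq := by rw [IsSplit.card_point ⟨h.1, h.2.1, h.2.2.1, h.2.2.2⟩, hcard]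

/-- A criterion for `Detects`: the `i`-th coordinate is the sum of the rows with the indices
`c i`. -/
theorem detects_of_indices {m : ℕ} {rows : List (Fin m → ZMod 2)} (c : Fin m → List ℕ)
    (hc : ∀ i, ∀ k ∈ c i, k < rows.length)
    (h : ∀ i j, ((c i).map (fun k => rows.getD k 0 j)).sum = if i = j then 1 else 0) :
    Detects rows :=
  detects_of_combination (fun i => (c i).map (fun k => rows.getD k 0))
    (fun i ρ hρ => by
      obtain ⟨k, hk, rfl⟩ := List.mem_map.1 hρ
      rw [List.getD_eq_getElem _ _ (hc i k hk)]
      exact List.getElem_mem _)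
    (fun i j => by rw [← h i j, List.map_map]; rfl)

/-- A prime number, or a polynomial to which the irreducibility criterion with the prime `p` and the
value at `e` applies. -/
def IsCertified (l : List ℤ) (p : ℕ) (e : ℤ) : Prop :=
  p.Prime ∧ (l = [(p : ℤ)] ∨ 2 ≤ l.length ∧ l.length ≤ 6 ∧
    l.foldr (fun a g => Nat.gcd a.natAbs g) 0 = 1 ∧ ((l.getD (l.length - 1) 0 : ℤ) : ZMod p) ≠ 0 ∧
    (l.length - 1 = 1 ∨ ∀ r < p, listEval (l.map (Int.cast : ℤ → ZMod p)) (r : ZMod p) ≠ 0) ∧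
    (l.length - 1 ≤ 3 ∨ listEval l e ≠ 0 ∧
      ∀ u < p, ∀ v < p,
        listRem (u : ZMod p) (v : ZMod p) (l.map (Int.cast : ℤ → ZMod p)) = (0, 0) →
        ∀ c ∈ (l.getD (l.length - 1) 0).natAbs.divisors, ∀ d ∈ (listEval l e).natAbs.divisors,
          (d : ZMod p) ≠ c * ((e : ZMod p) ^ 2 + u * e + v) ∧
          (d : ZMod p) ≠ -(c * ((e : ZMod p) ^ 2 + u * e + v))))

instance (l : List ℤ) (p : ℕ) (e : ℤ) : Decidable (IsCertified l p e) := by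
  unfold IsCertified
  infer_instance

theorem IsCertified.prime {l : List ℤ} {p : ℕ} {e : ℤ} (h : IsCertified l p e) :
    Prime (ofList l) := by
  obtain ⟨hp, rfl | ⟨hl2, hl6, hgcd, hlc, h1, h2⟩⟩ := h
  · exact prime_ofList_singleton hp
  · have : Fact p.Prime := ⟨hp⟩
    refine prime_ofList (n := l.length - 1) (by lia) (by lia) (by lia) hgcd p e hlc
      (h1.imp_right fun h r => ?_)
      (h2.imp_right fun h => ⟨h.1, fun u v => ?_⟩) hp
    · rw [← ZMod.natCast_zmod_val r]
      exact h _ (ZMod.val_lt r)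
    · rw [← ZMod.natCast_zmod_val u, ← ZMod.natCast_zmod_val v]
      exact h.2 _ (ZMod.val_lt u) _ (ZMod.val_lt v)

end DiophantineCurves

/-! ### The field `ℚ(w)` as the field of fractions of `ℤ[w]` -/

namespace DiophantineCurves

open Polynomial

/-- The inclusion of `ℤ[w]` in `ℚ(w)`. -/
noncomputable instance algebraIntRatFunc : Algebra ℤ[X] (RatFunc ℚ) :=
  ((algebraMap ℚ[X] (RatFunc ℚ)).comp (mapRingHom (Int.castRingHom ℚ))).toAlgebra

theorem algebraMap_int_ratFunc (g : ℤ[X]) : algebraMap ℤ[X] (RatFunc ℚ) g =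
    algebraMap ℚ[X] (RatFunc ℚ) (g.map (Int.castRingHom ℚ)) := rfl

instance isFractionRingIntRatFunc : IsFractionRing ℤ[X] (RatFunc ℚ) := by
  have hinj : Function.Injective (algebraMap ℤ[X] (RatFunc ℚ)) :=
    (RatFunc.algebraMap_injective ℚ).comp (map_injective _ Int.cast_injective)
  have : FaithfulSMul ℤ[X] (RatFunc ℚ) := (faithfulSMul_iff_algebraMap_injective _ _).2 hinj
  -- the denominators of the coefficients are cleared
  have hclear : ∀ g : ℚ[X], ∃ (b : ℤ) (g' : ℤ[X]), b ≠ 0 ∧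
      algebraMap ℤ[X] (RatFunc ℚ) g' = algebraMap ℤ[X] (RatFunc ℚ) (C b) *
        algebraMap ℚ[X] (RatFunc ℚ) g := by
    intro g
    obtain ⟨b, hb, h⟩ := IsLocalization.integerNormalization_spec (nonZeroDivisors ℤ) g
    refine ⟨b, IsLocalization.integerNormalization (nonZeroDivisors ℤ) g,
      nonZeroDivisors.ne_zero hb, ?_⟩
    rw [algebraMap_int_ratFunc, algebraMap_int_ratFunc, ← map_mul]
    congr 1
    refine h.trans ?_
    rw [map_C, ← smul_eq_C_mul]
    exact (Int.cast_smul_eq_zsmul ℚ b g).symm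
  refine IsFractionRing.of_field ℤ[X] (RatFunc ℚ) fun z => ?_
  obtain ⟨f, g, hg, rfl⟩ := IsFractionRing.div_surjective (A := ℚ[X]) z
  obtain ⟨b, f', hb, hf'⟩ := hclear f
  obtain ⟨c, g', hc, hg'⟩ := hclear g
  have hb' : algebraMap ℤ[X] (RatFunc ℚ) (C b) ≠ 0 := by
    rw [Ne, ← _root_.map_zero (algebraMap ℤ[X] (RatFunc ℚ)), hinj.eq_iff, C_eq_zero]
    exact hb
  have hc' : algebraMap ℤ[X] (RatFunc ℚ) (C c) ≠ 0 := by
    rw [Ne, ← _root_.map_zero (algebraMap ℤ[X] (RatFunc ℚ)), hinj.eq_iff, C_eq_zero]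
    exact hc
  have hg0 : algebraMap ℚ[X] (RatFunc ℚ) g ≠ 0 := by
    rw [Ne, ← _root_.map_zero (algebraMap ℚ[X] (RatFunc ℚ)),
      (RatFunc.algebraMap_injective ℚ).eq_iff]
    exact nonZeroDivisors.ne_zero hg
  refine ⟨C c * f', C b * g', ?_⟩
  rw [map_mul, map_mul, hf', hg']
  field_simp

theorem algebraMap_ofList (l : List ℤ) : algebraMap ℤ[X] (RatFunc ℚ) (ofList l) =
    listEval (l.map (Int.cast : ℤ → RatFunc ℚ)) RatFunc.X := by
  induction l with
  | nil => simp [listEval]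
  | cons a l ih =>
    rw [ofList_cons, map_add, map_mul, ih]
    have h1 : algebraMap ℤ[X] (RatFunc ℚ) (C a) = (a : RatFunc ℚ) := by
      simp
    have h2 : algebraMap ℤ[X] (RatFunc ℚ) X = RatFunc.X := by
      rw [algebraMap_int_ratFunc, map_X, RatFunc.algebraMap_X]
    rw [h1, h2]
    rfl

theorem listEval_ratFunc_ne_zero {l : List ℤ} (e : ℤ) (h : listEval l e ≠ 0) :
    listEval (l.map (Int.cast : ℤ → RatFunc ℚ)) RatFunc.X ≠ 0 := by
  rw [← algebraMap_ofList, Ne, IsFractionRing.to_map_eq_zero_iff]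
  intro h0
  rw [← eval_ofList, h0, eval_zero] at h
  exact h rfl

end DiophantineCurves

/-! ### The first curve: square classes -/

namespace DiophantineCurves

/-- The data of the first curve. -/
def firstData : FamilyData 12 where
  f := ![[1, 1], [-2, 1], [2, 1], [-7, 1], [10, 0, 19, 6, 1], [-1, 1], [1, 2], [3, 1], [3],
    [47, 36, -7, -6, 2], [19, 12, 4, 0, 1], [-37, -36, 26, 12, -1]]
  t := ![0, 0, 0, 0, 0, 1, 1, 1, 1, 1, 2, 2]
  fa := [0, 1, 2, 3]
  fb := [5, 6, 7, 8]
  fa2b := [4]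
  fb2a := [9]
  fab := [10]
  fba := [11]

theorem firstData_valid : firstData.Valid where
  consistent := ⟨[-12, -1], by decide +kernel⟩
  prime := fun i => by
    have h : ∀ i, IsCertified (firstData.f i) (![3, 3, 3, 3, 11, 3, 3, 3, 3, 11, 7, 7] i)
        (![0, 0, 0, 0, -6, 0, 0, 0, 0, 3, -4, 0] i) := by
      decide +kernel
    exact (h i).prime

/-- The local tests for the first curve: at roots modulo primes of prime factors of `a` and `b`,
and, for the simple ones, of `a + 2 b` and `b + 2 a`. -/
def firstTests : List (LocalTest 12) :=
  [⟨0, false, 5, 4, [28, -4, -7, 1]⟩,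
    ⟨0, false, 7, 6, [28, -4, -7, 1]⟩,
    ⟨0, false, 13, 12, [28, -4, -7, 1]⟩,
    ⟨1, false, 11, 2, [-14, -19, -4, 1]⟩,
    ⟨5, false, 5, 1, [9, 21, 6]⟩,
    ⟨5, false, 7, 1, [9, 21, 6]⟩,
    ⟨5, false, 13, 1, [9, 21, 6]⟩,
    ⟨6, false, 7, 3, [-9, 6, 3]⟩,
    ⟨4, true, 31, 5, [1]⟩,
    ⟨4, true, 53, 3, [1]⟩]

theorem firstTests_valid : ∀ T ∈ firstTests, T.Valid firstData := by decide +kernel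

/-- The coordinates of the exponents of square classes that the local tests leave free. -/
def firstIdx : Fin 4 → Fin 14 := ![5, 11, 12, 13]

/-- Each coordinate is a sum of the linear forms with the given indices, where the four free
coordinates come after the tests. -/
theorem firstTests_detects : Detects (firstTests.map firstData.testRow ++
    List.ofFn fun k => FamilyData.bitRow (firstIdx k)) :=
  detects_of_indices
    ![[3, 4, 6, 7, 13], [4, 6, 7, 13], [6, 10], [5, 7, 10], [4, 6, 10], [10],
      [0, 1, 2, 8, 9, 11, 12], [1, 8, 11], [0, 2, 3, 8, 11], [1, 2, 8, 11], [0, 2, 11, 12, 13],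
      [11], [12], [13]]
    (by decide +kernel) (by decide +kernel)

theorem firstData_specializes : firstData.Specializes firstTests 3 11 13 [11, 13, 29, 31] where
  isPolePrime := by decide +kernel
  detects := detects_of_indices
    ![[4, 6, 10, 11], [3, 4, 6, 10, 11], [2, 3, 4, 7, 9, 13], [2, 3, 4, 5, 6, 9, 13],
      [2, 3, 7, 9, 13], [2, 3, 4, 6, 7, 9, 13], [0, 2, 3, 8, 10, 12, 13],
      [1, 3, 7, 8, 9, 10, 11, 12], [0, 2, 7, 8, 9, 10, 11, 12], [1, 2, 3, 7, 8, 9, 10, 11, 12],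
      [0, 1, 2, 7, 9, 11, 12, 13], [3, 7, 9, 10, 11, 12], [1, 7, 11, 13], [3, 7, 10, 11]]
    (by decide +kernel) (by decide +kernel)
  ne := by norm_num
  left := hasTwelvePoints_of_card (by decide +kernel) (by decide +kernel)
  right := hasTwelvePoints_of_card (by decide +kernel) (by decide +kernel)

/-- The polynomial `-3`, in the square class of the `X`-coordinate of the first point. -/
def firstClass₁ : List ℤ := [-3]

/-- The polynomial `-(b / 3) (a + 2 b) (b + 2 a)`, in the square class of the `X`-coordinate of the
second point. -/
def firstClass₂ : List ℤ := [1410, 2960, 1559, 3270, -761, -5936, -3057, 298, 295, -12, -22, -4]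

theorem firstData_separates : firstData.Separates firstClass₁ firstClass₂
    [(0, 11), (0, 13), (3, 13), (3, 29)] where
  prime := by decide +kernel
  not_dvd := by decide +kernel
  detects := detects_of_indices ![[0, 1, 2], [0, 3], [2], [0, 1, 3]]
    (by decide +kernel) (by decide +kernel)

end DiophantineCurves

/-! ### The second curve: square classes -/

namespace DiophantineCurves

/-- The data of the second curve. -/
def secondData : FamilyData 10 where
  f := ![[1, -6, 1], [-2, 0, 1], [16, -36, 17, 6, 1], [-1, 1], [-1, 2], [3, 1], [3],
    [5, 0, 7, -6, 2], [7, -12, 8, 0, 1], [11, -36, 10, 12, -1]]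
  t := ![0, 0, 0, 1, 1, 1, 1, 1, 2, 2]
  fa := [0, 1]
  fb := [3, 4, 5, 6]
  fa2b := [2]
  fb2a := [7]
  fab := [8]
  fba := [9]

theorem secondData_valid : secondData.Valid where
  consistent := ⟨[-8, 0], by decide +kernel⟩
  prime := fun i => by
    have h : ∀ i, IsCertified (secondData.f i) (![3, 3, 11, 3, 3, 3, 3, 11, 5, 5] i)
        (![0, 0, 1, 0, 0, 0, 0, 0, 2, 0] i) := by
      decide +kernel
    exact (h i).prime

/-- The local tests for the second curve: at roots modulo primes of prime factors of `a` and `b`,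
and, for the simple ones, of `a + 2 b` and `b + 2 a`. -/
def secondTests : List (LocalTest 10) :=
  [⟨0, false, 7, 2, [-2, 0, 1]⟩,
    ⟨0, false, 17, 8, [-2, 0, 1]⟩,
    ⟨0, false, 17, 15, [-2, 0, 1]⟩,
    ⟨0, false, 23, 13, [-2, 0, 1]⟩,
    ⟨3, false, 7, 1, [-9, 15, 6]⟩,
    ⟨4, false, 5, 3, [-9, 6, 3]⟩,
    ⟨2, true, 19, 2, [1]⟩,
    ⟨7, true, 17, 2, [1]⟩]

theorem secondTests_valid : ∀ T ∈ secondTests, T.Valid secondData := by decide +kernel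

/-- The coordinates of the exponents of square classes that the local tests leave free. -/
def secondIdx : Fin 4 → Fin 12 := ![4, 9, 10, 11]

/-- Each coordinate is a sum of the linear forms with the given indices, where the four free
coordinates come after the tests. -/
theorem secondTests_detects : Detects (secondTests.map secondData.testRow ++
    List.ofFn fun k => FamilyData.bitRow (secondIdx k)) :=
  detects_of_indices
    ![[3, 4, 5, 11], [4, 5, 11], [7, 9, 10], [5, 7, 9, 10], [8], [2, 3, 6, 9], [0, 1, 2, 6, 9],
      [0, 6, 9], [0, 1, 2, 3, 9, 10, 11], [9], [10], [11]]
    (by decide +kernel) (by decide +kernel)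

theorem secondData_specializes : secondData.Specializes secondTests 2 11 13 [11, 13, 23, 43] where
  isPolePrime := by decide +kernel
  detects := detects_of_indices
    ![[4, 6, 7, 10, 11], [3, 4, 6, 7, 10, 11], [0, 4, 7, 8, 9, 10, 11],
      [0, 4, 5, 7, 8, 9, 10, 11], [0, 4, 7, 11], [2, 3, 4, 5, 7, 9, 11],
      [0, 1, 2, 4, 5, 7, 9, 11], [0, 4, 5, 7, 9, 11], [1, 2, 4, 5, 6, 7, 8, 9],
      [4, 5, 6, 7, 9, 11], [0, 5, 6, 7, 8, 10], [3, 5, 6, 7, 10, 11]]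
    (by decide +kernel) (by decide +kernel)
  ne := by norm_num
  left := hasTwelvePoints_of_card (by decide +kernel) (by decide +kernel)
  right := hasTwelvePoints_of_card (by decide +kernel) (by decide +kernel)

/-- The polynomial `-3`, in the square class of the `X`-coordinate of the first point. -/
def secondClass₁ : List ℤ := [-3]

/-- The polynomial `-a (b / 3) (b + 2 a)`, in the square class of the `X`-coordinate of the second
point. -/
def secondClass₂ : List ℤ := [30, -260, 567, -510, 699, -748, -117, 574, -249, -12, 30, -4]

theorem secondData_separates : secondData.Separates secondClass₁ secondClass₂
    [(-2, 7), (-2, 11), (2, 11), (2, 13)] where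
  prime := by decide +kernel
  not_dvd := by decide +kernel
  detects := detects_of_indices ![[1, 3], [0, 1, 2, 3], [1, 2], [0, 1, 2]]
    (by decide +kernel) (by decide +kernel)

end DiophantineCurves

/-! ### The third curve: square classes -/

namespace DiophantineCurves

/-- The data of the third curve. -/
def thirdData : FamilyData 11 where
  f := ![[-2, 0, 1], [-14, -12, 1], [-44, -24, 56, 36, 1], [-1, 1], [1, 1], [3, 2], [2], [3],
    [10, 12, 2, 0, 1], [-8, 0, 20, 12, 1], [-64, -48, 52, 36, -1]]
  t := ![0, 0, 0, 1, 1, 1, 1, 1, 1, 2, 2]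
  fa := [0, 1]
  fb := [3, 4, 5, 6, 6, 7]
  fa2b := [2]
  fb2a := [6, 8]
  fab := [9]
  fba := [10]

theorem thirdData_valid : thirdData.Valid where
  consistent := ⟨[-5, 0], by decide +kernel⟩
  prime := fun i => by
    have h : ∀ i, IsCertified (thirdData.f i) (![3, 3, 7, 3, 3, 3, 2, 3, 7, 7, 7] i)
        (![0, 0, -1, 0, 0, 0, 0, 0, -3, -1, 3] i) := by
      decide +kernel
    exact (h i).prime

/-- The local tests for the third curve: at roots modulo primes of prime factors of `a` and `b`,
and, for the simple ones, of `a + 2 b` and `b + 2 a`. -/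
def thirdTests : List (LocalTest 11) :=
  [⟨0, false, 7, 3, [-14, -12, 1]⟩,
    ⟨0, false, 7, 4, [-14, -12, 1]⟩,
    ⟨0, false, 17, 6, [-14, -12, 1]⟩,
    ⟨1, false, 7, 0, [-2, 0, 1]⟩,
    ⟨3, false, 7, 1, [36, 60, 24]⟩,
    ⟨5, false, 7, 2, [-12, 0, 12]⟩,
    ⟨2, true, 11, 0, [1]⟩,
    ⟨2, true, 61, 24, [1]⟩,
    ⟨8, true, 5, 0, [2]⟩]

theorem thirdTests_valid : ∀ T ∈ thirdTests, T.Valid thirdData := by decide +kernel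

/-- The coordinates of the exponents of square classes that the local tests leave free. -/
def thirdIdx : Fin 4 → Fin 13 := ![7, 10, 11, 12]

/-- Each coordinate is a sum of the linear forms with the given indices, where the four free
coordinates come after the tests. -/
theorem thirdTests_detects : Detects (thirdTests.map thirdData.testRow ++
    List.ofFn fun k => FamilyData.bitRow (thirdIdx k)) :=
  detects_of_indices
    ![[1, 2, 5, 12], [5, 12], [8, 10, 11], [4, 5, 8, 10, 11], [1, 2, 6, 7, 9, 12], [0, 3, 9],
      [1, 3, 9], [9], [0, 3, 7, 10], [0, 1, 2, 10, 11, 12], [10], [11], [12]]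
    (by decide +kernel) (by decide +kernel)

theorem thirdData_specializes : thirdData.Specializes thirdTests 2 11 13 [5, 11, 31, 41] where
  isPolePrime := by decide +kernel
  detects := detects_of_indices
    ![[1, 5, 7, 8, 9], [2, 5, 7, 8, 9], [4, 6, 7, 11, 12], [5, 6, 7, 11, 12],
      [5, 6, 7, 9, 10, 12], [0, 1, 3, 5, 7, 8, 10, 12], [3, 5, 7, 8, 10, 12],
      [1, 5, 7, 8, 10, 12], [4, 6, 7, 10], [0, 1, 4, 6, 9, 11, 12], [0, 3, 4, 6, 10],
      [0, 3, 7, 8, 10, 11, 12], [2, 7, 8, 9]]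
    (by decide +kernel) (by decide +kernel)
  ne := by norm_num
  left := hasTwelvePoints_of_card (by decide +kernel) (by decide +kernel)
  right := hasTwelvePoints_of_card (by decide +kernel) (by decide +kernel)

/-- The polynomial `3 a`, in the square class of the `X`-coordinate of the first point. -/
def thirdClass₁ : List ℤ := [84, 72, -48, -36, 3]

/-- The polynomial `-b / 4`, in the square class of the `X`-coordinate of the second point. -/
def thirdClass₂ : List ℤ := [9, 6, -9, -6]

theorem thirdData_separates : thirdData.Separates thirdClass₁ thirdClass₂
    [(-3, 5), (-3, 11), (2, 11), (-2, 13)] where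
  prime := by decide +kernel
  not_dvd := by decide +kernel
  detects := detects_of_indices ![[2, 3], [1, 3], [2], [0, 1, 3]]
    (by decide +kernel) (by decide +kernel)

end DiophantineCurves

/-! ### Triples and points in terms of `a` and `b` -/

namespace DiophantineCurves

section Identities

variable {F : Type*} [Field F] {q : Fin 3 → F} {a b s t m : F}

/-- The elements of the triple are distinct and non-zero because the discriminant does not vanish.
-/
theorem IsSubstitution.isDiophantineTriple {u A B : F} (h : IsSubstitution q u A B)
    (hD : 2 * B * (A ^ 2 - 4 * B) ≠ 0) (h₀₁ : IsSquare (q 0 * q 1 + 1))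
    (h₀₂ : IsSquare (q 0 * q 2 + 1)) (h₁₂ : IsSquare (q 1 * q 2 + 1)) : IsDiophantineTriple q := by
  have hA := h.mul_A
  have hB := h.mul_B
  have hdisc : u ^ 4 * (A ^ 2 - 4 * B) = (q 0 * q 2 - q 1 * q 2) ^ 2 := by
    linear_combination (u ^ 2 * A + (q 0 * q 2 + q 1 * q 2 - 2 * (q 0 * q 1))) * hA - 4 * hB
  have hB0 : (q 0 * q 2 - q 0 * q 1) * (q 1 * q 2 - q 0 * q 1) ≠ 0 := by
    rw [← hB]
    exact mul_ne_zero (pow_ne_zero _ h.ne_zero) (right_ne_zero_of_mul (left_ne_zero_of_mul hD))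
  have hdisc0 : (q 0 * q 2 - q 1 * q 2) ^ 2 ≠ 0 := by
    rw [← hdisc]
    exact mul_ne_zero (pow_ne_zero _ h.ne_zero) (right_ne_zero_of_mul hD)
  have n₀ : q 0 ≠ 0 := fun e => hB0 (by rw [e]; ring)
  have n₁ : q 1 ≠ 0 := fun e => hB0 (by rw [e]; ring)
  have n₂ : q 2 ≠ 0 := fun e => hdisc0 (by rw [e]; ring)
  have n₀₁ : q 0 ≠ q 1 := fun e => hdisc0 (by rw [e]; ring)
  have n₀₂ : q 0 ≠ q 2 := fun e => hB0 (by rw [e]; ring)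
  have n₁₂ : q 1 ≠ q 2 := fun e => hB0 (by rw [e]; ring)
  refine ⟨fun i j hij => ?_, fun i => ?_, fun i j hij => ?_⟩
  · fin_cases i <;> fin_cases j <;>
      first | rfl | exact absurd hij n₀₁ | exact absurd hij n₀₂ | exact absurd hij n₁₂ |
        exact absurd hij.symm n₀₁ | exact absurd hij.symm n₀₂ | exact absurd hij.symm n₁₂
  · fin_cases i
    · exact n₀
    · exact n₁
    · exact n₂
  · fin_cases i <;> fin_cases j <;>
      first | exact h₀₁ | exact h₀₂ | exact h₁₂ | exact absurd hij (by decide)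

/-! #### Triples with `q₀ q₁ = -3/4` -/

/-- The differences of the products `qᵢ qⱼ` are `a³ (a + 2 b)` and `b³ (b + 2 a)` divided by
`4 a² b²`. -/
theorem isSubstitution_of_mul_eq (h2 : (2 : F) ≠ 0) (ha : a ≠ 0) (hb : b ≠ 0)
    (h₀₁ : q 0 * q 1 = -3 / 4) (h₀₂ : q 0 * q 2 = (a - b) * (a + 3 * b) / (4 * b ^ 2))
    (h₁₂ : q 1 * q 2 = (b - a) * (b + 3 * a) / (4 * a ^ 2)) :
    IsSubstitution q (1 / (2 * a * b)) (a ^ 3 * (a + 2 * b) + b ^ 3 * (b + 2 * a))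
      (a ^ 3 * (a + 2 * b) * (b ^ 3 * (b + 2 * a))) := by
  have h4 : (4 : F) ≠ 0 := by
    rw [show (4 : F) = 2 * 2 by norm_num]; exact mul_ne_zero h2 h2
  refine ⟨div_ne_zero one_ne_zero (mul_ne_zero (mul_ne_zero h2 ha) hb), ?_, ?_⟩
  · rw [h₀₁, h₀₂, h₁₂]
    field_simp
    ring
  · rw [h₀₁, h₀₂, h₁₂]
    field_simp
    ring

/-- The products of a triple given by `a`, `b` with `a + 3 b = s²` and `b + 3 a = 3 t²`. The square
roots `s` and `t` occur in the triple, and not in the curve. -/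
theorem mul_eq_of_triple (h2 : (2 : F) ≠ 0) (ha : a ≠ 0) (hb : b ≠ 0) (hs : s ≠ 0) (ht : t ≠ 0)
    (hsq : s ^ 2 = a + 3 * b) (htq : 3 * t ^ 2 = b + 3 * a) (h₀ : q 0 = -(a * s) / (2 * b * t))
    (h₁ : q 1 = 3 * b * t / (2 * a * s)) (h₂ : q 2 = -(t * s * (a - b)) / (2 * a * b)) :
    q 0 * q 1 = -3 / 4 ∧ q 0 * q 2 = (a - b) * (a + 3 * b) / (4 * b ^ 2) ∧
      q 1 * q 2 = (b - a) * (b + 3 * a) / (4 * a ^ 2) := by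
  have h4 : (4 : F) ≠ 0 := by
    rw [show (4 : F) = 2 * 2 by norm_num]; exact mul_ne_zero h2 h2
  rw [h₀, h₁, h₂, ← hsq, ← htq]
  refine ⟨?_, ?_, ?_⟩ <;> field_simp <;> ring

theorem isSquare_of_mul_eq (h2 : (2 : F) ≠ 0) (ha : a ≠ 0) (hb : b ≠ 0)
    (h₀₁ : q 0 * q 1 = -3 / 4) (h₀₂ : q 0 * q 2 = (a - b) * (a + 3 * b) / (4 * b ^ 2))
    (h₁₂ : q 1 * q 2 = (b - a) * (b + 3 * a) / (4 * a ^ 2)) :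
    IsSquare (q 0 * q 1 + 1) ∧ IsSquare (q 0 * q 2 + 1) ∧ IsSquare (q 1 * q 2 + 1) := by
  have h4 : (4 : F) ≠ 0 := by
    rw [show (4 : F) = 2 * 2 by norm_num]; exact mul_ne_zero h2 h2
  refine ⟨⟨1 / 2, ?_⟩, ⟨(a + b) / (2 * b), ?_⟩, ⟨(a + b) / (2 * a), ?_⟩⟩
  · rw [h₀₁]; field_simp; ring
  · rw [h₀₂]; field_simp; ring
  · rw [h₁₂]; field_simp; ring

/-- The point with abscissa `-3 a² b²`. -/
theorem equation_x₁_of_mul_eq (hsq : s ^ 2 = a + 3 * b) (htq : 3 * t ^ 2 = b + 3 * a) :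
    (3 * a ^ 2 * b ^ 2 * (b - a) * s * t) ^ 2 = (-3 * a ^ 2 * b ^ 2) *
      (-3 * a ^ 2 * b ^ 2 + a ^ 3 * (a + 2 * b)) * (-3 * a ^ 2 * b ^ 2 + b ^ 3 * (b + 2 * a)) := by
  linear_combination (9 * a ^ 4 * b ^ 4 * (b - a) ^ 2 * t ^ 2) * hsq +
    (3 * a ^ 4 * b ^ 4 * (b - a) ^ 2 * (a + 3 * b)) * htq

/-- The additional point when `3 a + 4 b` is three times a square. -/
theorem equation_x₂_pole_s (h3 : (3 : F) ≠ 0) (hs : s ≠ 0) (hsq : s ^ 2 = a + 3 * b)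
    (hmq : 3 * m ^ 2 = 3 * a + 4 * b) {x y : F}
    (hx : x = -(4 / 3) * a ^ 2 * b * (a + 2 * b) * (b + 2 * a) / s ^ 2)
    (hy : y = 2 / 3 * a ^ 2 * b * (a + 2 * b) * (b + 2 * a) * (b - a) * m * (3 * b + 2 * a) /
      s ^ 3) :
    y ^ 2 = x * (x + a ^ 3 * (a + 2 * b)) * (x + b ^ 3 * (b + 2 * a)) := by
  have e₁ : x + a ^ 3 * (a + 2 * b) = -(a ^ 2 * (a + 2 * b) * (b - a) * m ^ 2) / s ^ 2 := by
    rw [hx, eq_div_iff (pow_ne_zero 2 hs), add_mul, div_mul_cancel₀ _ (pow_ne_zero 2 hs), hsq]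
    field_simp
    linear_combination (a ^ 2 * (a + 2 * b) * (b - a)) * hmq
  have e₂ : x + b ^ 3 * (b + 2 * a) =
      b * (b + 2 * a) * (b - a) * (3 * b + 2 * a) ^ 2 / (3 * s ^ 2) := by
    rw [hx, eq_div_iff (mul_ne_zero h3 (pow_ne_zero 2 hs)), add_mul, mul_left_comm,
      div_mul_cancel₀ _ (pow_ne_zero 2 hs), hsq]
    field_simp
    ring
  rw [e₁, e₂, hx, hy]
  field_simp
  ring

/-- The additional point when `3 a + 2 b` is three times a square. -/
theorem equation_x₂_pole_t (h3 : (3 : F) ≠ 0) (ht : t ≠ 0) (htq : 3 * t ^ 2 = b + 3 * a)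
    (hmq : 3 * m ^ 2 = 3 * a + 2 * b) {x y : F}
    (hx : x = -(4 / 3) * a ^ 3 * b * (b + 2 * a) / t ^ 2)
    (hy : y = 2 / 3 * a ^ 3 * b * (b + 2 * a) ^ 2 * (b - a) * m / t ^ 3) :
    y ^ 2 = x * (x + a ^ 3 * (a + 2 * b)) * (x + b ^ 3 * (b + 2 * a)) := by
  have ht2 := pow_ne_zero 2 ht
  have e₁ : x + a ^ 3 * (a + 2 * b) = -(a ^ 3 * (b - a) * m ^ 2) / t ^ 2 := by
    rw [hx, eq_div_iff ht2, add_mul, div_mul_cancel₀ _ ht2]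
    field_simp
    linear_combination (a ^ 3 * (a + 2 * b)) * htq + a ^ 3 * (b - a) * hmq
  have e₂ : x + b ^ 3 * (b + 2 * a) = b * (b + 2 * a) ^ 3 * (b - a) / (3 * t ^ 2) := by
    rw [hx, eq_div_iff (mul_ne_zero h3 ht2), add_mul, mul_left_comm, div_mul_cancel₀ _ ht2]
    field_simp
    linear_combination (b ^ 3 * (b + 2 * a)) * htq
  rw [e₁, e₂, hx, hy]
  field_simp
  ring

/-! #### Triples with `q₁ q₂ = 4 a (a + b) / b²` -/

/-- The products of a triple given by `a`, `b` with `3 a + 2 b = 3 s²` and `3 a + b = 3 t²`. -/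
theorem mul_eq_of_triple' (h2 : (2 : F) ≠ 0) (ha : a ≠ 0) (hb : b ≠ 0) (hab : a + b ≠ 0)
    (hs : s ≠ 0) (ht : t ≠ 0) (hsq : 3 * s ^ 2 = 3 * a + 2 * b) (htq : 3 * t ^ 2 = 3 * a + b)
    (h₀ : q 0 = -(3 * b * t * s) / (2 * a * (a + b)))
    (h₁ : q 1 = -(2 * a ^ 2 * s) / (b * t * (a + b)))
    (h₂ : q 2 = -(2 * t * (a + b) ^ 2) / (a * b * s)) :
    q 0 * q 1 = a * (3 * a + 2 * b) / (a + b) ^ 2 ∧ q 0 * q 2 = (a + b) * (3 * a + b) / a ^ 2 ∧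
      q 1 * q 2 = 4 * a * (a + b) / b ^ 2 := by
  rw [h₀, h₁, h₂, ← hsq, ← htq]
  refine ⟨?_, ?_, ?_⟩ <;> field_simp
  ring

/-- The differences of the products `qᵢ qⱼ` are `a³ (a + 2 b)` and `b³ (b + 2 a)` times the square
of `(b + 2 a) / (a b (a + b))`. -/
theorem isSubstitution_of_mul_eq' (ha : a ≠ 0) (hb : b ≠ 0) (hab : a + b ≠ 0)
    (hba : b + 2 * a ≠ 0) (h₀₁ : q 0 * q 1 = a * (3 * a + 2 * b) / (a + b) ^ 2)
    (h₀₂ : q 0 * q 2 = (a + b) * (3 * a + b) / a ^ 2) (h₁₂ : q 1 * q 2 = 4 * a * (a + b) / b ^ 2) :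
    IsSubstitution q ((b + 2 * a) / (a * b * (a + b)))
      (a ^ 3 * (a + 2 * b) + b ^ 3 * (b + 2 * a))
      (a ^ 3 * (a + 2 * b) * (b ^ 3 * (b + 2 * a))) := by
  refine ⟨div_ne_zero hba (mul_ne_zero (mul_ne_zero ha hb) hab), ?_, ?_⟩
  · rw [h₀₁, h₀₂, h₁₂]
    field_simp
    ring
  · rw [h₀₁, h₀₂, h₁₂]
    field_simp
    ring

theorem isSquare_of_mul_eq' (ha : a ≠ 0) (hb : b ≠ 0) (hab : a + b ≠ 0)
    (h₀₁ : q 0 * q 1 = a * (3 * a + 2 * b) / (a + b) ^ 2)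
    (h₀₂ : q 0 * q 2 = (a + b) * (3 * a + b) / a ^ 2) (h₁₂ : q 1 * q 2 = 4 * a * (a + b) / b ^ 2) :
    IsSquare (q 0 * q 1 + 1) ∧ IsSquare (q 0 * q 2 + 1) ∧ IsSquare (q 1 * q 2 + 1) := by
  refine ⟨⟨(b + 2 * a) / (a + b), ?_⟩, ⟨(b + 2 * a) / a, ?_⟩, ⟨(b + 2 * a) / b, ?_⟩⟩
  · rw [h₀₁]; field_simp; ring
  · rw [h₀₂]; field_simp; ring
  · rw [h₁₂]; field_simp; ring

/-- The point whose abscissa is `3 a` times a square. -/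
theorem equation_x₁_of_mul_eq' (hba : b + 2 * a ≠ 0) (hsq : 3 * s ^ 2 = 3 * a + 2 * b)
    (htq : 3 * t ^ 2 = 3 * a + b) {x y : F} (hx : x = 3 * a ^ 3 * b ^ 2 * s ^ 2 / (b + 2 * a) ^ 2)
    (hy : y = 6 * a ^ 3 * b ^ 2 * (a + b) ^ 3 * s * t / (b + 2 * a) ^ 3) :
    y ^ 2 = x * (x + a ^ 3 * (a + 2 * b)) * (x + b ^ 3 * (b + 2 * a)) := by
  have h0 := pow_ne_zero 2 hba
  have e₁ : x + a ^ 3 * (a + 2 * b) = 4 * a ^ 3 * (a + b) ^ 3 / (b + 2 * a) ^ 2 := by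
    rw [hx, eq_div_iff h0, add_mul, div_mul_cancel₀ _ h0]
    linear_combination (a ^ 3 * b ^ 2) * hsq
  have e₂ : x + b ^ 3 * (b + 2 * a) = 3 * b ^ 2 * (a + b) ^ 3 * t ^ 2 / (b + 2 * a) ^ 2 := by
    rw [hx, eq_div_iff h0, add_mul, div_mul_cancel₀ _ h0]
    linear_combination (a ^ 3 * b ^ 2) * hsq - b ^ 2 * (a + b) ^ 3 * htq
  rw [e₁, e₂, hx, hy]
  field_simp
  ring

/-- The additional point when `4 a + 3 b` is a square. -/
theorem equation_x₂_of_mul_eq' (h2 : (2 : F) ≠ 0) (htq : 3 * t ^ 2 = 3 * a + b)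
    (hmq : 4 * m ^ 2 = 4 * a + 3 * b) {x y : F} (hx : x = -(9 / 4) * a ^ 2 * b * t ^ 2)
    (hy : y = 3 / 4 * a ^ 2 * b * (b - a) * t * m * (2 * b + 3 * a)) :
    y ^ 2 = x * (x + a ^ 3 * (a + 2 * b)) * (x + b ^ 3 * (b + 2 * a)) := by
  have h4 : (4 : F) ≠ 0 := by
    rw [show (4 : F) = 2 * 2 by norm_num]; exact mul_ne_zero h2 h2
  have e₁ : x + a ^ 3 * (a + 2 * b) = -(a ^ 2 * (b - a) * m ^ 2) := by
    rw [hx]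
    field_simp
    linear_combination -(3 * a ^ 2 * b) * htq + a ^ 2 * (b - a) * hmq
  have e₂ : x + b ^ 3 * (b + 2 * a) = b * (b - a) * (2 * b + 3 * a) ^ 2 / 4 := by
    rw [hx]
    field_simp
    linear_combination -(3 * a ^ 2 * b) * htq
  rw [e₁, e₂, hx, hy]
  field_simp
  ring

end Identities

end DiophantineCurves

/-! ### The three curves -/

namespace DiophantineCurves

open Polynomial WeierstrassCurve.Affine

namespace FamilyData

variable {n : ℕ} {D : FamilyData n}

theorem algebraMap_listProd (s : List (Fin n)) :
    algebraMap ℤ[X] (RatFunc ℚ) (ofList (D.listProd s)) =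
      (s.map fun i => listEval ((D.f i).map (Int.cast : ℤ → RatFunc ℚ)) RatFunc.X).prod := by
  induction s with
  | nil => simp [listProd]
  | cons i s ih =>
    have h : ofList (D.listProd (i :: s)) = ofList (D.f i) * ofList (D.listProd s) :=
      ofList_listMul _ _
    rw [h, map_mul, ih, algebraMap_ofList, List.map_cons, List.prod_cons]

/-- The curve induced by a triple over `ℚ(w)` has the asserted arithmetic when the substitution of
variables transforms it to the curve given by the data. -/
theorem Valid.inducesRankTwoCurve (hD : D.Valid) {Ts : List (LocalTest n)}
    (hTs : ∀ T ∈ Ts, T.Valid D) {idx : Fin 4 → Fin (n + 2)}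
    (hdet : Detects (Ts.map D.testRow ++ List.ofFn (fun k => bitRow (idx k))))
    {w₀ : ℤ} {ps : List ℕ} (hw : D.Specializes Ts w₀ 11 13 ps)
    {g₁ g₂ : List ℤ} {tests : List (ℤ × ℕ)} (h : D.Separates g₁ g₂ tests)
    {q : Fin 3 → RatFunc ℚ} {a b u A B x₁ y₁ x₂ y₂ : RatFunc ℚ}
    (ha : algebraMap ℤ[X] (RatFunc ℚ) D.a = a) (hb : algebraMap ℤ[X] (RatFunc ℚ) D.b = b)
    (hA : A = a ^ 3 * (a + 2 * b) + b ^ 3 * (b + 2 * a))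
    (hB : B = a ^ 3 * (a + 2 * b) * (b ^ 3 * (b + 2 * a)))
    (hq : IsSubstitution q u (a ^ 3 * (a + 2 * b) + b ^ 3 * (b + 2 * a))
      (a ^ 3 * (a + 2 * b) * (b ^ 3 * (b + 2 * a))))
    (hsq : IsSquare (q 0 * q 1 + 1) ∧ IsSquare (q 0 * q 2 + 1) ∧ IsSquare (q 1 * q 2 + 1))
    (h₁ : y₁ ^ 2 = x₁ * (x₁ + a ^ 3 * (a + 2 * b)) * (x₁ + b ^ 3 * (b + 2 * a)))
    (h₂ : y₂ ^ 2 = x₂ * (x₂ + a ^ 3 * (a + 2 * b)) * (x₂ + b ^ 3 * (b + 2 * a)))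
    (hx₁ : x₁ ≠ 0) (hx₂ : x₂ ≠ 0)
    (hg₁ : IsSquare (x₁ * listEval (g₁.map (Int.cast : ℤ → RatFunc ℚ)) RatFunc.X))
    (hg₂ : IsSquare (x₂ * listEval (g₂.map (Int.cast : ℤ → RatFunc ℚ)) RatFunc.X)) :
    InducesRankTwoCurve q A B x₁ x₂ := by
  have hM : a ^ 3 * (a + 2 * b) = algebraMap ℤ[X] (RatFunc ℚ) D.M := by
    rw [← ha, ← hb]
    simp only [M, map_mul, map_pow, map_add, map_ofNat]
  have hN : b ^ 3 * (b + 2 * a) = algebraMap ℤ[X] (RatFunc ℚ) D.N := by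
    rw [← ha, ← hb]
    simp only [N, map_mul, map_pow, map_add, map_ofNat]
  rw [hM, hN] at hA hB hq h₁ h₂
  subst hA hB
  rw [← algebraMap_ofList] at hg₁ hg₂
  have hS := hD.isSplit (RatFunc ℚ)
  obtain ⟨ht, hr, hi⟩ := hD.torsion_rank_independent hTs idx hdet hw (by decide) h
    (hS.nonsingular h₁) (hS.nonsingular h₂) hx₁ hx₂ hg₁ hg₂
  exact inducesRankTwoCurve_of_substitution
    (hq.isDiophantineTriple hS.discr_ne_zero hsq.1 hsq.2.1 hsq.2.2) hq hS.discr_ne_zero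
    _ _ ht hr hi

theorem Valid.ne_zero_of_algebraMap_eq (hD : D.Valid) {a b : RatFunc ℚ}
    (ha : algebraMap ℤ[X] (RatFunc ℚ) D.a = a) (hb : algebraMap ℤ[X] (RatFunc ℚ) D.b = b) :
    a ≠ 0 ∧ b ≠ 0 ∧ a + b ≠ 0 ∧ a + 2 * b ≠ 0 ∧ b + 2 * a ≠ 0 := by
  have h0 : ∀ g : ℤ[X], g ≠ 0 → algebraMap ℤ[X] (RatFunc ℚ) g ≠ 0 := fun g hg h => hg
    ((IsFractionRing.to_map_eq_zero_iff (K := RatFunc ℚ)).1 h)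
  subst ha hb
  refine ⟨h0 _ hD.a_ne_zero, h0 _ hD.b_ne_zero, ?_, ?_, ?_⟩
  · rw [← map_add]
    exact h0 _ hD.add_ne_zero
  · have := h0 _ (right_ne_zero_of_mul hD.M_ne_zero)
    simpa only [map_add, map_mul, map_ofNat] using this
  · have := h0 _ (right_ne_zero_of_mul hD.N_ne_zero)
    simpa only [map_add, map_mul, map_ofNat] using this

end FamilyData

theorem quadratic_ratFunc_ne_zero (c d : ℤ) (hc : c ≠ 0) :
    ((c : RatFunc ℚ) + (d : RatFunc ℚ) * RatFunc.X + RatFunc.X ^ 2) ≠ 0 := by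
  have := listEval_ratFunc_ne_zero (l := [c, d, 1]) 0 (by simpa [listEval] using hc)
  simp only [listEval, List.map, List.foldr] at this
  convert this using 1
  push_cast
  ring

theorem first_inducesRankTwoCurve : InducesRankTwoCurve (firstTriple (RatFunc.X : RatFunc ℚ))
    (firstA RatFunc.X) (firstB RatFunc.X) (firstX₁ RatFunc.X) (firstX₂ RatFunc.X) := by
  have hs : (-1 + 6 * RatFunc.X + RatFunc.X ^ 2 : RatFunc ℚ) ≠ 0 := by
    simpa [sub_eq_add_neg] using quadratic_ratFunc_ne_zero (-1) (6) (by norm_num)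
  have ht : (-5 - 2 * RatFunc.X + RatFunc.X ^ 2 : RatFunc ℚ) ≠ 0 := by
    simpa [sub_eq_add_neg] using quadratic_ratFunc_ne_zero (-5) (-2) (by norm_num)
  have ha : algebraMap ℤ[X] (RatFunc ℚ) firstData.a =
      (-7 + RatFunc.X) * (-2 + RatFunc.X) * (1 + RatFunc.X) * (2 + RatFunc.X) := by
    refine (FamilyData.algebraMap_listProd _).trans ?_
    simp [firstData, listEval]
    ring
  have hb : algebraMap ℤ[X] (RatFunc ℚ) firstData.b =
      3 * ((-1 + RatFunc.X) * (3 + RatFunc.X) * (1 + 2 * RatFunc.X)) := by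
    refine (FamilyData.algebraMap_listProd _).trans ?_
    simp [firstData, listEval]
    ring
  obtain ⟨ha0, hb0, -, hab0, hba0⟩ := firstData_valid.ne_zero_of_algebraMap_eq ha hb
  set w : RatFunc ℚ := RatFunc.X
  set a := (-7 + w) * (-2 + w) * (1 + w) * (2 + w) with hadef
  set b := 3 * ((-1 + w) * (3 + w) * (1 + 2 * w)) with hbdef
  set s := -1 + 6 * w + w ^ 2 with hsdef
  set t := -5 - 2 * w + w ^ 2 with htdef
  have hsq : s ^ 2 = a + 3 * b := by rw [hsdef, hadef, hbdef]; ring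
  have htq : 3 * t ^ 2 = b + 3 * a := by rw [htdef, hadef, hbdef]; ring
  have hmq : 3 * (4 + w + w ^ 2) ^ 2 = 3 * a + 4 * b := by rw [hadef, hbdef]; ring
  have hq₀ : firstTriple w 0 = -(a * s) / (2 * b * t) := by
    simp only [firstTriple, Matrix.cons_val]
    congr 1
    rw [hbdef, htdef]
    ring
  have hq₁ : firstTriple w 1 = 3 * b * t / (2 * a * s) := by
    simp only [firstTriple, Matrix.cons_val]
    congr 1
    · rw [hbdef, htdef]; ring
    · rw [hadef, hsdef]; ring
  have hq₂ : firstTriple w 2 = -(t * s * (a - b)) / (2 * a * b) := by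
    simp only [firstTriple, Matrix.cons_val]
    congr 1
    · rw [hadef, hbdef, htdef, hsdef]; ring
    · rw [hadef, hbdef]; ring
  obtain ⟨h₀₁, h₀₂, h₁₂⟩ := mul_eq_of_triple two_ne_zero ha0 hb0 hs ht hsq htq hq₀ hq₁ hq₂
  have hx₁ : firstX₁ w = -3 * a ^ 2 * b ^ 2 := by rw [firstX₁, hadef, hbdef]; ring
  have hx₂ : firstX₂ w = -(4 / 3) * a ^ 2 * b * (a + 2 * b) * (b + 2 * a) / s ^ 2 := by
    have e₁ : 10 + 19 * w ^ 2 + 6 * w ^ 3 + w ^ 4 = a + 2 * b := by rw [hadef, hbdef]; ring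
    have e₂ : 47 + 36 * w - 7 * w ^ 2 - 6 * w ^ 3 + 2 * w ^ 4 = b + 2 * a := by
      rw [hadef, hbdef]; ring
    rw [firstX₂, e₁, e₂, ← hsdef, hadef, hbdef]
    ring
  refine firstData_valid.inducesRankTwoCurve firstTests_valid firstTests_detects
    firstData_specializes firstData_separates ha hb ?_ ?_
    (isSubstitution_of_mul_eq two_ne_zero ha0 hb0 h₀₁ h₀₂ h₁₂)
    (isSquare_of_mul_eq two_ne_zero ha0 hb0 h₀₁ h₀₂ h₁₂)
    (by rw [hx₁]; exact equation_x₁_of_mul_eq hsq htq)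
    (equation_x₂_pole_s three_ne_zero hs hsq hmq hx₂ rfl) ?_ ?_ ⟨3 * a * b, ?_⟩
    ⟨2 / 3 * a * b * (a + 2 * b) * (b + 2 * a) / s, ?_⟩
  · rw [firstA, hadef, hbdef]; ring
  · rw [firstB, hadef, hbdef]; ring
  · rw [hx₁]
    simp [ha0, hb0]
  · rw [hx₂]
    simp [ha0, hb0, hab0, hba0, hs]
  · rw [hx₁]
    simp [firstClass₁, listEval]
    ring
  · have : listEval (firstClass₂.map (Int.cast : ℤ → RatFunc ℚ)) w =
        -(b / 3 * (a + 2 * b) * (b + 2 * a)) := by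
      simp only [firstClass₂, listEval, List.map, List.foldr]
      push_cast
      rw [hadef, hbdef]
      ring
    rw [hx₂, this]
    field_simp
    norm_num

theorem second_inducesRankTwoCurve : InducesRankTwoCurve (secondTriple (RatFunc.X : RatFunc ℚ))
    (secondA RatFunc.X) (secondB RatFunc.X) (secondX₁ RatFunc.X) (secondX₂ RatFunc.X) := by
  have hs : (-5 + 6 * RatFunc.X + RatFunc.X ^ 2 : RatFunc ℚ) ≠ 0 := by
    simpa [sub_eq_add_neg] using quadratic_ratFunc_ne_zero (-5) (6) (by norm_num)
  have ht : (-1 - 2 * RatFunc.X + RatFunc.X ^ 2 : RatFunc ℚ) ≠ 0 := by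
    simpa [sub_eq_add_neg] using quadratic_ratFunc_ne_zero (-1) (-2) (by norm_num)
  have ha : algebraMap ℤ[X] (RatFunc ℚ) secondData.a =
      (-2 + RatFunc.X ^ 2) * (1 - 6 * RatFunc.X + RatFunc.X ^ 2) := by
    refine (FamilyData.algebraMap_listProd _).trans ?_
    simp [secondData, listEval]
    ring
  have hb : algebraMap ℤ[X] (RatFunc ℚ) secondData.b =
      3 * ((-1 + RatFunc.X) * (3 + RatFunc.X) * (-1 + 2 * RatFunc.X)) := by
    refine (FamilyData.algebraMap_listProd _).trans ?_
    simp [secondData, listEval]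
    ring
  obtain ⟨ha0, hb0, -, -, hba0⟩ := secondData_valid.ne_zero_of_algebraMap_eq ha hb
  set w : RatFunc ℚ := RatFunc.X
  set a := (-2 + w ^ 2) * (1 - 6 * w + w ^ 2) with hadef
  set b := 3 * ((-1 + w) * (3 + w) * (-1 + 2 * w)) with hbdef
  set s := -5 + 6 * w + w ^ 2 with hsdef
  set t := -1 - 2 * w + w ^ 2 with htdef
  have hsq : s ^ 2 = a + 3 * b := by rw [hsdef, hadef, hbdef]; ring
  have htq : 3 * t ^ 2 = b + 3 * a := by rw [htdef, hadef, hbdef]; ring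
  have hmq : 3 * (2 - w + w ^ 2) ^ 2 = 3 * a + 2 * b := by rw [hadef, hbdef]; ring
  have hq₀ : secondTriple w 0 = -(a * s) / (2 * b * t) := by
    simp only [secondTriple, Matrix.cons_val]
    congr 1
    rw [hbdef, htdef]
    ring
  have hq₁ : secondTriple w 1 = 3 * b * t / (2 * a * s) := by
    simp only [secondTriple, Matrix.cons_val]
    congr 1
    · rw [hbdef, htdef]; ring
    · rw [hadef, hsdef]; ring
  have hq₂ : secondTriple w 2 = -(t * s * (a - b)) / (2 * a * b) := by
    simp only [secondTriple, Matrix.cons_val]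
    congr 1
    · rw [hadef, hbdef, htdef, hsdef]; ring
    · rw [hadef, hbdef]; ring
  obtain ⟨h₀₁, h₀₂, h₁₂⟩ := mul_eq_of_triple two_ne_zero ha0 hb0 hs ht hsq htq hq₀ hq₁ hq₂
  have hx₁ : secondX₁ w = -3 * a ^ 2 * b ^ 2 := by rw [secondX₁, hadef, hbdef]; ring
  have hx₂ : secondX₂ w = -(4 / 3) * a ^ 3 * b * (b + 2 * a) / t ^ 2 := by
    have e₂ : 5 + 7 * w ^ 2 - 6 * w ^ 3 + 2 * w ^ 4 = b + 2 * a := by rw [hadef, hbdef]; ring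
    rw [secondX₂, e₂, ← htdef, hadef, hbdef]
    ring
  refine secondData_valid.inducesRankTwoCurve secondTests_valid secondTests_detects
    secondData_specializes secondData_separates ha hb ?_ ?_
    (isSubstitution_of_mul_eq two_ne_zero ha0 hb0 h₀₁ h₀₂ h₁₂)
    (isSquare_of_mul_eq two_ne_zero ha0 hb0 h₀₁ h₀₂ h₁₂)
    (by rw [hx₁]; exact equation_x₁_of_mul_eq hsq htq)
    (equation_x₂_pole_t three_ne_zero ht htq hmq hx₂ rfl) ?_ ?_ ⟨3 * a * b, ?_⟩
    ⟨2 / 3 * a ^ 2 * b * (b + 2 * a) / t, ?_⟩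
  · rw [secondA, hadef, hbdef]; ring
  · rw [secondB, hadef, hbdef]; ring
  · rw [hx₁]
    simp [ha0, hb0]
  · rw [hx₂]
    simp [ha0, hb0, hba0, ht]
  · rw [hx₁]
    simp [secondClass₁, listEval]
    ring
  · have : listEval (secondClass₂.map (Int.cast : ℤ → RatFunc ℚ)) w =
        -(a * (b / 3) * (b + 2 * a)) := by
      simp only [secondClass₂, listEval, List.map, List.foldr]
      push_cast
      rw [hadef, hbdef]
      ring
    rw [hx₂, this]
    field_simp
    norm_num

theorem third_inducesRankTwoCurve : InducesRankTwoCurve (thirdTriple (RatFunc.X : RatFunc ℚ))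
    (thirdA RatFunc.X) (thirdB RatFunc.X) (thirdX₁ RatFunc.X) (thirdX₂ RatFunc.X) := by
  have hs : (2 + 2 * RatFunc.X + RatFunc.X ^ 2 : RatFunc ℚ) ≠ 0 := by
    simpa [sub_eq_add_neg] using quadratic_ratFunc_ne_zero (2) (2) (by norm_num)
  have ht : (-4 - 2 * RatFunc.X + RatFunc.X ^ 2 : RatFunc ℚ) ≠ 0 := by
    simpa [sub_eq_add_neg] using quadratic_ratFunc_ne_zero (-4) (-2) (by norm_num)
  have ha : algebraMap ℤ[X] (RatFunc ℚ) thirdData.a =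
      (-2 + RatFunc.X ^ 2) * (-14 - 12 * RatFunc.X + RatFunc.X ^ 2) := by
    refine (FamilyData.algebraMap_listProd _).trans ?_
    simp [thirdData, listEval]
    ring
  have hb : algebraMap ℤ[X] (RatFunc ℚ) thirdData.b =
      12 * ((-1 + RatFunc.X) * (1 + RatFunc.X) * (3 + 2 * RatFunc.X)) := by
    refine (FamilyData.algebraMap_listProd _).trans ?_
    simp [thirdData, listEval]
    ring
  obtain ⟨ha0, hb0, hab0, -, hba0⟩ := thirdData_valid.ne_zero_of_algebraMap_eq ha hb
  set w : RatFunc ℚ := RatFunc.X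
  set a := (-2 + w ^ 2) * (-14 - 12 * w + w ^ 2) with hadef
  set b := 12 * ((-1 + w) * (1 + w) * (3 + 2 * w)) with hbdef
  set s := 2 + 2 * w + w ^ 2 with hsdef
  set t := -4 - 2 * w + w ^ 2 with htdef
  have hsq : 3 * s ^ 2 = 3 * a + 2 * b := by rw [hsdef, hadef, hbdef]; ring
  have htq : 3 * t ^ 2 = 3 * a + b := by rw [htdef, hadef, hbdef]; ring
  have hmq : 4 * (1 + 3 * w + w ^ 2) ^ 2 = 4 * a + 3 * b := by rw [hadef, hbdef]; ring
  have hv : -8 + 20 * w ^ 2 + 12 * w ^ 3 + w ^ 4 = a + b := by rw [hadef, hbdef]; ring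
  have hb' : (-1 + w) * (1 + w) * (3 + 2 * w) = b / 12 := by rw [hbdef]; ring
  have hq₀ : thirdTriple w 0 = -(3 * b * t * s) / (2 * a * (a + b)) := by
    have e : thirdTriple w 0 = -(18 * ((-1 + w) * (1 + w) * (3 + 2 * w)) * t * s) /
        (a * (-8 + 20 * w ^ 2 + 12 * w ^ 3 + w ^ 4)) := by
      simp only [thirdTriple, Matrix.cons_val]
      congr 1
      rw [hsdef, htdef]
      ring
    rw [e, hv, hb']
    field_simp
    norm_num
  have hq₁ : thirdTriple w 1 = -(2 * a ^ 2 * s) / (b * t * (a + b)) := by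
    have e : thirdTriple w 1 = -(a ^ 2 * s) / (6 * ((-1 + w) * (1 + w) * (3 + 2 * w)) * t *
        (-8 + 20 * w ^ 2 + 12 * w ^ 3 + w ^ 4)) := by
      simp only [thirdTriple, Matrix.cons_val]
      congr 1
      · rw [hsdef, hadef]; ring
      · rw [htdef]; ring
    rw [e, hv, hb']
    field_simp
    norm_num
  have hq₂ : thirdTriple w 2 = -(2 * t * (a + b) ^ 2) / (a * b * s) := by
    have e : thirdTriple w 2 = -(t * (-8 + 20 * w ^ 2 + 12 * w ^ 3 + w ^ 4) ^ 2) /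
        (6 * ((-1 + w) * (1 + w) * (3 + 2 * w)) * a * s) := by
      simp only [thirdTriple, Matrix.cons_val]
      congr 1
      rw [hsdef, hadef]
      ring
    rw [e, hv, hb']
    field_simp
    norm_num
  obtain ⟨h₀₁, h₀₂, h₁₂⟩ := mul_eq_of_triple' two_ne_zero ha0 hb0 hab0 hs ht hsq htq hq₀ hq₁ hq₂
  have hx₁ : thirdX₁ w = 3 * a ^ 3 * b ^ 2 * s ^ 2 / (b + 2 * a) ^ 2 := by
    have e : thirdX₁ w = 108 * ((-1 + w) * (1 + w) * (3 + 2 * w)) ^ 2 * a ^ 3 * s ^ 2 /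
        (10 + 12 * w + 2 * w ^ 2 + w ^ 4) ^ 2 := by
      rw [thirdX₁]
      congr 1
      rw [hsdef, hadef]
      ring
    have e₁ : 10 + 12 * w + 2 * w ^ 2 + w ^ 4 = (b + 2 * a) / 2 := by rw [hadef, hbdef]; ring
    rw [e, e₁, hb']
    field_simp
    norm_num
  have hx₂ : thirdX₂ w = -(9 / 4) * a ^ 2 * b * t ^ 2 := by
    rw [thirdX₂, hadef, hbdef, htdef]
    ring
  refine thirdData_valid.inducesRankTwoCurve thirdTests_valid thirdTests_detects
    thirdData_specializes thirdData_separates ha hb ?_ ?_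
    (isSubstitution_of_mul_eq' ha0 hb0 hab0 hba0 h₀₁ h₀₂ h₁₂)
    (isSquare_of_mul_eq' ha0 hb0 hab0 h₀₁ h₀₂ h₁₂)
    (equation_x₁_of_mul_eq' hba0 hsq htq hx₁ rfl)
    (equation_x₂_of_mul_eq' two_ne_zero htq hmq hx₂ rfl) ?_ ?_
    ⟨3 * a ^ 2 * b * s / (b + 2 * a), ?_⟩ ⟨3 / 4 * a * b * t, ?_⟩
  · rw [thirdA, hadef, hbdef]; ring
  · rw [thirdB, hadef, hbdef]; ring
  · rw [hx₁]
    simp [ha0, hb0, hs, hba0]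
  · rw [hx₂]
    simp [ha0, hb0, ht]
  · have : listEval (thirdClass₁.map (Int.cast : ℤ → RatFunc ℚ)) w = 3 * a := by
      simp only [thirdClass₁, listEval, List.map, List.foldr]
      push_cast
      rw [hadef]
      ring
    rw [hx₁, this]
    field_simp
  · have : listEval (thirdClass₂.map (Int.cast : ℤ → RatFunc ℚ)) w = -b / 4 := by
      simp only [thirdClass₂, listEval, List.map, List.foldr]
      push_cast
      rw [hbdef]
      ring
    rw [hx₂, this]
    field_simp
    norm_num

end DiophantineCurves

theorem mainTheorem4 :
    DiophantineCurves.InducesRankTwoCurve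
      (DiophantineCurves.firstTriple (RatFunc.X : RatFunc ℚ))
      (DiophantineCurves.firstA RatFunc.X) (DiophantineCurves.firstB RatFunc.X)
      (DiophantineCurves.firstX₁ RatFunc.X) (DiophantineCurves.firstX₂ RatFunc.X) ∧
    DiophantineCurves.InducesRankTwoCurve
      (DiophantineCurves.secondTriple (RatFunc.X : RatFunc ℚ))
      (DiophantineCurves.secondA RatFunc.X) (DiophantineCurves.secondB RatFunc.X)
      (DiophantineCurves.secondX₁ RatFunc.X) (DiophantineCurves.secondX₂ RatFunc.X) ∧
    DiophantineCurves.InducesRankTwoCurve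
      (DiophantineCurves.thirdTriple (RatFunc.X : RatFunc ℚ))
      (DiophantineCurves.thirdA RatFunc.X) (DiophantineCurves.thirdB RatFunc.X)
      (DiophantineCurves.thirdX₁ RatFunc.X) (DiophantineCurves.thirdX₂ RatFunc.X) :=
  ⟨DiophantineCurves.first_inducesRankTwoCurve, DiophantineCurves.second_inducesRankTwoCurve,
    DiophantineCurves.third_inducesRankTwoCurve⟩
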